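/- **Setting.** Let $n\ge 1$, let $M$ be a smooth (Hausdorff, second countable) $(n+1)$-dimensional manifold, and let $(\tau,h)$ be a Galilei structure on $M$: $\tau$ is a smooth nowhere vanishing one-form (clock form), $h$ is a smooth symmetric contravariant 2-tensor field (space metric) which is positive semidefinite of rank $n$ at every point, and $\tau_\mu h^{\mu\nu}=0$. Frame indices $A,B,C$ run over $\{t,1,\dots,n\}$, spatial frame indices $a,b,c$ over $\{1,\dots,n\}$, and one sums over repeated indices. Let $\mathsf{Gal}=\{\begin{pmatrix}1&0\\k&R\end{pmatrix}: R\in O(n),\,k\in\mathbb R^n\}\subset \mathsf{GL}(n+1)$ be the (homogeneous) Galilei group and $\mathfrak{gal}=\{\begin{pmatrix}0&0\\k&X\end{pmatrix}: X\in\mathfrak{so}(n),\,k\in\mathbb R^n\}\subset\mathfrak{gl}(n+1)$ its Lie algebra. Let $\rho:\mathsf{Gal}\to \mathsf{Aut}(\mathfrak{gl}(n+1))$ be the restriction of the adjoint representation of $\mathsf{GL}(n+1)$, and let $\tilde\rho$ be the induced representation on the quotient vector space $\mathfrak{gl}(n+1)/\mathfrak{gal}$ (the subspace $\mathfrak{gal}$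 is $\rho$-invariant). Let $F(M)$ be the bundle of linear frames of $M$, with right action $(e_A)\cdot g=(e_B\,g^B{}_A)$ of $\mathsf{GL}(n+1)$. A frame $(e_t,e_1,\dots,e_n)=(v,e_a)$ of $T_xM$ is a Galilei frame if $\tau(v)=1$ and $h=\delta^{ab}e_a\otimes e_b$; the Galilei frames form the sub-bundle $G(M)\subset F(M)$, on which $\mathsf{Gal}$ acts. Write $(e^A)$ for the dual frame of $(e_A)$ and $\pi$ for the projection to $M$. For an affine connection $\nabla$ on $M$, put $\hat Q=\nabla\tau$ and $Q=\nabla h$, viewed as one-forms with values in $T^*M$ and $\bigvee^2TM$: $\hat Q(X)(Y)=(\nabla_X\tau)(Y)$ and $Q(X)(\alpha,\beta)=(\nabla_X h)(\alpha,\beta)$. For a unit timelike vector field $v$ ($\tau(v)=1$), let $h_{\mu\nu}$ be the covariant space metric with respect to $v$, i.e. the symmetric tensor with $h_{\mu\nu}v^\nu=0$ and $h_{\mu\nu}h^{\nu\rho}=\delta_\mu^\rho-v^\rho\tau_\mu$. The Newton–Coriolis form $\Omega$ of $\nabla$ with respect to $v$ is the two-form $\Omega_{\mu\nu}=2(\nabla_{[\mu}v^\rho)h_{\nu]\rho}=(\nabla_\mu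 v^\rho)h_{\nu\rho}-(\nabla_\nu v^\rho)h_{\mu\rho}$. An affine connection $\nabla$ and a principal connection form $\hat{\boldsymbol\omega}$ on $F(M)$ correspond to each other if $\nabla e_B=\omega^A{}_B\otimes e_A$ for every smooth local frame $\hat\sigma=(e_A)$, where $(\omega^A{}_B)=\hat\sigma^*\hat{\boldsymbol\omega}$. **Theorem.** 1. *Correspondence.* This relation is a bijection between affine connections $\nabla$ on $M$ and principal connection forms $\hat{\boldsymbol\omega}$ on $F(M)$. Pullback $\hat{\boldsymbol\omega}\mapsto\boldsymbol\omega$ along the inclusion $G(M)\hookrightarrow F(M)$ is a bijection from the principal connection forms on $F(M)$ onto the smooth $\mathfrak{gl}(n+1)$-valued one-forms $\boldsymbol\omega$ on $G(M)$ satisfying (i) $\mathrm R_g^*\boldsymbol\omega=\rho_{g^{-1}}\circ\boldsymbol\omega$ for all $g\in\mathsf{Gal}$, where $\mathrm R_g$ is the right translation of $G(M)$ by $g$; (ii) evaluated on the fundamental vector field on $G(M)$ of an element of $\mathfrak{gal}$, the form $\boldsymbol\omega$ yields that element as a matrix in $\mathfrak{gl}(n+1)$. 2. *Projection.* For every form $\boldsymbol\omega$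 as in 1, its composition $\boldsymbol\omega+\mathfrak{gal}$ with the projection $\mathfrak{gl}(n+1)\to\mathfrak{gl}(n+1)/\mathfrak{gal}$ is a tensorial one-form on $G(M)$ for $\tilde\rho$: it is smooth, $\tilde\rho$-equivariant, and vanishes on vertical vectors. 3. *Encoding of the non-metricities.* There is an injective linear map $\Psi:\mathfrak{gl}(n+1)/\mathfrak{gal}\to\mathbb R^{n+1}\times\mathbb R^{(n+1)\times(n+1)}$ such that, for every affine connection $\nabla$ with its corresponding form $\boldsymbol\omega$, every $e=(e_A)\in G(M)$ and every $\xi\in T_eG(M)$, $$\Psi\big(\boldsymbol\omega_e(\xi)+\mathfrak{gal}\big)=\Big(\big(\hat Q(d\pi\,\xi)(e_A)\big)_A,\ \big(Q(d\pi\,\xi)(e^A,e^B)\big)_{A,B}\Big).$$ 4. *Local expressions.* Let $\nabla$ be an affine connection with corresponding form $\boldsymbol\omega$, let $\sigma=(e_A)=(v,e_a)$ be a smooth local Galilei frame on an open set $U\subset M$, and let $\omega=(\omega^A{}_B)=\sigma^*\boldsymbol\omega$. Then $\omega$ is a smooth $\mathfrak{gl}(n+1)$-valued one-form on $U$, it is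 the local connection form of $\nabla$, i.e. $\nabla e_B=\omega^A{}_B\otimes e_A$, and, with $\tau_A=\tau(e_A)$ and $h^{AB}=h(e^A,e^B)$, $$\hat Q_A=d\tau_A-\omega^B{}_A\,\tau_B=-\omega^t{}_A,$$ $$Q^{AB}=dh^{AB}+\omega^A{}_C\,h^{CB}+\omega^B{}_C\,h^{AC}=\omega^A{}_c\,\delta^{cb}\delta^B_b+\omega^B{}_c\,\delta^{ac}\delta^A_a;$$ explicitly $$Q^{tt}=0,\qquad Q^{ta}=Q^{at}=\omega^t{}_a,\qquad Q^{ab}=\omega^a{}_b+\omega^b{}_a.$$ The Newton–Coriolis form of $\nabla$ with respect to $v=e_t$ is $$\Omega=\delta_{ab}\,\varpi^a\wedge e^b,\qquad \varpi^a=\omega^a{}_t .$$ -/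

import Mathlib

open Bundle Manifold ContDiff Topology

noncomputable section

namespace Galilei

/-! ### Matrices: the Galilei group and the Galilei algebra -/

/-- The index set `{t, 1, …, n}` of frames; `t` is `Sum.inl ()`. -/
abbrev Idx (n : ℕ) : Type := Unit ⊕ Fin n

/-- The frame index `t`. -/
abbrev idxT {n : ℕ} : Idx n := Sum.inl ()

/-- The spatial frame index `a`. -/
abbrev idxS {n : ℕ} (a : Fin n) : Idx n := Sum.inr a

/-- `𝔤𝔩(n+1)`. -/
abbrev Gl (n : ℕ) : Type := Matrix (Idx n) (Idx n) ℝ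

/-- The matrix `(1 0; k R)`. -/
def galGroupMatrix {n : ℕ} (R : Matrix (Fin n) (Fin n) ℝ) (k : Fin n → ℝ) : Gl n :=
  Matrix.fromBlocks 1 0 (Matrix.of fun a _ => k a) R

/-- The matrix `(0 0; k X)`. -/
def galAlgMatrix {n : ℕ} (X : Matrix (Fin n) (Fin n) ℝ) (k : Fin n → ℝ) : Gl n :=
  Matrix.fromBlocks 0 0 (Matrix.of fun a _ => k a) X

/-- The frame components `δ^{ab} δ^A_a δ^B_b` of a space metric. -/
def spaceDiag (n : ℕ) : Gl n := Matrix.fromBlocks 0 0 0 1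

theorem exists_galGroupMatrix_iff {n : ℕ} (g : Gl n) :
    (∃ R ∈ Matrix.orthogonalGroup (Fin n) ℝ, ∃ k, g = galGroupMatrix R k) ↔
      (∀ B, g idxT B = (1 : Gl n) idxT B) ∧ g * spaceDiag n * g.transpose = spaceDiag n := by
  constructor
  · rintro ⟨R, hR, k, rfl⟩
    rw [Matrix.mem_orthogonalGroup_iff] at hR
    constructor
    · rintro (⟨⟩ | b) <;> simp [galGroupMatrix]
    · simp [galGroupMatrix, spaceDiag, Matrix.fromBlocks_multiply, Matrix.fromBlocks_transpose]
      simpa [Matrix.star_eq_conjTranspose] using hR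
  · rintro ⟨h1, h2⟩
    have hg : g = galGroupMatrix g.toBlocks₂₂ (fun a => g (idxS a) idxT) := by
      ext (⟨⟩ | a) (⟨⟩ | b)
      · simpa [galGroupMatrix] using h1 idxT
      · simpa [galGroupMatrix] using h1 (idxS b)
      · simp [galGroupMatrix]
      · simp [galGroupMatrix, Matrix.toBlocks₂₂]
    refine ⟨g.toBlocks₂₂, ?_, _, hg⟩
    rw [Matrix.mem_orthogonalGroup_iff]
    rw [hg] at h2
    simp only [galGroupMatrix, spaceDiag, Matrix.fromBlocks_multiply,
      Matrix.fromBlocks_transpose] at h2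
    have := congrArg Matrix.toBlocks₂₂ h2
    simpa [Matrix.star_eq_conjTranspose] using this

/-- The homogeneous Galilei group `O(n) ⋉ ℝⁿ` as a subgroup of `GL(n+1)`. -/
def galGroup (n : ℕ) : Subgroup (GL (Idx n) ℝ) where
  carrier := {g | ∃ R ∈ Matrix.orthogonalGroup (Fin n) ℝ, ∃ k, (g : Gl n) = galGroupMatrix R k}
  mul_mem' := by
    intro a b ha hb
    simp only [Set.mem_ofPred_eq, exists_galGroupMatrix_iff] at *
    refine ⟨fun B => ?_, ?_⟩
    · rw [← hb.1 B]
      simp [Matrix.mul_apply, ha.1, Matrix.one_apply]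
    · calc (a * b : Gl n) * spaceDiag n * (a * b : Gl n).transpose
          = a * (b * spaceDiag n * (b : Gl n).transpose) * (a : Gl n).transpose := by
            simp [Matrix.mul_assoc, Matrix.transpose_mul]
        _ = spaceDiag n := by rw [hb.2, ha.2]
  one_mem' := by
    simp [exists_galGroupMatrix_iff]
  inv_mem' := by
    intro a ha
    simp only [Set.mem_ofPred_eq, exists_galGroupMatrix_iff] at *
    have hi : ((a⁻¹ : GL (Idx n) ℝ) : Gl n) * (a : Gl n) = 1 := by simp
    have hi' : (a : Gl n) * ((a⁻¹ : GL (Idx n) ℝ) : Gl n) = 1 := by simp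
    refine ⟨fun B => ?_, ?_⟩
    · rw [← hi']
      simp [Matrix.mul_apply, ha.1, Matrix.one_apply]
    · conv_lhs => rw [← ha.2]
      set b : Gl n := ((a⁻¹ : GL (Idx n) ℝ) : Gl n)
      calc b * ((a : Gl n) * spaceDiag n * (a : Gl n).transpose) * b.transpose
          = (b * a) * spaceDiag n * (b * a).transpose := by
            simp [Matrix.mul_assoc, Matrix.transpose_mul]
        _ = spaceDiag n := by simp [hi]

theorem exists_galAlgMatrix_iff {n : ℕ} (Y : Gl n) :
    (∃ X ∈ LieAlgebra.Orthogonal.so (Fin n) ℝ, ∃ k, Y = galAlgMatrix X k) ↔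
      (∀ B, Y idxT B = 0) ∧ Y * spaceDiag n + spaceDiag n * Y.transpose = 0 := by
  simp only [LieAlgebra.Orthogonal.mem_so]
  constructor
  · rintro ⟨X, hX, k, rfl⟩
    constructor
    · rintro (⟨⟩ | b) <;> simp [galAlgMatrix]
    · simp [galAlgMatrix, spaceDiag, Matrix.fromBlocks_multiply, Matrix.fromBlocks_transpose,
        Matrix.fromBlocks_add, hX]
  · rintro ⟨h1, h2⟩
    have hg : Y = galAlgMatrix Y.toBlocks₂₂ (fun a => Y (idxS a) idxT) := by
      ext (⟨⟩ | a) (⟨⟩ | b)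
      · simpa [galAlgMatrix] using h1 idxT
      · simpa [galAlgMatrix] using h1 (idxS b)
      · simp [galAlgMatrix]
      · simp [galAlgMatrix, Matrix.toBlocks₂₂]
    refine ⟨Y.toBlocks₂₂, ?_, _, hg⟩
    rw [hg] at h2
    simp only [galAlgMatrix, spaceDiag, Matrix.fromBlocks_multiply,
      Matrix.fromBlocks_transpose, Matrix.fromBlocks_add] at h2
    have := congrArg Matrix.toBlocks₂₂ h2
    rw [eq_neg_iff_add_eq_zero, add_comm]
    ext a b
    have h3 := congrFun (congrFun this a) b
    simpa [Matrix.toBlocks₂₂] using h3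

/-- The Galilei algebra `𝔰𝔬(n) ⋉ ℝⁿ` as a subspace of `𝔤𝔩(n+1)`. -/
def galAlg (n : ℕ) : Submodule ℝ (Gl n) where
  carrier := {Y | ∃ X ∈ LieAlgebra.Orthogonal.so (Fin n) ℝ, ∃ k, Y = galAlgMatrix X k}
  add_mem' := by
    intro a b ha hb
    simp only [Set.mem_ofPred_eq, exists_galAlgMatrix_iff] at *
    refine ⟨fun B => by simp [ha.1, hb.1], ?_⟩
    rw [Matrix.transpose_add, add_mul, mul_add, add_add_add_comm, ha.2, hb.2, add_zero]
  zero_mem' := by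
    simp only [Set.mem_ofPred_eq, exists_galAlgMatrix_iff]
    simp
  smul_mem' := by
    intro c a ha
    simp only [Set.mem_ofPred_eq, exists_galAlgMatrix_iff] at *
    refine ⟨fun B => by simp [ha.1], ?_⟩
    rw [Matrix.transpose_smul, smul_mul_assoc, mul_smul_comm, ← smul_add, ha.2, smul_zero]

/-- The adjoint representation of `GL(n+1)` on `𝔤𝔩(n+1)`. -/
def adRep (n : ℕ) : Representation ℝ (GL (Idx n) ℝ) (Gl n) where
  toFun g :=
    { toFun := fun X => (g : Gl n) * X * ((g⁻¹ : GL (Idx n) ℝ) : Gl n)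
      map_add' := fun X Y => by rw [mul_add, add_mul]
      map_smul' := fun c X => by simp }
  map_one' := by ext1 X; simp
  map_mul' g g' := by ext1 X; simp [mul_assoc]

/-- The restriction `ρ` of the adjoint representation to the Galilei group. -/
def galRep (n : ℕ) : Representation ℝ (galGroup n) (Gl n) := (adRep n).comp (galGroup n).subtype

theorem galAlg_le_comap (n : ℕ) (g : galGroup n) :
    galAlg n ≤ (galAlg n).comap (galRep n g) := by
  intro X hX
  obtain ⟨g, hg⟩ := g
  change ∃ X' ∈ LieAlgebra.Orthogonal.so (Fin n) ℝ, ∃ k, X = galAlgMatrix X' k at hX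
  change ∃ R ∈ Matrix.orthogonalGroup (Fin n) ℝ, ∃ k, (g : Gl n) = galGroupMatrix R k at hg
  change ∃ X' ∈ LieAlgebra.Orthogonal.so (Fin n) ℝ, ∃ k,
    (g : Gl n) * X * ((g⁻¹ : GL (Idx n) ℝ) : Gl n) = galAlgMatrix X' k
  rw [exists_galAlgMatrix_iff] at *
  rw [exists_galGroupMatrix_iff] at hg
  have hi : ((g⁻¹ : GL (Idx n) ℝ) : Gl n) * (g : Gl n) = 1 := by simp
  set b : Gl n := ((g⁻¹ : GL (Idx n) ℝ) : Gl n)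
  set a : Gl n := (g : Gl n)
  have hi' : a.transpose * b.transpose = 1 := by rw [← Matrix.transpose_mul, hi]; simp
  constructor
  · intro B
    have : ∀ C, (a * X) idxT C = 0 := fun C => by
      simp [Matrix.mul_apply, hg.1, hX.1, Matrix.one_apply]
    simp [Matrix.mul_apply (M := a * X), this]
  · have e1 : a * X * b * spaceDiag n = a * (X * spaceDiag n) * a.transpose := by
      conv_lhs => rw [← hg.2]
      calc a * X * b * (a * spaceDiag n * a.transpose)
          = a * X * (b * a) * spaceDiag n * a.transpose := by simp only [mul_assoc]
        _ = _ := by rw [hi]; simp only [mul_assoc, mul_one]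
    have e2 : spaceDiag n * (a * X * b).transpose
        = a * (spaceDiag n * X.transpose) * a.transpose := by
      conv_lhs => rw [← hg.2]
      rw [Matrix.transpose_mul, Matrix.transpose_mul]
      calc a * spaceDiag n * a.transpose * (b.transpose * (X.transpose * a.transpose))
          = a * spaceDiag n * (a.transpose * b.transpose) * X.transpose * a.transpose := by
            simp only [mul_assoc]
        _ = _ := by rw [hi']; simp only [mul_assoc, mul_one]
    rw [e1, e2, ← add_mul, ← mul_add, hX.2]
    simp

/-- The quotient representation `ρ̃` of the Galilei group on `𝔤𝔩(n+1) / 𝔤𝔞𝔩`. -/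
def galQuotRep (n : ℕ) : Representation ℝ (galGroup n) (Gl n ⧸ galAlg n) :=
  (galRep n).quotient (galAlg n) (galAlg_le_comap n)

theorem mul_exp_of_semiconj {m : Type*} [Fintype m] [DecidableEq m] {P A B : Matrix m m ℝ}
    (h : P * A = B * P) : P * NormedSpace.exp A = NormedSpace.exp B * P := by
  let : NormedRing (Matrix m m ℝ) := Matrix.linftyOpNormedRing
  let : NormedAlgebra ℝ (Matrix m m ℝ) := Matrix.linftyOpNormedAlgebra
  let : NormedAlgebra ℚ (Matrix m m ℝ) := NormedAlgebra.restrictScalars ℚ ℝ (Matrix m m ℝ)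
  have h0 : SemiconjBy P A B := h
  exact h0.exp_right.eq

theorem contDiff_exp_smul {m : Type*} [Fintype m] [DecidableEq m] (A : Matrix m m ℝ) (i j : m) :
    ContDiff ℝ ∞ fun t : ℝ => (NormedSpace.exp (t • A) : Matrix m m ℝ) i j := by
  let : NormedRing (Matrix m m ℝ) := Matrix.linftyOpNormedRing
  let : NormedAlgebra ℝ (Matrix m m ℝ) := Matrix.linftyOpNormedAlgebra
  have h1 : ContDiff ℝ ∞ (NormedSpace.exp : Matrix m m ℝ → Matrix m m ℝ) :=
    contDiff_iff_contDiffAt.2 fun x => (NormedSpace.exp_analytic x).contDiffAt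
  have h2 : ContDiff ℝ ∞ fun t : ℝ => (NormedSpace.exp (t • A) : Matrix m m ℝ) :=
    h1.comp (contDiff_id.smul contDiff_const)
  exact (LinearMap.toContinuousLinearMap (Matrix.entryLinearMap ℝ ℝ i j)).contDiff.comp h2

/-- The one-parameter group `t ↦ exp (t X)` in `GL(n+1)`. -/
def expGL {n : ℕ} (X : Gl n) (t : ℝ) : GL (Idx n) ℝ := (Matrix.isUnit_exp (t • X)).unit

theorem expGL_zero {n : ℕ} (X : Gl n) : expGL X 0 = 1 := by
  ext1; simp [expGL]

theorem expGL_mem {n : ℕ} {X : Gl n} (hX : X ∈ galAlg n) (t : ℝ) : expGL X t ∈ galGroup n := by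
  have hX' := (galAlg n).smul_mem t hX
  change ∃ X' ∈ LieAlgebra.Orthogonal.so (Fin n) ℝ, ∃ k, t • X = galAlgMatrix X' k at hX'
  change ∃ R ∈ Matrix.orthogonalGroup (Fin n) ℝ, ∃ k,
    NormedSpace.exp (t • X) = galGroupMatrix R k
  rw [exists_galAlgMatrix_iff] at hX'
  rw [exists_galGroupMatrix_iff]
  generalize t • X = Y at hX'
  constructor
  · intro B
    let P : Gl n := Matrix.fromBlocks 1 0 0 0
    have h0 : P * Y = 0 * P := by
      ext (⟨⟩ | a) B
      · simp [P, Matrix.mul_apply, hX'.1]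
      · simp [P, Matrix.mul_apply]
    have h2 : P * NormedSpace.exp Y = P := by
      simpa using mul_exp_of_semiconj h0
    have := congrFun (congrFun h2 idxT) B
    simp only [Matrix.mul_apply, Fintype.sum_sum_type, P] at this
    rcases B with (⟨⟩ | b)
    · simpa using this
    · simpa using this
  · have h0 : spaceDiag n * (-Y.transpose) = Y * spaceDiag n := by
      rw [mul_neg]
      exact (neg_eq_of_add_eq_zero_left hX'.2)
    rw [← mul_exp_of_semiconj h0, mul_assoc, ← Matrix.exp_transpose, Matrix.exp_neg,
      Matrix.nonsing_inv_mul, mul_one]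
    exact (Matrix.isUnit_iff_isUnit_det _).1 (Matrix.isUnit_exp _)

/-! ### Tangent spaces and differential forms of embedded submanifolds -/

section Submanifold

variable {E : Type*} [NormedAddCommGroup E] [NormedSpace ℝ E] {H : Type*} [TopologicalSpace H]
  (I : ModelWithCorners ℝ E H) {N : Type*} [TopologicalSpace N] [ChartedSpace H N]

/-- The velocities at `p` of smooth curves in `N` that run in the subset `P` and pass through `p`
at time `0`. -/
def velocitySet (P : Set N) (p : N) : Set (TangentSpace I p) :=
  {ξ | ∃ γ : ℝ → N, ContMDiffAt 𝓘(ℝ, ℝ) I ∞ γ 0 ∧ (∀ᶠ t in 𝓝 (0 : ℝ), γ t ∈ P) ∧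
    tangentMap 𝓘(ℝ, ℝ) I γ ⟨0, (1 : ℝ)⟩ = ⟨p, ξ⟩}

/-- The tangent space at `p` of an embedded submanifold `P` of `N`, as a subspace of `T_p N`.
(For an embedded submanifold the velocities already form a subspace.) -/
def subTangent (P : Set N) (p : N) : Submodule ℝ (TangentSpace I p) :=
  Submodule.span ℝ (velocitySet I P p)

/-- A (not necessarily smooth) `V`-valued one-form on the embedded submanifold `P`. -/
abbrev SubForm (P : Set N) (V : Type*) [AddCommGroup V] [Module ℝ V] :=
  ∀ p : P, subTangent I P p.1 →ₗ[ℝ] V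

/-- Smoothness over the open set `O` of a one-form on `N` with values in a finite-dimensional
vector space: all scalar components are smooth functions on the tangent bundle over `O`. -/
def IsSmoothFormOn {V : Type*} [AddCommGroup V] [Module ℝ V] [IsManifold I ∞ N]
    (η : ∀ p : N, TangentSpace I p →ₗ[ℝ] V) (O : Set N) : Prop :=
  ∀ l : Module.Dual ℝ V,
    ContMDiffOn I.tangent 𝓘(ℝ, ℝ) ∞ (fun q : TangentBundle I N => l (η q.proj q.2))
      (TotalSpace.proj ⁻¹' O)

/-- Smoothness of a one-form on an embedded submanifold `P` with values in a finite-dimensional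
vector space: each scalar component is, near each point of `P`, the restriction
of a smooth one-form on an open subset of `N`. -/
def IsSmoothSubForm {V : Type*} [AddCommGroup V] [Module ℝ V] [IsManifold I ∞ N] {P : Set N}
    (θ : SubForm I P V) : Prop :=
  ∀ (l : Module.Dual ℝ V) (p : P), ∃ (O : Set N) (η : ∀ q : N, TangentSpace I q →ₗ[ℝ] ℝ),
    IsOpen O ∧ p.1 ∈ O ∧ IsSmoothFormOn I η O ∧
      ∀ q : P, q.1 ∈ O → ∀ ξ : subTangent I P q.1, l (θ q ξ) = η q.1 ξ.1

variable {I}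
variable {E' : Type*} [NormedAddCommGroup E'] [NormedSpace ℝ E'] {H' : Type*} [TopologicalSpace H']
  {I' : ModelWithCorners ℝ E' H'} {N' : Type*} [TopologicalSpace N'] [ChartedSpace H' N']

theorem mfderiv_mem_subTangent {f : N → N'} {P : Set N} {P' : Set N'} {p : N}
    (hf : ContMDiffAt I I' ∞ f p) (hP : ∀ q ∈ P, f q ∈ P') {ξ : TangentSpace I p}
    (hξ : ξ ∈ subTangent I P p) : mfderiv I I' f p ξ ∈ subTangent I' P' (f p) := by
  suffices h : subTangent I P p ≤
      (subTangent I' P' (f p)).comap (mfderiv I I' f p).toLinearMap from h hξ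
  refine Submodule.span_le.2 ?_
  rintro ξ ⟨γ, hγ, hγP, hγξ⟩
  refine Submodule.subset_span ⟨f ∘ γ, ?_, hγP.mono fun t ht => hP _ ht, ?_⟩
  · have h0 : γ 0 = p := congrArg TotalSpace.proj hγξ
    exact ContMDiffAt.comp 0 (by rw [h0]; exact hf) hγ
  · have h0 : γ 0 = p := congrArg TotalSpace.proj hγξ
    subst h0
    rw [tangentMap_comp_at (I' := I)]
    · rw [hγξ]; rfl
    · exact hf.mdifferentiableAt (by simp)
    · exact hγ.mdifferentiableAt (by simp)

theorem subTangent_open [IsManifold I ∞ N] [I.Boundaryless] {U : Set N} (hU : IsOpen U)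
    {p : N} (hp : p ∈ U) : subTangent I U p = ⊤ := by
  refine eq_top_iff.2 fun ξ _ => Submodule.subset_span ?_
  obtain ⟨w, hw⟩ : ∃ w : E, w = ξ := ⟨ξ, rfl⟩
  let c : ℝ → E := fun t => extChartAt I p p + t • w
  have hc0 : c 0 = extChartAt I p p := by simp [c]
  have hc : ContMDiffAt 𝓘(ℝ, ℝ) 𝓘(ℝ, E) ∞ c 0 := by
    refine ContDiffAt.contMDiffAt ?_
    fun_prop
  have hs : ContMDiffAt 𝓘(ℝ, E) I ∞ (extChartAt I p).symm (c 0) := by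
    rw [hc0]
    exact (contMDiffOn_extChartAt_symm p).contMDiffAt (extChartAt_target_mem_nhds p)
  have hγ : ContMDiffAt 𝓘(ℝ, ℝ) I ∞ ((extChartAt I p).symm ∘ c) 0 := hs.comp 0 hc
  have h0 : (extChartAt I p).symm (c 0) = p := by rw [hc0]; simp
  have hd : HasMFDerivAt 𝓘(ℝ, E) I (extChartAt I p).symm (extChartAt I p p)
      (ContinuousLinearMap.id ℝ E) := by
    have h1 : MDifferentiableAt 𝓘(ℝ, E) I (extChartAt I p).symm (extChartAt I p p) := by
      rw [← hc0]; exact hs.mdifferentiableAt (by simp)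
    have h2 := mfderivWithin_range_extChartAt_symm (I := I) (x := p)
    rw [I.range_eq_univ, mfderivWithin_univ] at h2
    have h3 := h1.hasMFDerivAt
    rw [h2] at h3
    exact h3
  have hcd : HasMFDerivAt 𝓘(ℝ, ℝ) 𝓘(ℝ, E) c 0
      ((ContinuousLinearMap.id ℝ ℝ).smulRight w) := by
    refine HasFDerivAt.hasMFDerivAt ?_
    exact ((hasFDerivAt_id (0 : ℝ)).smul_const w).const_add _
  refine ⟨_, hγ, ?_, ?_⟩
  · refine hγ.continuousAt.eventually_mem (hU.mem_nhds ?_)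
    rw [Function.comp_apply, h0]
    exact hp
  · have h4 := HasMFDerivAt.comp (0 : ℝ) (by rw [hc0]; exact hd) hcd
    have h5 := h4.mfderiv
    refine TotalSpace.ext h0 ?_
    simp only [tangentMap]
    rw [h5]
    have h6 : ((ContinuousLinearMap.id ℝ E).comp ((ContinuousLinearMap.id ℝ ℝ).smulRight w)) 1
        = w := by simp
    exact heq_of_eq (h6.trans hw)

end Submanifold
/-! ### The frame bundle -/

/-- `ℝ^{n+1}`, with coordinates indexed by `{t, 1, …, n}`. -/
abbrev Vec (n : ℕ) : Type := Idx n → ℝ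

/-- The model space of an `(n+1)`-dimensional manifold. -/
abbrev Model (n : ℕ) : Type := EuclideanSpace ℝ (Fin (n + 1))

/-- The model of an `(n+1)`-dimensional manifold without boundary. -/
abbrev mdl (n : ℕ) : ModelWithCorners ℝ (Model n) (Model n) := 𝓡 (n + 1)

/-- The model of the frame bundle of an `(n+1)`-dimensional manifold. -/
abbrev frameMdl (n : ℕ) := (mdl n).prod 𝓘(ℝ, Vec n →L[ℝ] Model n)

instance {n : ℕ} {M : Type*} [TopologicalSpace M] [ChartedSpace (Model n) M] (x : M) :
    T2Space (TangentSpace (mdl n) x) := inferInstanceAs (T2Space (Model n))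

instance {n : ℕ} {M : Type*} [TopologicalSpace M] [ChartedSpace (Model n) M] (x : M) :
    FiniteDimensional ℝ (TangentSpace (mdl n) x) :=
  inferInstanceAs (FiniteDimensional ℝ (Model n))

section FrameBundle

variable (n : ℕ) (M : Type*) [TopologicalSpace M] [ChartedSpace (Model n) M]
  [IsManifold (mdl n) ∞ M]

/-- The total space of the vector bundle `Hom(ℝ^{n+1}, TM)` over `M`. -/
abbrev HomBundle : Type _ := TotalSpace (Vec n →L[ℝ] Model n)
  (fun x : M => Bundle.Trivial M (Vec n) x →L[ℝ] TangentSpace (mdl n) x)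

theorem isOpen_bijective : IsOpen {p : HomBundle n M | Function.Bijective p.2} := by
  rw [isOpen_iff_mem_nhds]
  intro p hp
  let t := trivializationAt (Vec n →L[ℝ] Model n)
    (fun x : M => Bundle.Trivial M (Vec n) x →L[ℝ] TangentSpace (mdl n) x) p.1
  have key : ∀ q : HomBundle n M, q ∈ t.source →
      ((t q).2 ∈ Set.range ((↑) : (Vec n ≃L[ℝ] Model n) → Vec n →L[ℝ] Model n) ↔
        Function.Bijective q.2) := by
    intro q hq
    rw [hom_trivializationAt_source] at hq
    have h1 : q.1 ∈ (trivializationAt (Vec n) (Bundle.Trivial M (Vec n)) p.1).baseSet := hq.1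
    have h2 : q.1 ∈ (trivializationAt (Model n) (TangentSpace (mdl n) : M → Type _) p.1).baseSet :=
      hq.2
    have h3 : (t q).2 = ContinuousLinearMap.inCoordinates (Vec n) (Bundle.Trivial M (Vec n))
        (Model n) (TangentSpace (mdl n)) p.1 q.1 p.1 q.1 q.2 := rfl
    have h4 : (t q).2 ∈ Set.range ((↑) : (Vec n ≃L[ℝ] Model n) → Vec n →L[ℝ] Model n) ↔
        Function.Bijective (t q).2 := by
      constructor
      · rintro ⟨w, hw⟩
        rw [← hw]
        exact w.bijective
      · intro hb
        exact ⟨ContinuousLinearEquiv.ofBijective _ (LinearMap.ker_eq_bot.2 hb.1)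
          (LinearMap.range_eq_top.2 hb.2), rfl⟩
    rw [h4, h3, ContinuousLinearMap.inCoordinates_eq h1 h2]
    simp only [ContinuousLinearMap.coe_comp, ContinuousLinearEquiv.coe_coe]
    rw [Function.Bijective.of_comp_iff' (ContinuousLinearEquiv.bijective _),
      Function.Bijective.of_comp_iff _ (ContinuousLinearEquiv.bijective _)]
  have hps : p ∈ t.source := FiberBundle.mem_trivializationAt_proj_source
  have hc : ContinuousAt (fun q => (t q).2) p :=
    continuous_snd.continuousAt.comp (t.continuousOn.continuousAt (t.open_source.mem_nhds hps))
  filter_upwards [t.open_source.mem_nhds hps,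
    hc.preimage_mem_nhds (ContinuousLinearEquiv.isOpen.mem_nhds ((key p hps).2 hp))] with q hq hq'
  exact (key q hq).1 hq'

/-- The general linear frame bundle `F(M)`: a frame at `x` is a linear isomorphism
`ℝ^{n+1} → T_x M`. It is an open submanifold of `Hom(ℝ^{n+1}, TM)`. -/
def FrameBundle : TopologicalSpace.Opens (HomBundle n M) :=
  ⟨{p | Function.Bijective p.2}, isOpen_bijective n M⟩

variable {n M}

/-- The bundle projection `F(M) → M`. -/
def base (e : FrameBundle n M) : M := e.1.proj

/-- The frame over `x` given by an isomorphism `ℝ^{n+1} ≃ T_x M`. -/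
def frameMk (x : M) (φ : Vec n ≃L[ℝ] TangentSpace (mdl n) x) : FrameBundle n M :=
  ⟨⟨x, (φ : Vec n →L[ℝ] TangentSpace (mdl n) x)⟩, φ.bijective⟩

/-- A point of `F(M)` as an isomorphism `ℝ^{n+1} ≃ T_x M`. -/
def frameIso (e : FrameBundle n M) : Vec n ≃L[ℝ] TangentSpace (mdl n) (base e) :=
  (LinearEquiv.ofBijective
    (e.1.2 : Vec n →L[ℝ] TangentSpace (mdl n) (base e)).toLinearMap e.2).toContinuousLinearEquiv

/-- The frame vector `e_A`. -/
def frameVec {x : M} (φ : Vec n ≃L[ℝ] TangentSpace (mdl n) x) (A : Idx n) :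
    TangentSpace (mdl n) x := φ (Pi.single A 1)

/-- The dual frame covector `e^A`. -/
def frameCovec {x : M} (φ : Vec n ≃L[ℝ] TangentSpace (mdl n) x) (A : Idx n) :
    TangentSpace (mdl n) x →L[ℝ] ℝ :=
  (ContinuousLinearMap.proj A : Vec n →L[ℝ] ℝ).comp
    (φ.symm : TangentSpace (mdl n) x →L[ℝ] Vec n)

/-- The linear automorphism of `ℝ^{n+1}` given by an invertible matrix. -/
def matCLM (g : Gl n) : Vec n →L[ℝ] Vec n := LinearMap.toContinuousLinearMap (Matrix.toLin' g)

theorem matCLM_bijective (g : GL (Idx n) ℝ) : Function.Bijective (matCLM (g : Gl n)) := by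
  refine Function.bijective_iff_has_inverse.2
    ⟨matCLM ((g⁻¹ : GL (Idx n) ℝ) : Gl n), fun v => ?_, fun v => ?_⟩
  · simp [matCLM]
  · simp [matCLM]

/-- The right translation `(e_A) ↦ (e_B g^B_A)` of `F(M)` by a matrix `g ∈ GL(n+1)`. -/
def rightMul (g : GL (Idx n) ℝ) (e : FrameBundle n M) : FrameBundle n M :=
  ⟨⟨e.1.proj, (e.1.2 : Vec n →L[ℝ] TangentSpace (mdl n) e.1.proj).comp (matCLM (g : Gl n))⟩,
    e.2.comp (matCLM_bijective g)⟩

theorem rightMul_one (e : FrameBundle n M) : rightMul 1 e = e := by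
  have h : matCLM ((1 : GL (Idx n) ℝ) : Gl n) = ContinuousLinearMap.id ℝ (Vec n) := by
    ext v; simp [matCLM]
  unfold rightMul
  simp only [h]
  rfl

theorem inCoordinates_comp (x y : M) (φ : Vec n →L[ℝ] TangentSpace (mdl n) y)
    (A : Vec n →L[ℝ] Vec n) :
    ContinuousLinearMap.inCoordinates (Vec n) (Bundle.Trivial M (Vec n))
        (Model n) (TangentSpace (mdl n)) x y x y (φ.comp A) =
      (ContinuousLinearMap.inCoordinates (Vec n) (Bundle.Trivial M (Vec n))
        (Model n) (TangentSpace (mdl n)) x y x y φ).comp A := by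
  ext1 v
  simp [ContinuousLinearMap.inCoordinates]

theorem contMDiff_rightMul (g : GL (Idx n) ℝ) :
    ContMDiff (frameMdl n) (frameMdl n) ∞ (rightMul g : FrameBundle n M → FrameBundle n M) := by
  rw [← ContMDiff.subtypeVal_comp_iff]
  intro e
  have h1 : ContMDiffAt (frameMdl n) (frameMdl n) ∞
      (fun e : FrameBundle n M => (e : HomBundle n M)) e := contMDiff_subtype_val e
  rw [contMDiffAt_hom_bundle] at h1 ⊢
  refine ⟨h1.1, ?_⟩
  refine (h1.2.clm_comp (contMDiffAt_const (c := matCLM (g : Gl n)))).congr_of_eventuallyEq ?_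
  exact Filter.Eventually.of_forall fun q => inCoordinates_comp _ _ _ _

theorem contDiff_matCLM_exp (X : Gl n) :
    ContDiff ℝ ∞ fun t : ℝ => matCLM (NormedSpace.exp (t • X)) := by
  have h : (fun t : ℝ => matCLM (NormedSpace.exp (t • X))) = fun t : ℝ =>
      ∑ i, ∑ j, (NormedSpace.exp (t • X) : Gl n) i j • matCLM (Matrix.single i j (1 : ℝ)) := by
    funext t
    conv_lhs => rw [Matrix.matrix_eq_sum_single (NormedSpace.exp (t • X) : Gl n)]
    simp only [matCLM, map_sum]
    refine Finset.sum_congr rfl fun i _ => Finset.sum_congr rfl fun j _ => ?_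
    rw [← map_smul, ← map_smul, Matrix.smul_single, smul_eq_mul, mul_one]
  rw [h]
  exact ContDiff.sum fun i _ => ContDiff.sum fun j _ =>
    (contDiff_exp_smul X i j).smul contDiff_const

theorem contMDiff_rightMul_expGL (X : Gl n) (e : FrameBundle n M) :
    ContMDiff 𝓘(ℝ, ℝ) (frameMdl n) ∞ (fun t : ℝ => rightMul (expGL X t) e) := by
  rw [← ContMDiff.subtypeVal_comp_iff]
  intro t
  rw [contMDiffAt_hom_bundle]
  refine ⟨contMDiffAt_const, ?_⟩
  refine ((contMDiffAt_const (c := ContinuousLinearMap.inCoordinates (Vec n)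
    (Bundle.Trivial M (Vec n)) (Model n) (TangentSpace (mdl n)) e.1.1 e.1.1 e.1.1 e.1.1
      e.1.2)).clm_comp (contDiff_matCLM_exp X).contMDiff.contMDiffAt).congr_of_eventuallyEq ?_
  exact Filter.Eventually.of_forall fun q => inCoordinates_comp _ _ _ _

/-- The value at `e` of the fundamental vector field on `F(M)` of `X ∈ 𝔤𝔩(n+1)`, i.e. the velocity
at `t = 0` of `t ↦ e · exp (t X)`. -/
def fundamentalVec (X : Gl n) (e : FrameBundle n M) : TangentSpace (frameMdl n) e :=
  (show Model n × (Vec n →L[ℝ] Model n) from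
    mfderiv 𝓘(ℝ, ℝ) (frameMdl n) (fun t : ℝ => rightMul (expGL X t) e) 0 (1 : ℝ))

theorem tangentMap_rightMul_expGL (X : Gl n) (e : FrameBundle n M) :
    tangentMap 𝓘(ℝ, ℝ) (frameMdl n) (fun t : ℝ => rightMul (expGL X t) e) ⟨0, (1 : ℝ)⟩
      = ⟨e, fundamentalVec X e⟩ := by
  refine TotalSpace.ext ?_ (heq_of_eq rfl)
  simp [tangentMap, expGL_zero, rightMul_one]

end FrameBundle


/-! ### Galilei manifolds and Galilei frames -/

section GalileiManifold

variable (n : ℕ) (M : Type*) [TopologicalSpace M] [ChartedSpace (Model n) M]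
  [IsManifold (mdl n) ∞ M]

/-- A Galilei structure `(τ, h)` on the `(n+1)`-dimensional manifold `M`. The symmetric
contravariant two-tensor field `h` is given as the bundle map `T*M → TM` with
`h(α, β) = α (h β)`. -/
structure GalileiStructure where
  /-- The clock form `τ`. -/
  clock : ∀ x : M, TangentSpace (mdl n) x →L[ℝ] ℝ
  /-- The space metric `h`. -/
  metric : ∀ x : M, (TangentSpace (mdl n) x →L[ℝ] ℝ) →L[ℝ] TangentSpace (mdl n) x
  contMDiff_clock : ContMDiff (mdl n) ((mdl n).prod 𝓘(ℝ, Model n →L[ℝ] ℝ)) ∞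
    (fun x => TotalSpace.mk' (Model n →L[ℝ] ℝ) x (clock x))
  contMDiff_metric :
    ContMDiff (mdl n) ((mdl n).prod 𝓘(ℝ, (Model n →L[ℝ] ℝ) →L[ℝ] Model n)) ∞
      (fun x => TotalSpace.mk' ((Model n →L[ℝ] ℝ) →L[ℝ] Model n) x (metric x))
  clock_ne_zero : ∀ x, clock x ≠ 0
  metric_symm : ∀ x (α β : TangentSpace (mdl n) x →L[ℝ] ℝ), α (metric x β) = β (metric x α)
  metric_nonneg : ∀ x (α : TangentSpace (mdl n) x →L[ℝ] ℝ), 0 ≤ α (metric x α)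
  metric_rank : ∀ x, Module.finrank ℝ (metric x).range = n
  clock_metric : ∀ x (α : TangentSpace (mdl n) x →L[ℝ] ℝ), clock x (metric x α) = 0

variable {n M} (S : GalileiStructure n M)

/-- The frame `(v, e_a)` at `x` is a Galilei frame: `τ(v) = 1` and `h = δ^{ab} e_a ⊗ e_b`. -/
def IsGalileiFrameAt (x : M) (φ : Vec n ≃L[ℝ] TangentSpace (mdl n) x) : Prop :=
  S.clock x (frameVec φ idxT) = 1 ∧ ∀ α : TangentSpace (mdl n) x →L[ℝ] ℝ,
    S.metric x α = ∑ a : Fin n, α (frameVec φ (idxS a)) • frameVec φ (idxS a)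

/-- The Galilei frame bundle `G(M) ⊆ F(M)`. -/
def galileiBundle : Set (FrameBundle n M) := {e | IsGalileiFrameAt S (base e) (frameIso e)}

variable {S} in
theorem clock_frameVec {x : M} {φ : Vec n ≃L[ℝ] TangentSpace (mdl n) x}
    (h : IsGalileiFrameAt S x φ) (a : Fin n) : S.clock x (frameVec φ (idxS a)) = 0 := by
  have h1 := S.clock_metric x (frameCovec φ (idxS a))
  rw [h.2, map_sum] at h1
  have h2 : ∀ b : Fin n, frameCovec φ (idxS a) (frameVec φ (idxS b)) = if b = a then 1 else 0 := by
    intro b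
    simp [frameCovec, frameVec, Pi.single_apply, eq_comm]
  simpa [h2, ite_smul, apply_ite (S.clock x)] using h1

theorem frameVec_rightMul (g : GL (Idx n) ℝ) (e : FrameBundle n M) (A : Idx n) :
    frameVec (frameIso (rightMul g e)) A = ∑ B, (g : Gl n) B A • frameVec (frameIso e) B := by
  have h1 : frameVec (frameIso (rightMul g e)) A
      = frameIso e (matCLM (g : Gl n) (Pi.single A 1)) := rfl
  have h2 : matCLM (g : Gl n) (Pi.single A 1)
      = ∑ B, (g : Gl n) B A • (Pi.single B (1 : ℝ) : Vec n) := by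
    ext C
    simp [matCLM, Pi.single_apply]
  rw [h1, h2, map_sum]
  exact Finset.sum_congr rfl fun B _ => map_smul _ _ _

variable {S} in
theorem isGalileiFrameAt_of_mul {g : Gl n}
    (hg : ∃ R ∈ Matrix.orthogonalGroup (Fin n) ℝ, ∃ k, g = galGroupMatrix R k) {x : M}
    {φ ψ : Vec n ≃L[ℝ] TangentSpace (mdl n) x} (hφ : IsGalileiFrameAt S x φ)
    (hψ : ∀ A, frameVec ψ A = ∑ B, g B A • frameVec φ B) : IsGalileiFrameAt S x ψ := by
  obtain ⟨R, hR, k, rfl⟩ := hg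
  rw [Matrix.mem_orthogonalGroup_iff] at hR
  have hS : ∀ a : Fin n, frameVec ψ (idxS a) = ∑ b, R b a • frameVec φ (idxS b) := by
    intro a
    rw [hψ, Fintype.sum_sum_type]
    simp [galGroupMatrix]
  constructor
  · have h1 : frameVec ψ idxT = frameVec φ idxT + ∑ b, k b • frameVec φ (idxS b) := by
      rw [hψ, Fintype.sum_sum_type]
      simp [galGroupMatrix]
    rw [h1, map_add, map_sum]
    have h2 := hφ.1
    simp only [map_smul, clock_frameVec hφ, smul_zero, Finset.sum_const_zero, add_zero]
    exact h2
  · intro α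
    have h3 : ∀ b c, ∑ a, R b a * R c a = (1 : Matrix (Fin n) (Fin n) ℝ) b c := by
      intro b c
      rw [← hR]
      simp [Matrix.mul_apply]
    rw [hφ.2 α]
    simp only [hS, map_sum, map_smul, smul_eq_mul, Finset.smul_sum, smul_smul]
    simp only [Finset.sum_mul, Finset.sum_smul]
    symm
    calc ∑ a, ∑ b, ∑ c, (R c a * α (frameVec φ (idxS c)) * R b a) • frameVec φ (idxS b)
        = ∑ b, ∑ c, ((∑ a, R b a * R c a) * α (frameVec φ (idxS c))) • frameVec φ (idxS b) := by
          rw [Finset.sum_comm]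
          refine Finset.sum_congr rfl fun b _ => ?_
          rw [Finset.sum_comm]
          refine Finset.sum_congr rfl fun c _ => ?_
          rw [← Finset.sum_smul, Finset.sum_mul]
          congr 1
          exact Finset.sum_congr rfl fun a _ => by ring
      _ = _ := by
          refine Finset.sum_congr rfl fun b _ => ?_
          simp [h3, Matrix.one_apply]

variable {S} in
theorem rightMul_mem {g : GL (Idx n) ℝ} (hg : g ∈ galGroup n) {e : FrameBundle n M}
    (he : e ∈ galileiBundle S) : rightMul g e ∈ galileiBundle S :=
  isGalileiFrameAt_of_mul (x := base e) (φ := frameIso e) (ψ := frameIso (rightMul g e)) hg he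
    (frameVec_rightMul g e)

/-- The right translation by an element of the Galilei group as a map `G(M) → G(M)`. -/
def galRightMul (g : galGroup n) (e : galileiBundle S) : galileiBundle S :=
  ⟨rightMul g.1 e.1, rightMul_mem g.2 e.2⟩

/-- A `V`-valued one-form on `G(M)`. -/
abbrev GalForm (V : Type*) [AddCommGroup V] [Module ℝ V] := SubForm (frameMdl n) (galileiBundle S) V

/-- The differential of the right translation on `G(M)`. -/
def galRightMulDeriv (g : galGroup n) (e : galileiBundle S) :
    subTangent (frameMdl n) (galileiBundle S) e.1 →ₗ[ℝ]
      subTangent (frameMdl n) (galileiBundle S) (galRightMul S g e).1 :=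
  (mfderiv (frameMdl n) (frameMdl n) (rightMul g.1 : FrameBundle n M → _) e.1).toLinearMap.restrict
    fun _ hξ => mfderiv_mem_subTangent (contMDiff_rightMul g.1 e.1)
      (fun _ hq => rightMul_mem g.2 hq) hξ

/-- The value at `e ∈ G(M)` of the fundamental vector field on `G(M)` of `X ∈ 𝔤𝔞𝔩`. -/
def galFundamentalVec (X : galAlg n) (e : galileiBundle S) :
    subTangent (frameMdl n) (galileiBundle S) e.1 :=
  ⟨fundamentalVec X.1 e.1, Submodule.subset_span ⟨_, contMDiff_rightMul_expGL X.1 e.1 0,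
    Filter.Eventually.of_forall fun t => rightMul_mem (expGL_mem X.2 t) e.2,
    tangentMap_rightMul_expGL X.1 e.1⟩⟩

variable {S}

/-- Equivariance `R_g^* θ = r(g⁻¹) ∘ θ` of a form on `G(M)` with respect to a representation `r`
of the Galilei group. -/
def IsGalEquivariant {V : Type*} [AddCommGroup V] [Module ℝ V]
    (r : Representation ℝ (galGroup n) V) (θ : GalForm S V) : Prop :=
  ∀ (g : galGroup n) (e : galileiBundle S) (ξ : subTangent (frameMdl n) (galileiBundle S) e.1),
    θ (galRightMul S g e) (galRightMulDeriv S g e ξ) = r g⁻¹ (θ e ξ)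

/-- A smooth `𝔤𝔩(n+1)`-valued one-form on `G(M)` that is `Ad`-equivariant and reproduces the
elements of the Galilei algebra on fundamental vector fields. -/
structure IsGalileiConnectionForm (θ : GalForm S (Gl n)) : Prop where
  smooth : IsSmoothSubForm (frameMdl n) θ
  equivariant : IsGalEquivariant (galRep n) θ
  fundamental : ∀ (X : galAlg n) (e : galileiBundle S), θ e (galFundamentalVec S X e) = X.1

/-- A tensorial (smooth, equivariant and horizontal) one-form on `G(M)`. -/
structure IsTensorial {V : Type*} [AddCommGroup V] [Module ℝ V]
    (r : Representation ℝ (galGroup n) V) (θ : GalForm S V) : Prop where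
  smooth : IsSmoothSubForm (frameMdl n) θ
  equivariant : IsGalEquivariant r θ
  horizontal : ∀ (e : galileiBundle S) (ξ : subTangent (frameMdl n) (galileiBundle S) e.1),
    mfderiv (frameMdl n) (mdl n) (base : FrameBundle n M → M) e.1 ξ.1 = 0 → θ e ξ = 0

/-! ### Affine connections and connection forms on the frame bundle -/

variable (n M) in
/-- A `𝔤𝔩(n+1)`-valued one-form on `F(M)`. -/
abbrev FrameForm := ∀ e : FrameBundle n M, TangentSpace (frameMdl n) e →ₗ[ℝ] Gl n

/-- A (smooth) principal connection form on `F(M)`. -/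
structure IsPrincipalConnectionForm (Θ : FrameForm n M) : Prop where
  smooth : IsSmoothFormOn (frameMdl n) Θ Set.univ
  equivariant : ∀ (g : GL (Idx n) ℝ) (e : FrameBundle n M) (ξ : TangentSpace (frameMdl n) e),
    Θ (rightMul g e) (mfderiv (frameMdl n) (frameMdl n) (rightMul g : FrameBundle n M → _) e ξ)
      = adRep n g⁻¹ (Θ e ξ)
  fundamental : ∀ (X : Gl n) (e : FrameBundle n M), Θ e (fundamentalVec X e) = X

variable (S) in
/-- The pullback of a form on `F(M)` along the inclusion `G(M) → F(M)`. -/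
def restrictToGalilei (Θ : FrameForm n M) : GalForm S (Gl n) :=
  fun e => (Θ e.1).domRestrict (subTangent (frameMdl n) (galileiBundle S) e.1)

/-- The map `M → F(M)` given by a family of frames. -/
def frameSection (s : ∀ x : M, Vec n ≃L[ℝ] TangentSpace (mdl n) x) (x : M) : FrameBundle n M :=
  frameMk x (s x)

/-- `s` is a smooth local frame on the open set `U` (its values outside of `U` play no role). -/
def IsLocalFrame (s : ∀ x : M, Vec n ≃L[ℝ] TangentSpace (mdl n) x) (U : Set M) : Prop :=
  IsOpen U ∧ ContMDiffOn (mdl n) (frameMdl n) ∞ (frameSection s) U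

/-- The local connection form: the pullback of a form on `F(M)` along a local frame. -/
def framePullback (Θ : FrameForm n M) (s : ∀ x : M, Vec n ≃L[ℝ] TangentSpace (mdl n) x) (x : M) :
    TangentSpace (mdl n) x →ₗ[ℝ] Gl n :=
  (Θ (frameSection s x)).comp (mfderiv (mdl n) (frameMdl n) (frameSection s) x).toLinearMap

variable (n M) in
/-- Covariant derivatives on `TM`; `cov Y x X` is `∇_X Y` at `x`. -/
abbrev Connection := CovariantDerivative (mdl n) (Model n) (TangentSpace (mdl n) : M → Type _)

/-- An affine connection `∇` and a form on `F(M)` correspond to each other if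
`∇ e_B = ω^A_B ⊗ e_A` for all local frames `(e_A)`, where `ω` is the local connection form. -/
def Corresponds (cov : Connection n M) (Θ : FrameForm n M) : Prop :=
  ∀ (U : Set M) (s : ∀ x : M, Vec n ≃L[ℝ] TangentSpace (mdl n) x), IsLocalFrame s U →
    ∀ x ∈ U, ∀ (X : TangentSpace (mdl n) x) (B : Idx n),
      cov (fun y => frameVec (s y) B) x X = ∑ A, framePullback Θ s x X A B • frameVec (s x) A

variable (S) in
/-- `s` is a local Galilei frame on `U`. -/
def IsGalileiFrame (s : ∀ x : M, Vec n ≃L[ℝ] TangentSpace (mdl n) x) (U : Set M) : Prop :=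
  IsLocalFrame s U ∧ ∀ x ∈ U, IsGalileiFrameAt S x (s x)

theorem frameSection_mem {s : ∀ x : M, Vec n ≃L[ℝ] TangentSpace (mdl n) x} {U : Set M}
    (hs : IsGalileiFrame S s U) {x : M} (hx : x ∈ U) : frameSection s x ∈ galileiBundle S := by
  have h : frameIso (frameSection s x) = s x := by ext v; rfl
  change IsGalileiFrameAt S x (frameIso (frameSection s x))
  rw [h]
  exact hs.2 x hx

theorem mfderiv_frameSection_mem {s : ∀ x : M, Vec n ≃L[ℝ] TangentSpace (mdl n) x} {U : Set M}
    (hs : IsGalileiFrame S s U) {x : M} (hx : x ∈ U) (X : TangentSpace (mdl n) x) :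
    mfderiv (mdl n) (frameMdl n) (frameSection s) x X ∈
      subTangent (frameMdl n) (galileiBundle S) (frameSection s x) :=
  mfderiv_mem_subTangent (hs.1.2.contMDiffAt (hs.1.1.mem_nhds hx))
    (fun _ hq => frameSection_mem hs hq)
    (by rw [subTangent_open hs.1.1 hx]; exact Submodule.mem_top)

open Classical in
/-- The pullback of a form on `G(M)` along a local Galilei frame on `U`, understood as a local
section of `G(M)`. -/
def galileiPullback (θ : GalForm S (Gl n)) {s : ∀ x : M, Vec n ≃L[ℝ] TangentSpace (mdl n) x}
    {U : Set M} (hs : IsGalileiFrame S s U) (x : M) : TangentSpace (mdl n) x →ₗ[ℝ] Gl n :=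
  if hx : x ∈ U then
    (θ ⟨frameSection s x, frameSection_mem hs hx⟩).comp
      ((mfderiv (mdl n) (frameMdl n) (frameSection s) x).toLinearMap.codRestrict _
        (mfderiv_frameSection_mem hs hx))
  else 0

/-! ### Non-metricities and the Newton–Coriolis form -/

/-- `(∇_X α)(Y) = X(α(Y)) - α(∇_X Y)` for a one-form `α` and `X, Y ∈ T_x M`, computed with a local
extension of `Y` to a vector field (the value does not depend on the extension). -/
def covDerivForm (cov : Connection n M) (α : ∀ x : M, TangentSpace (mdl n) x →L[ℝ] ℝ) (x : M)
    (X Y : TangentSpace (mdl n) x) : ℝ :=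
  mvfderiv (mdl n) (fun y => α y (FiberBundle.extend (Model n) Y y)) x X
    - α x (cov (FiberBundle.extend (Model n) Y) x X)

variable (S) in
/-- The `τ`-non-metricity `Q̂(X, Y) = (∇_X τ)(Y)`. -/
def nonMetricityClock (cov : Connection n M) (x : M) (X Y : TangentSpace (mdl n) x) : ℝ :=
  covDerivForm cov S.clock x X Y

/-- A local extension of a covector to a one-form. -/
def extendCovec {x : M} (α : TangentSpace (mdl n) x →L[ℝ] ℝ) :
    ∀ y : M, TangentSpace (mdl n) y →L[ℝ] ℝ :=
  FiberBundle.extend (Model n →L[ℝ] ℝ) α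

variable (S) in
/-- The `h`-non-metricity
`Q_X(α, β) = (∇_X h)(α, β) = X(h(α, β)) - h(∇_X α, β) - h(α, ∇_X β)`, computed with local
extensions of the covectors `α, β` to one-forms (the value does not depend on the extensions). -/
def nonMetricityMetric (cov : Connection n M) (x : M) (X : TangentSpace (mdl n) x)
    (α β : TangentSpace (mdl n) x →L[ℝ] ℝ) : ℝ :=
  mvfderiv (mdl n) (fun y => extendCovec α y (S.metric y (extendCovec β y))) x X
    - covDerivForm cov (extendCovec α) x X (S.metric x β)
    - covDerivForm cov (extendCovec β) x X (S.metric x α)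

variable (S) in
/-- `b` is the covariant space metric at `x` with respect to the unit timelike vector `v`:
symmetric, `h_{μν} v^ν = 0`, and `h_{μν} h^{νρ} = δ^ρ_μ - v^ρ τ_μ`. -/
def IsCovariantSpaceMetric (x : M) (v : TangentSpace (mdl n) x)
    (b : TangentSpace (mdl n) x →ₗ[ℝ] TangentSpace (mdl n) x →ₗ[ℝ] ℝ) : Prop :=
  (∀ Y Z, b Y Z = b Z Y) ∧ (∀ Y, b Y v = 0) ∧
    ∀ Y (α : TangentSpace (mdl n) x →L[ℝ] ℝ), b Y (S.metric x α) = α (Y - S.clock x Y • v)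

variable (S) in
theorem existsUnique_covariantSpaceMetric (x : M) (v : TangentSpace (mdl n) x)
    (hv : S.clock x v = 1) : ∃! b, IsCovariantSpaceMetric S x v b := by
  let τ : TangentSpace (mdl n) x →ₗ[ℝ] ℝ := (S.clock x).toLinearMap
  let h : (TangentSpace (mdl n) x →L[ℝ] ℝ) →ₗ[ℝ] TangentSpace (mdl n) x :=
    (S.metric x).toLinearMap
  have hτ0 : τ ≠ 0 := fun h0 => S.clock_ne_zero x (by ext w; exact LinearMap.congr_fun h0 w)
  have hle : LinearMap.range h ≤ LinearMap.ker τ := by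
    rintro _ ⟨α, rfl⟩
    exact S.clock_metric x α
  have hdim : Module.finrank ℝ (TangentSpace (mdl n) x) = n + 1 := by
    change Module.finrank ℝ (EuclideanSpace ℝ (Fin (n + 1))) = n + 1
    simp
  have hker : LinearMap.range h = LinearMap.ker τ := by
    refine Submodule.eq_of_le_of_finrank_eq hle ?_
    have h1 := Module.Dual.finrank_ker_add_one_of_ne_zero (f := τ) hτ0
    have h2 : Module.finrank ℝ (LinearMap.range h) = n := S.metric_rank x
    rw [hdim] at h1
    omega
  let P : TangentSpace (mdl n) x →ₗ[ℝ] TangentSpace (mdl n) x :=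
    LinearMap.id - τ.smulRight v
  have hP : ∀ Y, P Y = Y - S.clock x Y • v := fun Y => rfl
  have hPr : ∀ Y, P Y ∈ LinearMap.range h := by
    intro Y
    rw [hker, LinearMap.mem_ker, hP]
    change S.clock x (Y - S.clock x Y • v) = 0
    rw [map_sub, map_smul, hv]
    simp
  obtain ⟨s, hs⟩ := LinearMap.exists_rightInverse_of_surjective h.rangeRestrict
    (LinearMap.range_eq_top.2 h.surjective_rangeRestrict)
  let Pr : TangentSpace (mdl n) x →ₗ[ℝ] LinearMap.range h := P.codRestrict _ hPr
  let c : TangentSpace (mdl n) x →ₗ[ℝ] (TangentSpace (mdl n) x →L[ℝ] ℝ) := s.comp Pr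
  have hc : ∀ Y, S.metric x (c Y) = P Y := by
    intro Y
    have h3 := LinearMap.congr_fun hs (Pr Y)
    exact congrArg Subtype.val h3
  let b : TangentSpace (mdl n) x →ₗ[ℝ] TangentSpace (mdl n) x →ₗ[ℝ] ℝ :=
    LinearMap.mk₂ ℝ (fun Y Z => c Y (P Z)) (by intros; simp) (by intros; simp) (by intros; simp)
      (by intros; simp)
  have hb : ∀ Y Z, b Y Z = c Y (P Z) := fun Y Z => rfl
  have hPv : P v = 0 := by rw [hP, hv, one_smul, sub_self]
  refine ⟨b, ⟨fun Y Z => ?_, fun Y => ?_, fun Y α => ?_⟩, ?_⟩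
  · rw [hb, hb, ← hc, ← hc]
    exact S.metric_symm x _ _
  · rw [hb, hPv, map_zero]
  · have h4 : P (S.metric x α) = S.metric x α := by
      rw [hP, S.clock_metric, zero_smul, sub_zero]
    rw [hb, h4, S.metric_symm, hc, hP]
  · rintro b' ⟨h1, h2, h3⟩
    refine LinearMap.ext fun Y => LinearMap.ext fun Z => ?_
    have h5 : Z = S.clock x Z • v + S.metric x (c Z) := by rw [hc, hP]; simp
    conv_lhs => rw [h5]
    rw [map_add, map_smul, h2, h3, smul_zero, zero_add, ← hP, hb, ← hc, ← hc]
    exact S.metric_symm x _ _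

variable (S) in
/-- The covariant space metric at `x` with respect to the unit timelike vector `v`. -/
def covariantSpaceMetric (x : M) (v : TangentSpace (mdl n) x) :
    TangentSpace (mdl n) x →ₗ[ℝ] TangentSpace (mdl n) x →ₗ[ℝ] ℝ :=
  Classical.epsilon (IsCovariantSpaceMetric S x v)

variable (S) in
theorem covariantSpaceMetric_spec (x : M) (v : TangentSpace (mdl n) x) (hv : S.clock x v = 1) :
    IsCovariantSpaceMetric S x v (covariantSpaceMetric S x v) :=
  Classical.epsilon_spec (existsUnique_covariantSpaceMetric S x v hv).exists

variable (S) in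
/-- The Newton–Coriolis form `Ω_{μν} = 2 (∇_{[μ} v^ρ) h_{ν]ρ}` with respect to the unit timelike
vector field `v`. -/
def newtonCoriolis (cov : Connection n M) (v : ∀ x : M, TangentSpace (mdl n) x) (x : M)
    (X Y : TangentSpace (mdl n) x) : ℝ :=
  covariantSpaceMetric S x (v x) (cov v x X) Y - covariantSpaceMetric S x (v x) (cov v x Y) X

end GalileiManifold

end Galilei

end

noncomputable section

namespace Galilei

set_option linter.unusedSectionVars false

/-! ### Smoothness of local frames and of their dual coframes -/

section

variable {n : ℕ} {M : Type*} [TopologicalSpace M] [ChartedSpace (Model n) M]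
  [IsManifold (mdl n) ∞ M]

/-! Everything is reduced to matrices of one-forms. A local frame `s` over `U` identifies the part
of `F(M)` above `U` with `U × GL(n+1)`, by the base point and the matrix `G = frameCoord s`. This
map has a differentiable left inverse (`exists_frame_reassembly`), so a tangent vector is determined
by its two components, and a vector at `s(x) g` is the translate of a vector tangent to the section
plus a fundamental vector (`tangent_decomposition`). Equivariance prescribes a connection form on
the first summand, reproduction of the algebra on the second. Above `U` the form must therefore be
`G⁻¹ (η G + dG)`, called `localForm`, with `η` its pullback along `s`. The formulas for two frames
agree when the pullbacks satisfy `ω' = h⁻¹ (ω h + dh)` (`TransformsAt`). Conversely, smooth matrices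
of one-forms obeying this law, given for any class of local frames that covers `M`, glue to a
principal connection form (`exists_isPrincipalConnectionForm`).

Affine connections are encoded by the same data: on differentiable fields a covariant derivative is
`dY^A + ω^A_B Y^B` (`IsCovariantDerivativeOn.eq_localCov`), and its matrices obey the same law
(`transformsAt_covForm`). This gives the correspondence with forms on `F(M)`.

Forms on `G(M)` are handled with Galilei frames alone. Such frames exist locally by a smooth
Gram–Schmidt process for the semidefinite tensor `h` (`exists_isGalileiFrame`). Two of them differ
by a map into the Galilei group, whose logarithmic derivative lies in the Galilei algebra
(`inv_mul_matDeriv_mem_galAlg`). So the decomposition of tangent vectors stays inside `G(M)`, and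
equivariance under the small group suffices to recover the form from its pullbacks, which then glue
to a form on all of `F(M)`. On vertical vectors only the logarithmic derivative is left, whence the
projection to the quotient is horizontal.

In a Galilei frame `τ` and `h` have constant components, so `∇τ` and `∇h` are linear algebra in `ω`:
they are `-ω^t_A` and `ω D + (ω D)ᵀ` with `D = spaceDiag n`. The kernel of this linear map is
exactly the Galilei algebra (`ker_nonMetricityMap`), so the induced map on the quotient is
injective. -/

theorem IsLocalFrame.contMDiffOn_hom {s : ∀ x : M, Vec n ≃L[ℝ] TangentSpace (mdl n) x} {U : Set M}
    (hs : IsLocalFrame s U) :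
    ContMDiffOn (mdl n) (frameMdl n) ∞ (fun x => (frameSection s x : HomBundle n M)) U :=
  (contMDiff_subtype_val (n := ∞)).comp_contMDiffOn hs.2

theorem isLocalFrame_iff {s : ∀ x : M, Vec n ≃L[ℝ] TangentSpace (mdl n) x} {U : Set M} :
    IsLocalFrame s U ↔ IsOpen U ∧
      ContMDiffOn (mdl n) (frameMdl n) ∞ (fun x => (frameSection s x : HomBundle n M)) U := by
  refine ⟨fun h => ⟨h.1, h.contMDiffOn_hom⟩, fun h => ⟨h.1, fun x hx => ?_⟩⟩
  exact (ContMDiffWithinAt.subtypeVal_comp_iff _ _ _ x).1 (h.2 x hx)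

/-- The inverse of a local frame is a smooth section of `Hom(TM, ℝ^{n+1})`. -/
theorem IsLocalFrame.contMDiffOn_symm {s : ∀ x : M, Vec n ≃L[ℝ] TangentSpace (mdl n) x}
    {U : Set M} (hs : IsLocalFrame s U) :
    ContMDiffOn (mdl n) ((mdl n).prod 𝓘(ℝ, Model n →L[ℝ] Vec n)) ∞
      (fun x => TotalSpace.mk' (Model n →L[ℝ] Vec n)
        (E := fun x : M => TangentSpace (mdl n) x →L[ℝ] Bundle.Trivial M (Vec n) x) x
        ((s x).symm : TangentSpace (mdl n) x →L[ℝ] Vec n)) U := by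
  intro x₀ hx₀
  have h1 := (hs.contMDiffOn_hom).contMDiffAt (hs.1.mem_nhds hx₀)
  rw [contMDiffAt_hom_bundle] at h1
  refine ContMDiffAt.contMDiffWithinAt ?_
  rw [contMDiffAt_hom_bundle]
  refine ⟨contMDiffAt_id, ?_⟩
  -- In the trivializations at `x₀` the frame and its inverse are represented by mutually inverse
  -- operators, so the claim comes down to smoothness of operator inversion at an invertible
  -- operator.
  have key : ∀ᶠ x in 𝓝 x₀,
      (∃ w : Vec n ≃L[ℝ] Model n, (w : Vec n →L[ℝ] Model n) =
        ContinuousLinearMap.inCoordinates (Vec n) (Bundle.Trivial M (Vec n))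
        (Model n) (TangentSpace (mdl n)) x₀ x x₀ x (s x : Vec n →L[ℝ] TangentSpace (mdl n) x) ∧
       (w.symm : Model n →L[ℝ] Vec n) = ContinuousLinearMap.inCoordinates
        (Model n) (TangentSpace (mdl n)) (Vec n) (Bundle.Trivial M (Vec n))
         x₀ x x₀ x ((s x).symm : TangentSpace (mdl n) x →L[ℝ] Vec n)) := by
    let t1 := trivializationAt (Vec n) (Bundle.Trivial M (Vec n)) x₀
    let t2 := trivializationAt (Model n) (TangentSpace (mdl n) : M → Type _) x₀
    filter_upwards [t1.open_baseSet.mem_nhds (FiberBundle.mem_baseSet_trivializationAt' x₀),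
      t2.open_baseSet.mem_nhds (FiberBundle.mem_baseSet_trivializationAt' x₀)] with x hx1 hx2
    refine ⟨((t1.continuousLinearEquivAt ℝ x hx1).symm.trans (s x)).trans
      (t2.continuousLinearEquivAt ℝ x hx2), ?_, ?_⟩
    · rw [ContinuousLinearMap.inCoordinates_eq hx1 hx2]
      rfl
    · rw [ContinuousLinearMap.inCoordinates_eq hx2 hx1]
      rfl
  have h2 : ContMDiffAt (mdl n) 𝓘(ℝ, Model n →L[ℝ] Vec n) ∞
      (fun x => ContinuousLinearMap.inverse (ContinuousLinearMap.inCoordinates (Vec n)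
        (Bundle.Trivial M (Vec n)) (Model n) (TangentSpace (mdl n)) x₀ x x₀ x
        (s x : Vec n →L[ℝ] TangentSpace (mdl n) x))) x₀ := by
    obtain ⟨w, hw, -⟩ := key.self_of_nhds
    refine ContMDiffAt.comp (I' := 𝓘(ℝ, Vec n →L[ℝ] Model n)) x₀
      (g := ContinuousLinearMap.inverse) (ContDiffAt.contMDiffAt ?_) h1.2
    change ContDiffAt ℝ ∞ ContinuousLinearMap.inverse (ContinuousLinearMap.inCoordinates (Vec n)
        (Bundle.Trivial M (Vec n)) (Model n) (TangentSpace (mdl n)) x₀ x₀ x₀ x₀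
        (s x₀ : Vec n →L[ℝ] TangentSpace (mdl n) x₀))
    rw [← hw]
    exact contDiffAt_map_inverse w
  refine h2.congr_of_eventuallyEq ?_
  filter_upwards [key] with x hx
  obtain ⟨w, hw, hw'⟩ := hx
  rw [← hw, ContinuousLinearMap.inverse_equiv]
  exact hw'.symm

section Coframe

variable {EN : Type*} [NormedAddCommGroup EN] [NormedSpace ℝ EN] {HN : Type*}
  [TopologicalSpace HN] {J : ModelWithCorners ℝ EN HN} {N : Type*} [TopologicalSpace N]
  [ChartedSpace HN N] {s : ∀ x : M, Vec n ≃L[ℝ] TangentSpace (mdl n) x} {U : Set M}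

/-- Frame components of a smooth family of tangent vectors are smooth. -/
theorem IsLocalFrame.contMDiffOn_frameCovec (hs : IsLocalFrame s U) {b : N → M}
    {Y : ∀ q : N, TangentSpace (mdl n) (b q)} {O : Set N} (hb : Set.MapsTo b O U)
    (hY : ContMDiffOn J (mdl n).tangent ∞
      (fun q => (⟨b q, Y q⟩ : TangentBundle (mdl n) M)) O) (A : Idx n) :
    ContMDiffOn J 𝓘(ℝ, ℝ) ∞ (fun q => frameCovec (s (b q)) A (Y q)) O := by
  have hb' : ContMDiffOn J (mdl n) ∞ b O :=
    (contMDiff_proj (IB := mdl n) (F := Model n) (TangentSpace (mdl n) : M → Type _)).comp_contMDiffOn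
      hY
  have h1 := ContMDiffOn.clm_bundle_apply (E₁ := (TangentSpace (mdl n) : M → Type _))
    (E₂ := Bundle.Trivial M (Vec n)) (b := b) (v := Y)
    (ϕ := fun q => ((s (b q)).symm : TangentSpace (mdl n) (b q) →L[ℝ] Vec n))
    (hs.contMDiffOn_symm.comp hb' hb) hY
  have h2 : ContMDiffOn J 𝓘(ℝ, Vec n) ∞ (fun q => ((s (b q)).symm (Y q) : Vec n)) O := by
    intro q hq
    exact (contMDiffWithinAt_totalSpace.1 (h1 q hq)).2
  exact contMDiffOn_pi_space.1 h2 A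

/-- Additivity and the Leibniz rule of a covariant derivative ask for differentiability at one point
only; this is the pointwise companion of the smooth version. -/
theorem IsLocalFrame.mdifferentiableAt_frameCovec (hs : IsLocalFrame s U) {x : M} (hx : x ∈ U)
    {Y : ∀ x : M, TangentSpace (mdl n) x}
    (hY : MDifferentiableAt (mdl n) (mdl n).tangent
      (fun y => (⟨y, Y y⟩ : TangentBundle (mdl n) M)) x) (A : Idx n) :
    MDifferentiableAt (mdl n) 𝓘(ℝ, ℝ) (fun y => frameCovec (s y) A (Y y)) x := by
  have h1 := ((hs.contMDiffOn_symm.contMDiffAt (hs.1.mem_nhds hx)).mdifferentiableAt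
    (by simp)).clm_bundle_apply (v := Y) hY
  have h2 : MDifferentiableAt (mdl n) 𝓘(ℝ, Vec n) (fun q => ((s q).symm (Y q) : Vec n)) x :=
    (mdifferentiableAt_totalSpace (mdl n) _).1 h1 |>.2
  exact ((ContinuousLinearMap.proj A : Vec n →L[ℝ] ℝ).mdifferentiableAt).comp x h2

/-- The base map `b` may vary, so that both a local frame on `M` and the tautological frame
`frameIso` over `F(M)` are covered. The latter case yields smoothness of `frameCoord`. -/
theorem contMDiffOn_frameVec {b : N → M} {φ : ∀ q, Vec n ≃L[ℝ] TangentSpace (mdl n) (b q)}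
    {O : Set N} (hφ : ContMDiffOn J (frameMdl n) ∞
      (fun q => (⟨b q, (φ q : Vec n →L[ℝ] TangentSpace (mdl n) (b q))⟩ : HomBundle n M)) O)
    (A : Idx n) :
    ContMDiffOn J (mdl n).tangent ∞
      (fun q => (⟨b q, frameVec (φ q) A⟩ : TangentBundle (mdl n) M)) O := by
  have hb' : ContMDiffOn J (mdl n) ∞ b O := (contMDiff_proj (IB := mdl n)
    (F := Vec n →L[ℝ] Model n) (fun x : M => Bundle.Trivial M (Vec n) x →L[ℝ]
      TangentSpace (mdl n) x)).comp_contMDiffOn hφ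
  refine ContMDiffOn.clm_bundle_apply (E₁ := Bundle.Trivial M (Vec n))
    (E₂ := (TangentSpace (mdl n) : M → Type _)) (b := b)
    (ϕ := fun q => (φ q : Vec n →L[ℝ] TangentSpace (mdl n) (b q)))
    (v := fun _ => (Pi.single A 1 : Vec n)) hφ ?_
  intro q hq
  exact contMDiffWithinAt_totalSpace.2 ⟨hb' q hq, contMDiffWithinAt_const⟩

theorem IsLocalFrame.contMDiffOn_frameVec (hs : IsLocalFrame s U) (A : Idx n) :
    ContMDiffOn (mdl n) (mdl n).tangent ∞
      (fun x => (⟨x, frameVec (s x) A⟩ : TangentBundle (mdl n) M)) U :=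
  Galilei.contMDiffOn_frameVec hs.contMDiffOn_hom A

theorem IsLocalFrame.mdifferentiableAt_frameVec (hs : IsLocalFrame s U) {x : M} (hx : x ∈ U)
    (A : Idx n) : MDifferentiableAt (mdl n) (mdl n).tangent
      (fun x => (⟨x, frameVec (s x) A⟩ : TangentBundle (mdl n) M)) x :=
  ((hs.contMDiffOn_frameVec A).contMDiffAt (hs.1.mem_nhds hx)).mdifferentiableAt (by simp)

end Coframe

theorem contMDiff_base : ContMDiff (frameMdl n) (mdl n) ∞ (base : FrameBundle n M → M) :=
  (contMDiff_proj (IB := mdl n) (F := Vec n →L[ℝ] Model n)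
    (fun x : M => Bundle.Trivial M (Vec n) x →L[ℝ] TangentSpace (mdl n) x)).comp
    (contMDiff_subtype_val (n := ∞))

theorem mdifferentiableAt_base (e : FrameBundle n M) :
    MDifferentiableAt (frameMdl n) (mdl n) (base : FrameBundle n M → M) e :=
  contMDiff_base.mdifferentiableAt (by simp)

/-! ### Transition matrices -/

/-- The matrix `g` with `ψ_B = φ_A g^A_B`. -/
def transMat {x : M} (φ ψ : Vec n ≃L[ℝ] TangentSpace (mdl n) x) : Gl n :=
  Matrix.of fun A B => frameCovec φ A (frameVec ψ B)

theorem frameCovec_frameVec {x : M} (φ : Vec n ≃L[ℝ] TangentSpace (mdl n) x) (A B : Idx n) :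
    frameCovec φ A (frameVec φ B) = (1 : Gl n) A B := by
  simp [frameCovec, frameVec, Pi.single_apply, Matrix.one_apply]

theorem sum_frameCovec_smul {x : M} (φ : Vec n ≃L[ℝ] TangentSpace (mdl n) x)
    (Y : TangentSpace (mdl n) x) : ∑ A, frameCovec φ A Y • frameVec φ A = Y := by
  have h : ∑ A, frameCovec φ A Y • (Pi.single A 1 : Vec n) = φ.symm Y := by
    ext C
    simp [frameCovec, Pi.single_apply]
  simp only [frameVec, ← map_smul]
  rw [← map_sum, h]
  simp

theorem sum_frameCovec_mul {x : M} (φ : Vec n ≃L[ℝ] TangentSpace (mdl n) x)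
    (α : TangentSpace (mdl n) x →L[ℝ] ℝ) (Y : TangentSpace (mdl n) x) :
    ∑ A, frameCovec φ A Y * α (frameVec φ A) = α Y := by
  conv_rhs => rw [← sum_frameCovec_smul φ Y]
  simp

theorem frame_ext {x : M} {φ ψ : Vec n ≃L[ℝ] TangentSpace (mdl n) x}
    (h : ∀ A, frameVec φ A = frameVec ψ A) : φ = ψ := by
  refine ContinuousLinearEquiv.ext (funext fun v => ?_)
  have hv : v = ∑ A, v A • (Pi.single A 1 : Vec n) := by
    ext C
    simp [Pi.single_apply]
  rw [hv, map_sum, map_sum]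
  refine Finset.sum_congr rfl fun A _ => ?_
  rw [map_smul, map_smul]
  exact congrArg _ (h A)

theorem transMat_self {x : M} (φ : Vec n ≃L[ℝ] TangentSpace (mdl n) x) : transMat φ φ = 1 := by
  ext A B
  exact frameCovec_frameVec φ A B

/-- Insert the resolution of the identity given by the frame `ψ` and its coframe. With
`transMat_self` this makes transition matrices invertible, and it is the cocycle rule behind every
change of frame below. -/
theorem transMat_mul {x : M} (φ ψ χ : Vec n ≃L[ℝ] TangentSpace (mdl n) x) :
    transMat φ ψ * transMat ψ χ = transMat φ χ := by
  ext A B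
  rw [Matrix.mul_apply]
  simp only [transMat, Matrix.of_apply]
  rw [← sum_frameCovec_mul ψ (frameCovec φ A) (frameVec χ B)]
  exact Finset.sum_congr rfl fun C _ => mul_comm _ _

/-- The transition matrix as an element of `GL(n+1)`. -/
def transGL {x : M} (φ ψ : Vec n ≃L[ℝ] TangentSpace (mdl n) x) : GL (Idx n) ℝ :=
  ⟨transMat φ ψ, transMat ψ φ, by rw [transMat_mul, transMat_self],
    by rw [transMat_mul, transMat_self]⟩

theorem coe_transGL {x : M} (φ ψ : Vec n ≃L[ℝ] TangentSpace (mdl n) x) :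
    (transGL φ ψ : Gl n) = transMat φ ψ := rfl

theorem frameVec_eq_sum_transMat {x : M} (φ ψ : Vec n ≃L[ℝ] TangentSpace (mdl n) x) (B : Idx n) :
    frameVec ψ B = ∑ A, transMat φ ψ A B • frameVec φ A :=
  (sum_frameCovec_smul φ _).symm

theorem transMat_rightMul (e : FrameBundle n M) (φ : Vec n ≃L[ℝ] TangentSpace (mdl n) (base e))
    (g : GL (Idx n) ℝ) :
    transMat φ (frameIso (rightMul g e)) = transMat φ (frameIso e) * (g : Gl n) := by
  ext A B
  rw [Matrix.mul_apply]
  simp only [transMat, Matrix.of_apply]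
  have := congrArg (frameCovec φ A) (frameVec_rightMul g e B)
  refine this.trans ?_
  rw [map_sum]
  exact Finset.sum_congr rfl fun C _ => by rw [map_smul, smul_eq_mul, mul_comm]

theorem frameMk_frameIso (e : FrameBundle n M) : frameMk (base e) (frameIso e) = e := rfl

theorem frameMk_eq_rightMul {x : M} (φ ψ : Vec n ≃L[ℝ] TangentSpace (mdl n) x) :
    frameMk x ψ = rightMul (transGL φ ψ) (frameMk x φ) := by
  rw [← frameMk_frameIso (rightMul (transGL φ ψ) (frameMk x φ))]
  have h : frameIso (rightMul (transGL φ ψ) (frameMk x φ)) = ψ := by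
    refine frame_ext fun A => ?_
    rw [frameVec_rightMul]
    exact (frameVec_eq_sum_transMat φ ψ A).symm
  exact congrArg (frameMk x) h.symm

/-- Each fibre of `F(M)` is a single orbit, so an equivariant form is controlled by its values at
the points of a section. -/
theorem exists_eq_rightMul (s : ∀ x : M, Vec n ≃L[ℝ] TangentSpace (mdl n) x)
    (e : FrameBundle n M) :
    e = rightMul (transGL (s (base e)) (frameIso e)) (frameSection s (base e)) :=
  frameMk_eq_rightMul (s (base e)) (frameIso e)

end

section

section General

variable {EN : Type*} [NormedAddCommGroup EN] [NormedSpace ℝ EN] {HN : Type*}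
  [TopologicalSpace HN] {J : ModelWithCorners ℝ EN HN} {N : Type*} [TopologicalSpace N]
  [ChartedSpace HN N]
  {EN' : Type*} [NormedAddCommGroup EN'] [NormedSpace ℝ EN'] {HN' : Type*}
  [TopologicalSpace HN'] {J' : ModelWithCorners ℝ EN' HN'} {N' : Type*} [TopologicalSpace N']
  [ChartedSpace HN' N'] {n : ℕ}

/-! ### Derivatives of matrix-valued functions -/

variable (J) in
/-- The entrywise derivative of a matrix-valued function. -/
def matDeriv (f : N → Gl n) (p : N) : TangentSpace J p →ₗ[ℝ] Gl n where
  toFun ξ := Matrix.of fun A B => mvfderiv J (fun q => f q A B) p ξ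
  map_add' ξ η := by ext A B; simp
  map_smul' c ξ := by ext A B; simp

theorem matDeriv_apply (f : N → Gl n) (p : N) (ξ : TangentSpace J p) (A B : Idx n) :
    matDeriv J f p ξ A B = mvfderiv J (fun q => f q A B) p ξ := rfl

variable (J) in
/-- Entrywise differentiability of a matrix-valued function. -/
def MatDiffAt (f : N → Gl n) (p : N) : Prop :=
  ∀ A B, MDifferentiableAt J 𝓘(ℝ, ℝ) (fun q => f q A B) p

variable (J) in
/-- Entrywise smoothness of a matrix-valued function. -/
def MatSmoothOn (f : N → Gl n) (O : Set N) : Prop :=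
  ∀ A B, ContMDiffOn J 𝓘(ℝ, ℝ) ∞ (fun q => f q A B) O

theorem MatSmoothOn.matDiffAt {f : N → Gl n} {O : Set N} (h : MatSmoothOn J f O)
    (hO : IsOpen O) {p : N} (hp : p ∈ O) : MatDiffAt J f p := fun A B =>
  ((h A B).contMDiffAt (hO.mem_nhds hp)).mdifferentiableAt (by simp)

theorem MatSmoothOn.mul {f g : N → Gl n} {O : Set N} (hf : MatSmoothOn J f O)
    (hg : MatSmoothOn J g O) : MatSmoothOn J (fun q => f q * g q) O := fun A B => by
  simp only [Matrix.mul_apply]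
  exact contMDiffOn_finsetSum fun C _ => (hf A C).mul (hg C B)

theorem MatSmoothOn.add {f g : N → Gl n} {O : Set N} (hf : MatSmoothOn J f O)
    (hg : MatSmoothOn J g O) : MatSmoothOn J (fun q => f q + g q) O := fun A B =>
  (hf A B).add (hg A B)

theorem MatSmoothOn.comp {f : N → Gl n} {O : Set N} (hf : MatSmoothOn J f O) {u : N' → N}
    {O' : Set N'} (hu : ContMDiffOn J' J ∞ u O') (h : Set.MapsTo u O' O) :
    MatSmoothOn J' (fun q => f (u q)) O' := fun A B =>
  (hf A B).comp hu h

theorem matDeriv_congr {f g : N → Gl n} {p : N} (h : f =ᶠ[𝓝 p] g) :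
    matDeriv J f p = matDeriv J g p := by
  ext ξ A B
  rw [matDeriv_apply, matDeriv_apply, mvfderiv, mvfderiv]
  have h' : (fun q => f q A B) =ᶠ[𝓝 p] fun q => g q A B := h.mono fun q hq => by
    simp only [hq]
  rw [h'.mfderiv_eq]
  rfl

theorem matDeriv_const (c : Gl n) (p : N) : matDeriv J (fun _ => c) p = 0 := by
  ext ξ A B
  rw [matDeriv_apply, mvfderiv_const]
  rfl

theorem mvfderiv_sum {ι : Type*} {t : Finset ι} {f : ι → N → ℝ} {p : N}
    (h : ∀ i ∈ t, MDifferentiableAt J 𝓘(ℝ, ℝ) (f i) p) :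
    MDifferentiableAt J 𝓘(ℝ, ℝ) (fun q => ∑ i ∈ t, f i q) p ∧
    mvfderiv J (fun q => ∑ i ∈ t, f i q) p = ∑ i ∈ t, mvfderiv J (f i) p := by
  classical
  induction t using Finset.induction_on with
  | empty => exact ⟨by simpa using mdifferentiableAt_const, by simp [mvfderiv_const]⟩
  | insert i t hi ih =>
    have h1 := ih fun j hj => h j (Finset.mem_insert_of_mem hj)
    have h2 := h i (Finset.mem_insert_self i t)
    simp only [Finset.sum_insert hi]
    exact ⟨h2.add h1.1, by rw [mvfderiv_fun_add h2 h1.1, h1.2]⟩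

theorem matDeriv_mul {f g : N → Gl n} {p : N} (hf : MatDiffAt J f p) (hg : MatDiffAt J g p)
    (ξ : TangentSpace J p) :
    matDeriv J (fun q => f q * g q) p ξ = matDeriv J f p ξ * g p + f p * matDeriv J g p ξ := by
  ext A B
  simp only [matDeriv_apply, Matrix.add_apply, Matrix.mul_apply]
  rw [(mvfderiv_sum (f := fun C q => f q A C * g q C B) (fun C _ => (hf A C).mul (hg C B))).2]
  rw [← Finset.sum_add_distrib, sum_apply]
  refine Finset.sum_congr rfl fun C _ => ?_
  rw [mvfderiv_fun_mul (hf A C) (hg C B)]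
  simp only [add_apply, smul_apply, smul_eq_mul]
  ring

theorem matDeriv_comp {f : N → Gl n} {u : N' → N} {p : N'} {y : N} (hy : u p = y)
    (hf : MatDiffAt J f y) (hu : MDifferentiableAt J' J u p) (ξ : TangentSpace J' p) :
    matDeriv J' (fun q => f (u q)) p ξ = matDeriv J f y (mfderiv J' J u p ξ) := by
  ext A B
  subst hy
  exact mfderiv_comp_apply p (hf A B) hu ξ

theorem matDiffAt_comp {f : N → Gl n} {u : N' → N} {p : N'} {y : N} (hy : u p = y)
    (hf : MatDiffAt J f y) (hu : MDifferentiableAt J' J u p) :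
    MatDiffAt J' (fun q => f (u q)) p := by
  subst hy
  exact fun A B => (hf A B).comp p hu

theorem matDiffAt_const (c : Gl n) (p : N) : MatDiffAt J (fun _ => c) p :=
  fun _ _ => mdifferentiableAt_const

/-! ### Smoothness of forms -/

theorem contMDiffOn_tangentMap [IsManifold J ∞ N] [IsManifold J' ∞ N'] {f : N → N'} {O : Set N}
    (hO : IsOpen O) (hf : ContMDiffOn J J' ∞ f O) :
    ContMDiffOn J.tangent J'.tangent ∞ (tangentMap J J' f) (TotalSpace.proj ⁻¹' O) := by
  have : IsManifold J 1 N := IsManifold.of_le (n := ∞) (by simp)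
  have : IsManifold J' 1 N' := IsManifold.of_le (n := ∞) (by simp)
  refine (hf.contMDiffOn_tangentMapWithin (m := ∞) (by simp) hO.uniqueMDiffOn).congr ?_
  intro q hq
  exact (tangentMapWithin_eq_tangentMap (hO.uniqueMDiffOn _ hq)
    ((hf.contMDiffAt (hO.mem_nhds hq)).mdifferentiableAt (by simp))).symm

theorem contMDiffOn_mvfderiv [IsManifold J ∞ N] {f : N → ℝ} {O : Set N}
    (hO : IsOpen O) (hf : ContMDiffOn J 𝓘(ℝ, ℝ) ∞ f O) :
    ContMDiffOn J.tangent 𝓘(ℝ, ℝ) ∞ (fun q : TangentBundle J N => mvfderiv J f q.proj q.2)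
      (TotalSpace.proj ⁻¹' O) :=
  (contMDiff_snd_tangentBundle_modelSpace ℝ 𝓘(ℝ, ℝ)).comp_contMDiffOn
    (contMDiffOn_tangentMap hO hf)

/-- The matrix units form a basis, so every linear functional is a fixed combination of entries and
smoothness can be checked entry by entry. -/
theorem isSmoothFormOn_gl_iff [IsManifold J ∞ N] {η : ∀ p : N, TangentSpace J p →ₗ[ℝ] Gl n}
    {O : Set N} : IsSmoothFormOn J η O ↔
      MatSmoothOn J.tangent (fun q : TangentBundle J N => η q.proj q.2)
        (TotalSpace.proj ⁻¹' O) := by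
  constructor
  · intro h A B
    exact h (Matrix.entryLinearMap ℝ ℝ A B)
  · intro h l
    have hl : ∀ Y : Gl n, l Y = ∑ A, ∑ B, Y A B * l (Matrix.single A B 1) := by
      intro Y
      conv_lhs => rw [Matrix.matrix_eq_sum_single Y]
      simp only [map_sum]
      refine Finset.sum_congr rfl fun A _ => Finset.sum_congr rfl fun B _ => ?_
      rw [← smul_eq_mul, ← map_smul, Matrix.smul_single, smul_eq_mul, mul_one]
    refine ContMDiffOn.congr ?_ fun q _ => hl _
    exact contMDiffOn_finsetSum fun A _ => contMDiffOn_finsetSum fun B _ =>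
      (h A B).mul contMDiffOn_const

theorem MatSmoothOn.matDeriv [IsManifold J ∞ N] {f : N → Gl n} {O : Set N} (hO : IsOpen O)
    (hf : MatSmoothOn J f O) :
    MatSmoothOn J.tangent (fun q : TangentBundle J N => Galilei.matDeriv J f q.proj q.2)
      (TotalSpace.proj ⁻¹' O) := fun A B =>
  contMDiffOn_mvfderiv hO (hf A B)

theorem IsSmoothFormOn.pullback [IsManifold J ∞ N] [IsManifold J' ∞ N']
    {η : ∀ p : N, TangentSpace J p →ₗ[ℝ] Gl n} {O : Set N} (hη : IsSmoothFormOn J η O)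
    {u : N' → N} {O' : Set N'} (hO' : IsOpen O') (hu : ContMDiffOn J' J ∞ u O')
    (h : Set.MapsTo u O' O) :
    IsSmoothFormOn J' (fun p => (η (u p)).comp (mfderiv J' J u p).toLinearMap) O' := by
  rw [isSmoothFormOn_gl_iff] at *
  exact hη.comp (contMDiffOn_tangentMap hO' hu) fun q hq => h hq

end General

variable {n : ℕ} {M : Type*} [TopologicalSpace M] [ChartedSpace (Model n) M]
  [IsManifold (mdl n) ∞ M]

theorem IsLocalFrame.matSmoothOn_transMat {EN : Type*} [NormedAddCommGroup EN] [NormedSpace ℝ EN]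
    {HN : Type*} [TopologicalSpace HN] {J : ModelWithCorners ℝ EN HN} {N : Type*}
    [TopologicalSpace N] [ChartedSpace HN N] {s : ∀ x : M, Vec n ≃L[ℝ] TangentSpace (mdl n) x}
    {U : Set M} (hs : IsLocalFrame s U) {b : N → M}
    {φ : ∀ q, Vec n ≃L[ℝ] TangentSpace (mdl n) (b q)} {O : Set N}
    (hφ : ContMDiffOn J (frameMdl n) ∞
      (fun q => (⟨b q, (φ q : Vec n →L[ℝ] TangentSpace (mdl n) (b q))⟩ : HomBundle n M)) O)
    (hb : Set.MapsTo b O U) :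
    MatSmoothOn J (fun q => transMat (s (b q)) (φ q)) O := fun A B =>
  hs.contMDiffOn_frameCovec hb (Galilei.contMDiffOn_frameVec hφ B) A

/-- The matrix-valued coordinate on `F(M)` given by a local frame. -/
def frameCoord (s : ∀ x : M, Vec n ≃L[ℝ] TangentSpace (mdl n) x) (e : FrameBundle n M) : Gl n :=
  transMat (s (base e)) (frameIso e)

variable {s s' : ∀ x : M, Vec n ≃L[ℝ] TangentSpace (mdl n) x} {U U' : Set M}

theorem isOpen_base_preimage (hU : IsOpen U) :
    IsOpen ((base : FrameBundle n M → M) ⁻¹' U) :=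
  hU.preimage contMDiff_base.continuous

theorem IsLocalFrame.matSmoothOn_frameCoord (hs : IsLocalFrame s U) :
    MatSmoothOn (frameMdl n) (frameCoord s) ((base : FrameBundle n M → M) ⁻¹' U) :=
  hs.matSmoothOn_transMat (b := base) (φ := frameIso)
    (contMDiff_subtype_val (n := ∞)).contMDiffOn fun _ h => h

theorem IsLocalFrame.matDiffAt_frameCoord (hs : IsLocalFrame s U) {e : FrameBundle n M}
    (he : base e ∈ U) : MatDiffAt (frameMdl n) (frameCoord s) e :=
  hs.matSmoothOn_frameCoord.matDiffAt (isOpen_base_preimage hs.1) he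

theorem IsLocalFrame.mdifferentiableAt_frameSection (hs : IsLocalFrame s U) {x : M}
    (hx : x ∈ U) : MDifferentiableAt (mdl n) (frameMdl n) (frameSection s) x :=
  (hs.2.contMDiffAt (hs.1.mem_nhds hx)).mdifferentiableAt (by simp)

theorem mdifferentiableAt_rightMul (g : GL (Idx n) ℝ) (e : FrameBundle n M) :
    MDifferentiableAt (frameMdl n) (frameMdl n) (rightMul g : FrameBundle n M → _) e :=
  (contMDiff_rightMul g).mdifferentiableAt (by simp)

theorem frameCoord_rightMul (g : GL (Idx n) ℝ) (e : FrameBundle n M) :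
    frameCoord s (rightMul g e) = frameCoord s e * (g : Gl n) :=
  transMat_rightMul e (s (base e)) g

theorem frameIso_frameSection (x : M) : frameIso (frameSection s x) = s x := by
  ext v; rfl

theorem frameCoord_frameSection (x : M) : frameCoord s (frameSection s' x) =
    transMat (s x) (s' x) := by
  rw [frameCoord, frameIso_frameSection]
  rfl

/-! ### Decomposition of tangent vectors of the frame bundle -/

theorem mfderiv_base_rightMul (g : GL (Idx n) ℝ) (e : FrameBundle n M)
    (ξ : TangentSpace (frameMdl n) e) :
    mfderiv (frameMdl n) (mdl n) (base : FrameBundle n M → M) (rightMul g e)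
      (mfderiv (frameMdl n) (frameMdl n) (rightMul g : FrameBundle n M → _) e ξ) =
    mfderiv (frameMdl n) (mdl n) (base : FrameBundle n M → M) e ξ :=
  (mfderiv_comp_apply e (mdifferentiableAt_base _) (mdifferentiableAt_rightMul g e) ξ).symm

/-- Translation acts on the coordinate as `G ↦ G g`, which is linear in `G`. -/
theorem matDeriv_frameCoord_rightMul (hs : IsLocalFrame s U) (g : GL (Idx n) ℝ)
    {e : FrameBundle n M} (he : base e ∈ U) (ξ : TangentSpace (frameMdl n) e) :
    matDeriv (frameMdl n) (frameCoord s) (rightMul g e)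
      (mfderiv (frameMdl n) (frameMdl n) (rightMul g : FrameBundle n M → _) e ξ) =
    matDeriv (frameMdl n) (frameCoord s) e ξ * (g : Gl n) := by
  rw [← matDeriv_comp rfl (hs.matDiffAt_frameCoord he) (mdifferentiableAt_rightMul g e)]
  simp only [frameCoord_rightMul]
  rw [matDeriv_mul (hs.matDiffAt_frameCoord he) (matDiffAt_const _ _), matDeriv_const]
  simp

theorem mfderiv_base_frameSection (hs : IsLocalFrame s U) {x : M} (hx : x ∈ U)
    (X : TangentSpace (mdl n) x) :
    mfderiv (frameMdl n) (mdl n) (base : FrameBundle n M → M) (frameSection s x)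
      (mfderiv (mdl n) (frameMdl n) (frameSection s) x X) = X := by
  have h1 := mfderiv_comp_apply x (mdifferentiableAt_base _)
    (hs.mdifferentiableAt_frameSection hx) X
  refine h1.symm.trans ?_
  have h2 : (base : FrameBundle n M → M) ∘ frameSection s = id := rfl
  rw [h2, mfderiv_id]
  rfl

theorem matDeriv_frameCoord_frameSection (hs : IsLocalFrame s U) (hs' : IsLocalFrame s' U')
    {x : M} (hx : x ∈ U) (hx' : x ∈ U') (X : TangentSpace (mdl n) x) :
    matDeriv (frameMdl n) (frameCoord s) (frameSection s' x)
      (mfderiv (mdl n) (frameMdl n) (frameSection s') x X) =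
    matDeriv (mdl n) (fun y => transMat (s y) (s' y)) x X := by
  refine (matDeriv_comp (u := frameSection s') rfl (hs.matDiffAt_frameCoord
    (e := frameSection s' x) hx) (hs'.mdifferentiableAt_frameSection hx') X).symm.trans ?_
  simp only [frameCoord_frameSection]

theorem mfderiv_base_fundamentalVec (X : Gl n) (e : FrameBundle n M) :
    mfderiv (frameMdl n) (mdl n) (base : FrameBundle n M → M) e (fundamentalVec X e) = 0 := by
  have h0 : rightMul (expGL X 0) e = e := by rw [expGL_zero, rightMul_one]
  have h1 := mfderiv_comp_apply_of_eq (x := (0 : ℝ)) (mdifferentiableAt_base e)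
    ((contMDiff_rightMul_expGL X e).mdifferentiableAt (by simp)) h0 (1 : ℝ)
  refine h1.symm.trans ?_
  have h2 : (base : FrameBundle n M → M) ∘ (fun t : ℝ => rightMul (expGL X t) e) =
    fun _ => base e := rfl
  rw [h2, mfderiv_const]
  rfl

theorem hasDerivAt_exp_smul_apply (X : Gl n) (A B : Idx n) :
    HasDerivAt (fun t : ℝ => (NormedSpace.exp (t • X) : Gl n) A B) (X A B) 0 := by
  -- A norm that makes the matrices a Banach algebra is chosen only in order to differentiate the
  -- exponential.
  let : NormedRing (Gl n) := Matrix.linftyOpNormedRing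
  let : NormedAlgebra ℝ (Gl n) := Matrix.linftyOpNormedAlgebra
  have h := hasDerivAt_exp_smul_const (𝕂 := ℝ) X (0 : ℝ)
  rw [zero_smul, NormedSpace.exp_zero, one_mul] at h
  exact (LinearMap.toContinuousLinearMap
    (Matrix.entryLinearMap ℝ ℝ A B)).hasFDerivAt.comp_hasDerivAt 0 h

theorem matDeriv_exp (X : Gl n) :
    MatDiffAt 𝓘(ℝ, ℝ) (fun t : ℝ => (NormedSpace.exp (t • X) : Gl n)) 0 ∧
    matDeriv 𝓘(ℝ, ℝ) (fun t : ℝ => (NormedSpace.exp (t • X) : Gl n)) 0 (1 : ℝ) = X := by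
  have h : ∀ A B, HasMFDerivAt 𝓘(ℝ, ℝ) 𝓘(ℝ, ℝ)
      (fun t : ℝ => (NormedSpace.exp (t • X) : Gl n) A B) 0
      (ContinuousLinearMap.toSpanSingleton ℝ (X A B)) := fun A B =>
    (hasDerivAt_exp_smul_apply X A B).hasFDerivAt.hasMFDerivAt
  refine ⟨fun A B => (h A B).mdifferentiableAt, ?_⟩
  ext A B
  refine (DFunLike.congr_fun (h A B).mfderiv (1 : ℝ)).trans ?_
  exact one_smul ℝ (X A B)

/-- Along the curve `e exp(tX)` the coordinate is `G exp(tX)`, with `G` constant. -/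
theorem matDeriv_frameCoord_fundamentalVec (hs : IsLocalFrame s U) {e : FrameBundle n M}
    (he : base e ∈ U) (X : Gl n) :
    matDeriv (frameMdl n) (frameCoord s) e (fundamentalVec X e) = frameCoord s e * X := by
  have h0 : rightMul (expGL X 0) e = e := by rw [expGL_zero, rightMul_one]
  have h1 := matDeriv_comp (J' := 𝓘(ℝ, ℝ)) (u := fun t : ℝ => rightMul (expGL X t) e) h0
    (hs.matDiffAt_frameCoord he)
    ((contMDiff_rightMul_expGL X e).mdifferentiableAt (by simp)) (1 : ℝ)
  refine h1.symm.trans ?_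
  simp only [frameCoord_rightMul]
  have h2 : ∀ t : ℝ, (expGL X t : Gl n) = NormedSpace.exp (t • X) := fun t => rfl
  simp only [h2]
  refine (matDeriv_mul (matDiffAt_const _ _) (matDeriv_exp X).1 _).trans ?_
  rw [matDeriv_const]
  refine (congrArg₂ (· + ·) (zero_mul _) (congrArg _ (matDeriv_exp X).2)).trans (zero_add _)

end

/-! ### The matrix coordinate as a local trivialization, and the forms it carries -/

section

variable {n : ℕ} {M : Type*} [TopologicalSpace M] [ChartedSpace (Model n) M]
  [IsManifold (mdl n) ∞ M]
variable {s s' : ∀ x : M, Vec n ≃L[ℝ] TangentSpace (mdl n) x} {U U' : Set M}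

/-- Cramer's rule: the inverse is the adjugate divided by the determinant. Both are polynomial in
the entries of `f`, and the determinant has no zero where `f` is invertible. -/
theorem MatSmoothOn.of_mul_eq_one {EN : Type*} [NormedAddCommGroup EN] [NormedSpace ℝ EN]
    {HN : Type*} [TopologicalSpace HN] {J : ModelWithCorners ℝ EN HN} {N : Type*}
    [TopologicalSpace N] [ChartedSpace HN N] {f g : N → Gl n} {O : Set N}
    (hf : MatSmoothOn J f O) (h : ∀ q ∈ O, f q * g q = 1) : MatSmoothOn J g O := by
  have hdet : ∀ k : N → Gl n, MatSmoothOn J k O →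
      ContMDiffOn J 𝓘(ℝ, ℝ) ∞ (fun q => (k q).det) O := by
    intro k hk
    simp only [Matrix.det_apply']
    exact contMDiffOn_finsetSum fun σ _ =>
      contMDiffOn_const.mul (contMDiffOn_finsetProd fun A _ => hk _ _)
  intro A B
  have h1 : ∀ q ∈ O, g q A B = ((f q).det)⁻¹ * (f q).adjugate A B := by
    intro q hq
    rw [← Matrix.inv_eq_right_inv (h q hq), Matrix.inv_def, Ring.inverse_eq_inv']
    rfl
  refine ContMDiffOn.congr ?_ h1
  refine ContMDiffOn.mul (ContMDiffOn.inv₀ (hdet f hf) fun q hq => ?_) ?_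
  · exact ((Matrix.isUnit_iff_isUnit_det _).1 (IsUnit.of_mul_eq_one _ (h q hq))).ne_zero
  · simp only [Matrix.adjugate_apply]
    refine hdet _ fun C D => ?_
    simp only [Matrix.updateRow_apply]
    split_ifs
    · exact contMDiffOn_const
    · exact hf C D

theorem comp_matCLM_frameCoord (e : FrameBundle n M) :
    ((s (base e) : Vec n →L[ℝ] TangentSpace (mdl n) (base e))).comp (matCLM (frameCoord s e)) =
      (e.1.2 : Vec n →L[ℝ] TangentSpace (mdl n) (base e)) := by
  have h := exists_eq_rightMul s e
  have h1 : ∀ A, s (base e) (matCLM (frameCoord s e) (Pi.single A 1)) =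
      frameIso e (Pi.single A 1) := by
    intro A
    have h2 : matCLM (frameCoord s e) (Pi.single A 1)
        = ∑ B, frameCoord s e B A • (Pi.single B (1 : ℝ) : Vec n) := by
      ext C
      simp [matCLM, Pi.single_apply]
    rw [h2, map_sum]
    refine Eq.trans ?_ (frameVec_eq_sum_transMat (s (base e)) (frameIso e) A).symm
    exact Finset.sum_congr rfl fun B _ => map_smul _ _ _
  have h2 : ((s (base e) : Vec n →L[ℝ] TangentSpace (mdl n) (base e))).comp
      (matCLM (frameCoord s e)) = (frameIso e : Vec n →L[ℝ] TangentSpace (mdl n) (base e)) := by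
    refine ContinuousLinearMap.ext fun v => ?_
    have hv : v = ∑ A, v A • (Pi.single A 1 : Vec n) := by
      ext C
      simp [Pi.single_apply]
    rw [hv, map_sum, map_sum]
    refine Finset.sum_congr rfl fun A _ => ?_
    rw [map_smul, map_smul]
    exact congrArg _ (h1 A)
  exact h2

theorem contMDiff_matCLM :
    ContMDiff 𝓘(ℝ, Idx n → Idx n → ℝ) 𝓘(ℝ, Vec n →L[ℝ] Vec n) ∞
      (fun g : Idx n → Idx n → ℝ => matCLM (Matrix.of g)) := by
  let l : (Idx n → Idx n → ℝ) →ₗ[ℝ] (Vec n →L[ℝ] Vec n) :=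
    { toFun := fun g => matCLM (Matrix.of g)
      map_add' := fun g h => by
        rw [matCLM, matCLM, matCLM, ← map_add, ← map_add]
        rfl
      map_smul' := fun c g => by
        rw [matCLM, matCLM, RingHom.id_apply, ← map_smul, ← map_smul]
        rfl }
  exact (LinearMap.toContinuousLinearMap l).contMDiff

theorem mdifferentiableAt_frameCoord_pi (hs : IsLocalFrame s U) {e : FrameBundle n M}
    (he : base e ∈ U) :
    MDifferentiableAt (frameMdl n) 𝓘(ℝ, Idx n → Idx n → ℝ)
      (fun e A B => frameCoord s e A B) e := by
  refine ContMDiffAt.mdifferentiableAt (n := ∞) ?_ (by simp)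
  rw [contMDiffAt_pi_space]
  intro A
  rw [contMDiffAt_pi_space]
  intro B
  exact (hs.matSmoothOn_frameCoord A B).contMDiffAt ((isOpen_base_preimage hs.1).mem_nhds he)

open Classical in
/-- Reassembling a point of the frame bundle from its base point and matrix coordinate. -/
theorem exists_frame_reassembly (hs : IsLocalFrame s U) {e : FrameBundle n M}
    (he : base e ∈ U) : ∃ Φ : M × (Idx n → Idx n → ℝ) → FrameBundle n M,
      MDifferentiableAt ((mdl n).prod 𝓘(ℝ, Idx n → Idx n → ℝ)) (frameMdl n) Φ
        (base e, fun A B => frameCoord s e A B) ∧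
      ∀ e', Φ (base e', fun A B => frameCoord s e' A B) = e' := by
  let Φ₀ : M × (Idx n → Idx n → ℝ) → HomBundle n M := fun p =>
    ⟨p.1, (s p.1 : Vec n →L[ℝ] TangentSpace (mdl n) p.1).comp (matCLM (Matrix.of p.2))⟩
  -- Products that are not bijective are sent to the fixed frame `e`. The bijective ones form a
  -- neighbourhood of the point in question, so this default value does not affect differentiability
  -- there.
  let Φ : M × (Idx n → Idx n → ℝ) → FrameBundle n M := fun p =>
    if h : Φ₀ p ∈ FrameBundle n M then ⟨Φ₀ p, h⟩ else e
  have h0 : ∀ e', Φ₀ (base e', fun A B => frameCoord s e' A B) = e'.1 := by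
    intro e'
    exact congrArg (TotalSpace.mk (base e')) (comp_matCLM_frameCoord e')
  refine ⟨Φ, ?_, fun e' => ?_⟩
  · refine ContMDiffAt.mdifferentiableAt (n := ∞) ?_ (by simp)
    have hΦ₀ : ContMDiffAt ((mdl n).prod 𝓘(ℝ, Idx n → Idx n → ℝ)) (frameMdl n) ∞ Φ₀
        (base e, fun A B => frameCoord s e A B) := by
      rw [contMDiffAt_hom_bundle]
      refine ⟨contMDiffAt_fst, ?_⟩
      have h1 := ((contMDiffAt_hom_bundle _).1
        (hs.contMDiffOn_hom.contMDiffAt (hs.1.mem_nhds he))).2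
      refine ((h1.comp (base e, fun A B => frameCoord s e A B) contMDiffAt_fst).clm_comp
        (contMDiff_matCLM.contMDiffAt.comp _ contMDiffAt_snd)).congr_of_eventuallyEq ?_
      exact Filter.Eventually.of_forall fun q => inCoordinates_comp _ _ _ _
    rw [← ContMDiffAt.subtypeVal_comp_iff]
    refine hΦ₀.congr_of_eventuallyEq ?_
    have h2 : Φ₀ (base e, fun A B => frameCoord s e A B) ∈ FrameBundle n M := by
      rw [h0]; exact e.2
    filter_upwards [hΦ₀.continuousAt.preimage_mem_nhds ((FrameBundle n M).2.mem_nhds h2)]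
      with q hq
    have hq' : Φ₀ q ∈ FrameBundle n M := hq
    simp only [Function.comp_apply, Φ, dif_pos hq']
  · have h2 : Φ₀ (base e', fun A B => frameCoord s e' A B) ∈ FrameBundle n M := by
      rw [h0]; exact e'.2
    simp only [Φ, dif_pos h2]
    exact Subtype.ext (h0 e')

/-- The map to base point and matrix coordinate has a left inverse that is differentiable at the
image point, so by the chain rule its differential is injective. -/
theorem eq_zero_of_mfderiv_base_eq_zero (hs : IsLocalFrame s U) {e : FrameBundle n M}
    (he : base e ∈ U) {ξ : TangentSpace (frameMdl n) e}
    (h1 : mfderiv (frameMdl n) (mdl n) (base : FrameBundle n M → M) e ξ = 0)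
    (h2 : matDeriv (frameMdl n) (frameCoord s) e ξ = 0) : ξ = 0 := by
  obtain ⟨Φ, hΦ, hΦe⟩ := exists_frame_reassembly hs he
  have h3 := mdifferentiableAt_frameCoord_pi hs he
  have h4 : mfderiv (frameMdl n) 𝓘(ℝ, Idx n → Idx n → ℝ) (fun e A B => frameCoord s e A B) e ξ
      = 0 := by
    refine funext fun A => funext fun B => ?_
    let l : (Idx n → Idx n → ℝ) →L[ℝ] ℝ :=
      (ContinuousLinearMap.proj B : (Idx n → ℝ) →L[ℝ] ℝ).comp
        (ContinuousLinearMap.proj A : (Idx n → Idx n → ℝ) →L[ℝ] (Idx n → ℝ))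
    have h5 := mfderiv_comp_apply (I'' := 𝓘(ℝ, ℝ)) (g := l) e l.mdifferentiableAt h3 ξ
    rw [ContinuousLinearMap.mfderiv_eq] at h5
    exact h5.symm.trans (congrFun (congrFun h2 A) B)
  have h6 : Φ ∘ (fun e' => (base e', fun A B => frameCoord s e' A B)) = id := funext hΦe
  have h7 := mfderiv_comp_apply (f := fun e' : FrameBundle n M =>
    (base e', fun A B => frameCoord s e' A B)) e hΦ ((mdifferentiableAt_base e).prodMk h3) ξ
  rw [h6, mfderiv_id, mfderiv_prodMk (mdifferentiableAt_base e) h3] at h7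
  have h8 : (((mfderiv (frameMdl n) (mdl n) (base : FrameBundle n M → M) e).prod
      (mfderiv (frameMdl n) 𝓘(ℝ, Idx n → Idx n → ℝ) (fun e A B => frameCoord s e A B) e)) ξ) = 0 :=
    Prod.ext h1 h4
  refine h7.trans ?_
  refine (congrArg _ h8).trans ?_
  exact ContinuousLinearMap.map_zero (mfderiv ((mdl n).prod 𝓘(ℝ, Idx n → Idx n → ℝ)) (frameMdl n) Φ
    (base e, fun A B => frameCoord s e A B))

theorem tangent_ext (hs : IsLocalFrame s U) {e : FrameBundle n M}
    (he : base e ∈ U) {ξ η : TangentSpace (frameMdl n) e}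
    (h1 : mfderiv (frameMdl n) (mdl n) (base : FrameBundle n M → M) e ξ =
      mfderiv (frameMdl n) (mdl n) (base : FrameBundle n M → M) e η)
    (h2 : matDeriv (frameMdl n) (frameCoord s) e ξ = matDeriv (frameMdl n) (frameCoord s) e η) :
    ξ = η := by
  rw [← sub_eq_zero]
  refine eq_zero_of_mfderiv_base_eq_zero hs he ?_ ?_
  · exact (ContinuousLinearMap.map_sub _ ξ η).trans (sub_eq_zero.2 h1)
  · rw [map_sub, h2, sub_self]

theorem transMat_mul_cancel {x : M} (φ ψ : Vec n ≃L[ℝ] TangentSpace (mdl n) x) (X : Gl n) :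
    transMat φ ψ * (transMat ψ φ * X) = X := by
  rw [← mul_assoc, transMat_mul, transMat_self, one_mul]

/-- Every tangent vector of the frame bundle at `s(x) g` is the sum of a right translate of a
vector tangent to the section `s` and a fundamental vector. -/
theorem tangent_decomposition (hs : IsLocalFrame s U) {x : M} (hx : x ∈ U) (g : GL (Idx n) ℝ)
    (ξ : TangentSpace (frameMdl n) (rightMul g (frameSection s x))) (X : TangentSpace (mdl n) x)
    (hX : mfderiv (frameMdl n) (mdl n) (base : FrameBundle n M → M)
      (rightMul g (frameSection s x)) ξ = X) :
    ξ = mfderiv (frameMdl n) (frameMdl n) (rightMul g : FrameBundle n M → _) (frameSection s x)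
        (mfderiv (mdl n) (frameMdl n) (frameSection s) x X) +
      fundamentalVec (((g⁻¹ : GL (Idx n) ℝ) : Gl n) *
        matDeriv (frameMdl n) (frameCoord s) (rightMul g (frameSection s x)) ξ)
        (rightMul g (frameSection s x)) := by
  have he : base (rightMul g (frameSection s x)) ∈ U := hx
  have hG : frameCoord s (rightMul g (frameSection s x)) = g := by
    rw [frameCoord_rightMul, frameCoord_frameSection, transMat_self, one_mul]
  refine tangent_ext hs he ?_ ?_
  · refine hX.trans (Eq.symm ((ContinuousLinearMap.map_add _ _ _).trans ?_))
    rw [mfderiv_base_fundamentalVec, mfderiv_base_rightMul]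
    refine (add_zero _).trans ?_
    exact mfderiv_base_frameSection hs hx X
  · rw [map_add, matDeriv_frameCoord_fundamentalVec hs he,
      matDeriv_frameCoord_rightMul hs g (e := frameSection s x) hx,
      matDeriv_frameCoord_frameSection hs hs hx hx]
    -- Relative to itself the section has constant coordinate `1`, so the translated section vector
    -- contributes nothing to the matrix component; the fundamental vector alone accounts for it.
    have h1 : (fun y : M => transMat (s y) (s y)) = fun _ => 1 := funext fun y => transMat_self _
    rw [h1, matDeriv_const, hG, ← mul_assoc]
    simp

/-- The form on `F(M)` determined over `U` by a local connection form `η` with respect to the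
local frame `s`. -/
def localForm (s : ∀ x : M, Vec n ≃L[ℝ] TangentSpace (mdl n) x)
    (η : ∀ x : M, TangentSpace (mdl n) x →ₗ[ℝ] Gl n) : FrameForm n M := fun e =>
  (LinearMap.mulLeft ℝ (transMat (frameIso e) (s (base e)))).comp
    ((LinearMap.mulRight ℝ (frameCoord s e)).comp ((η (base e)).comp
      (mfderiv (frameMdl n) (mdl n) (base : FrameBundle n M → M) e).toLinearMap) +
      matDeriv (frameMdl n) (frameCoord s) e)

theorem localForm_apply (η : ∀ x : M, TangentSpace (mdl n) x →ₗ[ℝ] Gl n) (e : FrameBundle n M)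
    (ξ : TangentSpace (frameMdl n) e) : localForm s η e ξ =
      transMat (frameIso e) (s (base e)) *
        (η (base e) (mfderiv (frameMdl n) (mdl n) (base : FrameBundle n M → M) e ξ) *
          frameCoord s e + matDeriv (frameMdl n) (frameCoord s) e ξ) := rfl

theorem transMat_frameIso_eq_inv (e : FrameBundle n M) (g : GL (Idx n) ℝ)
    (h : frameCoord s e = g) :
    transMat (frameIso e) (s (base e)) = ((g⁻¹ : GL (Idx n) ℝ) : Gl n) := by
  have h1 : g = transGL (s (base e)) (frameIso e) := Units.ext h.symm
  rw [h1]
  rfl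

/-- On the two summands of `tangent_decomposition` the value of `Θ` is forced, by equivariance on
the translated section vector and by the normalization on the fundamental vector. -/
theorem IsPrincipalConnectionForm.eq_localForm {Θ : FrameForm n M}
    (hΘ : IsPrincipalConnectionForm Θ) (hs : IsLocalFrame s U) {e : FrameBundle n M}
    (he : base e ∈ U) : Θ e = localForm s (framePullback Θ s) e := by
  obtain ⟨x, g, hx, rfl⟩ : ∃ x g, x ∈ U ∧ e = rightMul g (frameSection s x) :=
    ⟨_, _, he, exists_eq_rightMul s e⟩
  refine LinearMap.ext fun ξ => ?_
  have hG : frameCoord s (rightMul g (frameSection s x)) = g := by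
    rw [frameCoord_rightMul, frameCoord_frameSection, transMat_self, one_mul]
  rw [localForm_apply, transMat_frameIso_eq_inv _ g hG, hG]
  conv_lhs => rw [tangent_decomposition hs hx g ξ _ rfl]
  rw [map_add, hΘ.fundamental, hΘ.equivariant, mul_add, ← mul_assoc]
  congr 1

theorem isSmoothFormOn_of_matSmoothOn {EN : Type*} [NormedAddCommGroup EN] [NormedSpace ℝ EN]
    {HN : Type*} [TopologicalSpace HN] {J : ModelWithCorners ℝ EN HN} {N : Type*}
    [TopologicalSpace N] [ChartedSpace HN N] [IsManifold J ∞ N] {L G : N → Gl n} {O : Set N}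
    (hO : IsOpen O) (hL : MatSmoothOn J L O) (hG : MatSmoothOn J G O)
    {η : ∀ p : N, TangentSpace J p →ₗ[ℝ] Gl n} (hη : IsSmoothFormOn J η O) :
    IsSmoothFormOn J (fun p => (LinearMap.mulLeft ℝ (L p)).comp
      ((LinearMap.mulRight ℝ (G p)).comp (η p) + matDeriv J G p)) O := by
  have hp : ContMDiffOn J.tangent J ∞ (TotalSpace.proj : TangentBundle J N → N)
      (TotalSpace.proj ⁻¹' O) := (contMDiff_proj (TangentSpace J)).contMDiffOn
  rw [isSmoothFormOn_gl_iff] at *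
  exact (hL.comp hp fun _ h => h).mul ((hη.mul (hG.comp hp fun _ h => h)).add (hG.matDeriv hO))

/-- `IsLocalFrame.matSmoothOn_transMat` requires the local frame on the left. With the two frames
exchanged, the transition matrix is the inverse of `frameCoord` and inherits its smoothness. -/
theorem matSmoothOn_transMat_frameIso (hs : IsLocalFrame s U) :
    MatSmoothOn (frameMdl n) (fun e => transMat (frameIso e) (s (base e)))
      ((base : FrameBundle n M → M) ⁻¹' U) :=
  hs.matSmoothOn_frameCoord.of_mul_eq_one fun e _ => by
    rw [frameCoord, transMat_mul, transMat_self]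

theorem IsSmoothFormOn.localForm (hs : IsLocalFrame s U)
    {η : ∀ x : M, TangentSpace (mdl n) x →ₗ[ℝ] Gl n} (hη : IsSmoothFormOn (mdl n) η U) :
    IsSmoothFormOn (frameMdl n) (localForm s η) ((base : FrameBundle n M → M) ⁻¹' U) := by
  have hO := isOpen_base_preimage (n := n) (M := M) hs.1
  exact isSmoothFormOn_of_matSmoothOn hO (matSmoothOn_transMat_frameIso hs)
    hs.matSmoothOn_frameCoord (hη.pullback hO contMDiff_base.contMDiffOn fun _ h => h)

end

/-! ### Transformation law and gluing of local connection forms -/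

section

variable {n : ℕ} {M : Type*} [TopologicalSpace M] [ChartedSpace (Model n) M]
  [IsManifold (mdl n) ∞ M]
variable {s s' : ∀ x : M, Vec n ≃L[ℝ] TangentSpace (mdl n) x} {U U' : Set M}

theorem matDeriv_comp_mul {EN : Type*} [NormedAddCommGroup EN] [NormedSpace ℝ EN] {HN : Type*}
    [TopologicalSpace HN] {J : ModelWithCorners ℝ EN HN} {N : Type*} [TopologicalSpace N]
    [ChartedSpace HN N]
    {EN' : Type*} [NormedAddCommGroup EN'] [NormedSpace ℝ EN'] {HN' : Type*}
    [TopologicalSpace HN'] {J' : ModelWithCorners ℝ EN' HN'} {N' : Type*} [TopologicalSpace N']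
    [ChartedSpace HN' N'] {f : N → Gl n} {u : N' → N} {g : N' → Gl n} {p : N'}
    (hf : MatDiffAt J f (u p)) (hu : MDifferentiableAt J' J u p) (hg : MatDiffAt J' g p)
    (ξ : TangentSpace J' p) :
    matDeriv J' (fun q => f (u q) * g q) p ξ =
      matDeriv J f (u p) (mfderiv J' J u p ξ) * g p + f (u p) * matDeriv J' g p ξ := by
  rw [matDeriv_mul (matDiffAt_comp rfl hf hu) hg, matDeriv_comp rfl hf hu]

theorem isSmoothFormOn_univ_of_locally {EN : Type*} [NormedAddCommGroup EN] [NormedSpace ℝ EN]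
    {HN : Type*} [TopologicalSpace HN] {J : ModelWithCorners ℝ EN HN} {N : Type*}
    [TopologicalSpace N] [ChartedSpace HN N] [IsManifold J ∞ N]
    {η : ∀ p : N, TangentSpace J p →ₗ[ℝ] Gl n}
    (h : ∀ p, ∃ (O : Set N) (η' : ∀ p : N, TangentSpace J p →ₗ[ℝ] Gl n), IsOpen O ∧ p ∈ O ∧
      IsSmoothFormOn J η' O ∧ ∀ q ∈ O, η q = η' q) : IsSmoothFormOn J η Set.univ := by
  intro l q _
  obtain ⟨O, η', hO, hq, hη', hηη'⟩ := h q.proj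
  have hO' : IsOpen (TotalSpace.proj ⁻¹' O : Set (TangentBundle J N)) :=
    hO.preimage (FiberBundle.continuous_proj _ _)
  refine (((hη' l).contMDiffAt (hO'.mem_nhds hq)).congr_of_eventuallyEq ?_).contMDiffWithinAt
  filter_upwards [hO'.mem_nhds hq] with q' hq'
  rw [hηη' q'.proj hq']

/-- Replacing `G` by `G g` with constant `g` in `G⁻¹ (η G + dG)` releases a factor `g⁻¹` on the left
and `g` on the right, while the base component does not change. -/
theorem localForm_rightMul (hs : IsLocalFrame s U)
    (η : ∀ x : M, TangentSpace (mdl n) x →ₗ[ℝ] Gl n) (g : GL (Idx n) ℝ) {e : FrameBundle n M}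
    (he : base e ∈ U) (ξ : TangentSpace (frameMdl n) e) :
    localForm s η (rightMul g e)
      (mfderiv (frameMdl n) (frameMdl n) (rightMul g : FrameBundle n M → _) e ξ) =
      adRep n g⁻¹ (localForm s η e ξ) := by
  have h1 : transMat (frameIso (rightMul g e)) (s (base (rightMul g e))) =
      ((g⁻¹ : GL (Idx n) ℝ) : Gl n) * transMat (frameIso e) (s (base e)) := by
    have h2 : frameCoord s (rightMul g e) =
        ((transGL (s (base e)) (frameIso e) * g : GL (Idx n) ℝ) : Gl n) :=
      frameCoord_rightMul g e
    rw [transMat_frameIso_eq_inv _ _ h2, mul_inv_rev]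
    rfl
  rw [localForm_apply, localForm_apply, h1, matDeriv_frameCoord_rightMul hs g he,
    mfderiv_base_rightMul, frameCoord_rightMul]
  change _ = ((g⁻¹ : GL (Idx n) ℝ) : Gl n) * _ * (((g⁻¹)⁻¹ : GL (Idx n) ℝ) : Gl n)
  rw [inv_inv]
  change (_ * _) * (η (base e) _ * _ + _) = _
  simp only [mul_assoc, add_mul, mul_add]

theorem localForm_fundamentalVec (hs : IsLocalFrame s U)
    (η : ∀ x : M, TangentSpace (mdl n) x →ₗ[ℝ] Gl n) {e : FrameBundle n M}
    (he : base e ∈ U) (X : Gl n) : localForm s η e (fundamentalVec X e) = X := by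
  rw [localForm_apply, matDeriv_frameCoord_fundamentalVec hs he, mfderiv_base_fundamentalVec,
    map_zero, zero_mul, zero_add]
  exact transMat_mul_cancel _ _ X

/-- Along `s` the coordinate `G` is constantly `1`, so of `G⁻¹ (η G + dG)` only `η` is left. -/
theorem framePullback_localForm (hs : IsLocalFrame s U)
    (η : ∀ x : M, TangentSpace (mdl n) x →ₗ[ℝ] Gl n) {x : M} (hx : x ∈ U) :
    framePullback (localForm s η) s x = η x := by
  refine LinearMap.ext fun X => ?_
  change localForm s η (frameSection s x) (mfderiv (mdl n) (frameMdl n) (frameSection s) x X) = _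
  rw [localForm_apply, matDeriv_frameCoord_frameSection hs hs hx hx,
    mfderiv_base_frameSection hs hx, frameCoord_frameSection, frameIso_frameSection]
  have h1 : (fun y : M => transMat (s y) (s y)) = fun _ => 1 := funext fun y => transMat_self _
  rw [h1, matDeriv_const, transMat_self, mul_one]
  change transMat (s x) (s x) * _ = _
  rw [transMat_self, one_mul, LinearMap.zero_apply, add_zero]
  rfl

/-- The transformation law `ω' = h⁻¹ (ω h + dh)` of local connection forms at a point. -/
def TransformsAt (s s' : ∀ x : M, Vec n ≃L[ℝ] TangentSpace (mdl n) x) (x : M)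
    (η η' : TangentSpace (mdl n) x →ₗ[ℝ] Gl n) : Prop :=
  ∀ X, transMat (s x) (s' x) * η' X =
    η X * transMat (s x) (s' x) + matDeriv (mdl n) (fun y => transMat (s y) (s' y)) x X

theorem IsLocalFrame.matDiffAt_transMat (hs : IsLocalFrame s U) (hs' : IsLocalFrame s' U')
    {x : M} (hx : x ∈ U) (hx' : x ∈ U') :
    MatDiffAt (mdl n) (fun y => transMat (s y) (s' y)) x := by
  have h := hs.matSmoothOn_transMat (b := id) (φ := s') (O := U ∩ U')
    (hs'.contMDiffOn_hom.mono Set.inter_subset_right) fun _ h => h.1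
  exact h.matDiffAt (hs.1.inter hs'.1) ⟨hx, hx'⟩

/-- Here `A` is the transition matrix and `D` its differential, `B` and `B'` are the two local
forms, and `G`, `d` are the coordinate in the second frame and its differential. The identity
combines the product rule for `A G` with the transformation law. -/
theorem mul_transformed_eq {A B B' D : Gl n} (h : A * B' = B * A + D) {L G d : Gl n} :
    L * (B * (A * G) + (D * G + A * d)) = L * A * (B' * G + d) := by
  rw [mul_assoc L A, mul_add A, ← mul_assoc A B', h, add_mul, mul_assoc B A, add_assoc]

/-- The two coordinates differ by the transition matrix as a left factor, and its differential,
produced by the product rule, is exactly the inhomogeneous term of the transformation law. -/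
theorem localForm_eq_of_transformsAt (hs : IsLocalFrame s U) (hs' : IsLocalFrame s' U')
    {η η' : ∀ x : M, TangentSpace (mdl n) x →ₗ[ℝ] Gl n} {e : FrameBundle n M}
    (he : base e ∈ U) (he' : base e ∈ U')
    (h : TransformsAt s s' (base e) (η (base e)) (η' (base e))) :
    localForm s η e = localForm s' η' e := by
  refine LinearMap.ext fun ξ => ?_
  have h1 : frameCoord s = fun e : FrameBundle n M =>
      transMat (s (base e)) (s' (base e)) * frameCoord s' e := by
    funext e
    exact (transMat_mul _ _ _).symm
  have h2 := matDeriv_comp_mul (hs.matDiffAt_transMat hs' he he') (mdifferentiableAt_base e)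
    (hs'.matDiffAt_frameCoord he') ξ
  have h3 := h (mfderiv (frameMdl n) (mdl n) (base : FrameBundle n M → M) e ξ)
  have h4 : transMat (frameIso e) (s' (base e)) =
    transMat (frameIso e) (s (base e)) * transMat (s (base e)) (s' (base e)) :=
    (transMat_mul _ _ _).symm
  refine (localForm_apply _ _ _).trans (Eq.trans ?_ (localForm_apply _ _ _).symm)
  rw [h4, ← mul_transformed_eq h3]
  refine congrArg _ (congrArg₂ _ (congrArg _ (congrFun h1 e)) ?_)
  exact (congrArg (fun f => matDeriv (frameMdl n) f e ξ) h1).trans h2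

/-- Local connection forms with the right transformation law glue to a principal connection
form. -/
theorem exists_isPrincipalConnectionForm
    {P : (∀ x : M, Vec n ≃L[ℝ] TangentSpace (mdl n) x) → Set M → Prop}
    (hP : ∀ s U, P s U → IsLocalFrame s U) (hcover : ∀ x, ∃ s U, P s U ∧ x ∈ U)
    (η : (∀ x : M, Vec n ≃L[ℝ] TangentSpace (mdl n) x) → Set M →
      ∀ x : M, TangentSpace (mdl n) x →ₗ[ℝ] Gl n)
    (hsmooth : ∀ s U, P s U → IsSmoothFormOn (mdl n) (η s U) U)
    (htrans : ∀ s U s' U', P s U → P s' U' → ∀ x ∈ U, x ∈ U' →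
      TransformsAt s s' x (η s U x) (η s' U' x)) :
    ∃ Θ : FrameForm n M, IsPrincipalConnectionForm Θ ∧
      ∀ s U, P s U → ∀ e, base e ∈ U → Θ e = localForm s (η s U) e := by
  choose σ V hσ hV using hcover
  -- At `e` the frame chosen for the base point of `e` is used. By the transformation law any other
  -- admissible frame gives the same value, so near a point one fixed frame may be used, which is
  -- what smoothness needs.
  let Θ : FrameForm n M := fun e =>
    localForm (σ (base e)) (η (σ (base e)) (V (base e))) e
  have hΘ : ∀ s U, P s U → ∀ e, base e ∈ U → Θ e = localForm s (η s U) e := fun s U h e he =>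
    localForm_eq_of_transformsAt (hP _ _ (hσ _)) (hP _ _ h) (hV _) he
      (htrans _ _ _ _ (hσ _) h _ (hV _) he)
  refine ⟨Θ, ⟨?_, fun g e ξ => ?_, fun X e => ?_⟩, hΘ⟩
  · refine isSmoothFormOn_univ_of_locally fun e => ?_
    have h1 := hP _ _ (hσ (base e))
    exact ⟨_, _, isOpen_base_preimage h1.1, hV (base e),
      IsSmoothFormOn.localForm h1 (hsmooth _ _ (hσ (base e))), hΘ _ _ (hσ (base e))⟩
  -- Translation keeps the base point, so both sides are computed with the same chosen frame.
  · exact localForm_rightMul (hP _ _ (hσ (base e))) _ g (hV _) ξ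
  · exact localForm_fundamentalVec (hP _ _ (hσ (base e))) _ (hV _) X

/-- The form is the `localForm` of its pullback along `s`; evaluating that formula along `s'` gives
the law. -/
theorem IsPrincipalConnectionForm.transformsAt {Θ : FrameForm n M}
    (hΘ : IsPrincipalConnectionForm Θ) (hs : IsLocalFrame s U) (hs' : IsLocalFrame s' U')
    {x : M} (hx : x ∈ U) (hx' : x ∈ U') :
    TransformsAt s s' x (framePullback Θ s x) (framePullback Θ s' x) := by
  intro X
  have h1 : framePullback Θ s' x X = localForm s (framePullback Θ s) (frameSection s' x)
      (mfderiv (mdl n) (frameMdl n) (frameSection s') x X) := by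
    rw [← hΘ.eq_localForm hs (e := frameSection s' x) hx]
    rfl
  rw [h1, localForm_apply, frameCoord_frameSection, matDeriv_frameCoord_frameSection hs hs' hx hx',
    mfderiv_base_frameSection hs' hx', frameIso_frameSection]
  exact transMat_mul_cancel _ _ _

theorem IsPrincipalConnectionForm.isSmoothFormOn_framePullback {Θ : FrameForm n M}
    (hΘ : IsPrincipalConnectionForm Θ) (hs : IsLocalFrame s U) :
    IsSmoothFormOn (mdl n) (framePullback Θ s) U :=
  hΘ.smooth.pullback hs.1 hs.2 fun _ _ => Set.mem_univ _

/-! ### Existence of local frames -/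

theorem exists_isLocalFrame (x₀ : M) :
    ∃ (s : ∀ x : M, Vec n ≃L[ℝ] TangentSpace (mdl n) x) (U : Set M), IsLocalFrame s U ∧ x₀ ∈ U := by
  classical
  let t := trivializationAt (Model n) (TangentSpace (mdl n) : M → Type _) x₀
  have hdim : Module.finrank ℝ (Vec n) = Module.finrank ℝ (Model n) := by
    simp [add_comm]
  let w : Vec n ≃L[ℝ] Model n := ContinuousLinearEquiv.ofFinrankEq hdim
  -- Off the base set the tangent space is read as the model space itself; these values play no
  -- role.
  let s : ∀ x : M, Vec n ≃L[ℝ] TangentSpace (mdl n) x := fun x =>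
    if hx : x ∈ t.baseSet then w.trans (t.continuousLinearEquivAt ℝ x hx).symm
    else (w : Vec n ≃L[ℝ] Model n)
  refine ⟨s, t.baseSet, isLocalFrame_iff.2 ⟨t.open_baseSet, ?_⟩,
    FiberBundle.mem_baseSet_trivializationAt' x₀⟩
  intro x hx
  refine ContMDiffAt.contMDiffWithinAt ?_
  have h1 := t.contMDiffAt_symmL (IB := mdl n) (n := ∞) hx
  rw [contMDiffAt_hom_bundle] at h1 ⊢
  refine ⟨contMDiffAt_id, ?_⟩
  refine (h1.2.clm_comp (contMDiffAt_const (c := (w : Vec n →L[ℝ] Model n)))).congr_of_eventuallyEq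
    ?_
  filter_upwards [t.open_baseSet.mem_nhds hx] with y hy
  ext1 v
  have hsy : s y = w.trans (t.continuousLinearEquivAt ℝ y hy).symm := dif_pos hy
  change ContinuousLinearMap.inCoordinates (Vec n) (Bundle.Trivial M (Vec n)) (Model n)
    (TangentSpace (mdl n)) x y x y (s y : Vec n →L[ℝ] TangentSpace (mdl n) y) v = _
  rw [hsy]
  simp [ContinuousLinearMap.inCoordinates, t.symmL_apply hy]

end

/-! ### Covariant derivatives in a local frame -/

section

variable {n : ℕ} {M : Type*} [TopologicalSpace M] [ChartedSpace (Model n) M]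
  [IsManifold (mdl n) ∞ M]
variable {s s' : ∀ x : M, Vec n ≃L[ℝ] TangentSpace (mdl n) x} {U U' : Set M}

/-- Differentiability of a vector field at a point. -/
abbrev FieldDiffAt (Y : ∀ x : M, TangentSpace (mdl n) x) (x : M) : Prop :=
  MDifferentiableAt (mdl n) (mdl n).tangent (fun y => (⟨y, Y y⟩ : TangentBundle (mdl n) M)) x

variable {c : (∀ x : M, TangentSpace (mdl n) x) →
    ∀ x : M, TangentSpace (mdl n) x →L[ℝ] TangentSpace (mdl n) x}

theorem IsCovariantDerivativeOn.sum {O : Set M}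
    (hc : IsCovariantDerivativeOn (Model n) (V := (TangentSpace (mdl n) : M → Type _)) c O)
    {x : M} (hx : x ∈ O) {ι : Type*} {t : Finset ι} {Y : ι → ∀ x : M, TangentSpace (mdl n) x}
    (hY : ∀ i ∈ t, FieldDiffAt (Y i) x) :
    c (fun y => ∑ i ∈ t, Y i y) x = ∑ i ∈ t, c (Y i) x := by
  classical
  induction t using Finset.induction_on with
  | empty =>
    simp only [Finset.sum_empty]
    exact hc.zero hx
  | insert i t hi ih =>
    have h1 : ∀ j ∈ t, FieldDiffAt (Y j) x := fun j hj => hY j (Finset.mem_insert_of_mem hj)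
    simp only [Finset.sum_insert hi]
    rw [← ih h1]
    exact hc.add (hY i (Finset.mem_insert_self i t)) (MDifferentiableAt.sum_section h1) hx

/-- The matrix of one-forms `ω^A_B` with `c s_B = ω^A_B ⊗ s_A`. -/
def covForm (c : (∀ x : M, TangentSpace (mdl n) x) →
      ∀ x : M, TangentSpace (mdl n) x →L[ℝ] TangentSpace (mdl n) x)
    (s : ∀ x : M, Vec n ≃L[ℝ] TangentSpace (mdl n) x) (x : M) :
    TangentSpace (mdl n) x →ₗ[ℝ] Gl n where
  toFun X := Matrix.of fun A B => frameCovec (s x) A (c (fun y => frameVec (s y) B) x X)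
  map_add' X Y := by ext A B; simp
  map_smul' a X := by ext A B; simp

theorem covForm_apply (x : M) (X : TangentSpace (mdl n) x) (A B : Idx n) :
    covForm c s x X A B = frameCovec (s x) A (c (fun y => frameVec (s y) B) x X) := rfl

/-- The covariant derivative with local connection form `η` with respect to the frame `s`. -/
def localCov (s : ∀ x : M, Vec n ≃L[ℝ] TangentSpace (mdl n) x)
    (η : ∀ x : M, TangentSpace (mdl n) x →ₗ[ℝ] Gl n) (Y : ∀ x : M, TangentSpace (mdl n) x)
    (x : M) : TangentSpace (mdl n) x →L[ℝ] TangentSpace (mdl n) x :=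
  ∑ A, (mvfderiv (mdl n) (fun y => frameCovec (s y) A (Y y)) x +
    ∑ B, frameCovec (s x) B (Y x) •
      LinearMap.toContinuousLinearMap ((Matrix.entryLinearMap ℝ ℝ A B).comp (η x))).smulRight
    (frameVec (s x) A)

theorem localCov_apply (η : ∀ x : M, TangentSpace (mdl n) x →ₗ[ℝ] Gl n)
    (Y : ∀ x : M, TangentSpace (mdl n) x) (x : M) (X : TangentSpace (mdl n) x) :
    localCov s η Y x X = ∑ A, (mvfderiv (mdl n) (fun y => frameCovec (s y) A (Y y)) x X +
      ∑ B, frameCovec (s x) B (Y x) * η x X A B) • frameVec (s x) A := by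
  simp [localCov]

theorem frameCovec_localCov (η : ∀ x : M, TangentSpace (mdl n) x →ₗ[ℝ] Gl n)
    (Y : ∀ x : M, TangentSpace (mdl n) x) (x : M) (X : TangentSpace (mdl n) x) (A : Idx n) :
    frameCovec (s x) A (localCov s η Y x X) =
      mvfderiv (mdl n) (fun y => frameCovec (s y) A (Y y)) x X +
      ∑ B, frameCovec (s x) B (Y x) * η x X A B := by
  rw [localCov_apply, map_sum]
  simp [frameCovec_frameVec, Matrix.one_apply]

theorem frameCovec_ext {x : M} (φ : Vec n ≃L[ℝ] TangentSpace (mdl n) x)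
    {Y Z : TangentSpace (mdl n) x} (h : ∀ A, frameCovec φ A Y = frameCovec φ A Z) : Y = Z := by
  rw [← sum_frameCovec_smul φ Y, ← sum_frameCovec_smul φ Z]
  simp only [h]

/-- A covariant derivative is determined by its local connection form. -/
theorem IsCovariantDerivativeOn.eq_localCov {O : Set M}
    (hc : IsCovariantDerivativeOn (Model n) (V := (TangentSpace (mdl n) : M → Type _)) c O)
    {x : M} (hx : x ∈ O) (hs : IsLocalFrame s U) (hxU : x ∈ U)
    {Y : ∀ x : M, TangentSpace (mdl n) x} (hY : FieldDiffAt Y x) :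
    c Y x = localCov s (covForm c s) Y x := by
  refine ContinuousLinearMap.ext fun X => frameCovec_ext (s x) fun A => ?_
  -- The field is expanded in the frame; additivity and the Leibniz rule then leave only derivatives
  -- of components and of frame vectors.
  have h1 : Y = fun y => ∑ B, ((fun y => frameCovec (s y) B (Y y)) •
      (fun y => frameVec (s y) B)) y := by
    funext y
    exact (sum_frameCovec_smul (s y) (Y y)).symm
  have h2 : ∀ B, MDifferentiableAt (mdl n) 𝓘(ℝ, ℝ) (fun y => frameCovec (s y) B (Y y)) x :=
    hs.mdifferentiableAt_frameCovec hxU hY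
  have h3 : c Y x = ∑ B, c ((fun y => frameCovec (s y) B (Y y)) •
      (fun y => frameVec (s y) B)) x := by
    conv_lhs => rw [h1]
    exact IsCovariantDerivativeOn.sum hc hx fun B _ =>
      (h2 B).smul_section (hs.mdifferentiableAt_frameVec hxU B)
  have h4 : ∀ B, c ((fun y => frameCovec (s y) B (Y y)) • (fun y => frameVec (s y) B)) x X =
      frameCovec (s x) B (Y x) • c (fun y => frameVec (s y) B) x X +
      mvfderiv (mdl n) (fun y => frameCovec (s y) B (Y y)) x X • frameVec (s x) B := by
    intro B
    rw [hc.leibniz (hs.mdifferentiableAt_frameVec hxU B) (h2 B) hx]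
    rfl
  rw [frameCovec_localCov, h3, sum_apply, map_sum]
  simp only [h4, map_add, map_smul, smul_eq_mul, frameCovec_frameVec, Matrix.one_apply,
    Finset.sum_add_distrib, covForm_apply]
  rw [add_comm]
  simp

theorem localCov_congr {η η' : ∀ x : M, TangentSpace (mdl n) x →ₗ[ℝ] Gl n} {x : M}
    (h : η x = η' x) (Y : ∀ x : M, TangentSpace (mdl n) x) :
    localCov s η Y x = localCov s η' Y x := by
  simp only [localCov, h]

/-- In components the operator is `dY^A + η^A_B Y^B`: the first term satisfies the Leibniz rule and
the second is linear over functions. -/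
theorem isCovariantDerivativeOn_localCov (hs : IsLocalFrame s U)
    (η : ∀ x : M, TangentSpace (mdl n) x →ₗ[ℝ] Gl n) :
    IsCovariantDerivativeOn (Model n) (V := (TangentSpace (mdl n) : M → Type _))
      (localCov s η) U where
  add := by
    intro Y Z x hY hZ hx
    refine ContinuousLinearMap.ext fun X => frameCovec_ext (s x) fun A => ?_
    have h1 : ∀ A, (fun y => frameCovec (s y) A ((Y + Z) y)) =
        fun y => frameCovec (s y) A (Y y) + frameCovec (s y) A (Z y) := fun A =>
      funext fun y => map_add _ _ _
    rw [add_apply, map_add, frameCovec_localCov, frameCovec_localCov, frameCovec_localCov, h1,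
      mvfderiv_fun_add (hs.mdifferentiableAt_frameCovec hx hY A)
        (hs.mdifferentiableAt_frameCovec hx hZ A), add_apply]
    simp only [Pi.add_apply, map_add, add_mul, Finset.sum_add_distrib]
    ring
  leibniz := by
    intro Y g x hY hg hx
    refine ContinuousLinearMap.ext fun X => frameCovec_ext (s x) fun A => ?_
    have h1 : ∀ A, (fun y => frameCovec (s y) A ((g • Y) y)) =
        fun y => g y * frameCovec (s y) A (Y y) := fun A =>
      funext fun y => (frameCovec (s y) A).map_smul (g y) (Y y)
    have h2 : (g x • localCov s η Y x + (mvfderiv (mdl n) g x).smulRight (Y x)) X =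
      g x • localCov s η Y x X + mvfderiv (mdl n) g x X • Y x := rfl
    have h3 : ∀ B, frameCovec (s x) B ((g • Y) x) = g x * frameCovec (s x) B (Y x) := fun B =>
      congrFun (h1 B) x
    rw [h2, map_add, map_smul, map_smul, frameCovec_localCov, frameCovec_localCov, h1,
      mvfderiv_fun_mul hg (hs.mdifferentiableAt_frameCovec hx hY A), add_apply, smul_apply,
      smul_apply]
    simp only [h3, smul_eq_mul, mul_add, Finset.mul_sum, mul_assoc]
    ring

/-- Apply the component formula in the frame `s` to the vector fields of `s'`, whose components are
the columns of the transition matrix. -/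
theorem transformsAt_covForm {O : Set M}
    (hc : IsCovariantDerivativeOn (Model n) (V := (TangentSpace (mdl n) : M → Type _)) c O)
    {x : M} (hx : x ∈ O) (hs : IsLocalFrame s U) (hs' : IsLocalFrame s' U')
    (hxU : x ∈ U) (hxU' : x ∈ U') : TransformsAt s s' x (covForm c s x) (covForm c s' x) := by
  intro X
  ext A B
  rw [Matrix.mul_apply]
  have h1 : ∑ C, transMat (s x) (s' x) A C * covForm c s' x X C B =
      frameCovec (s x) A (c (fun y => frameVec (s' y) B) x X) := by
    rw [← sum_frameCovec_mul (s' x) (frameCovec (s x) A)]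
    exact Finset.sum_congr rfl fun C _ => mul_comm _ _
  rw [h1, IsCovariantDerivativeOn.eq_localCov hc hx hs hxU
    (hs'.mdifferentiableAt_frameVec hxU' B), frameCovec_localCov, Matrix.add_apply,
    Matrix.mul_apply, add_comm]
  congr 1
  exact Finset.sum_congr rfl fun C _ => mul_comm _ _

/-- The computation of `transformsAt_covForm` run backwards: the matrix of the operator in `s'` and
`η'` have the same product with the invertible transition matrix. -/
theorem covForm_localCov_of_transformsAt
    (η : ∀ x : M, TangentSpace (mdl n) x →ₗ[ℝ] Gl n) {x : M}
    {η' : TangentSpace (mdl n) x →ₗ[ℝ] Gl n} (h : TransformsAt s s' x (η x) η') :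
    covForm (localCov s η) s' x = η' := by
  refine LinearMap.ext fun X => ?_
  have h1 : transMat (s x) (s' x) * covForm (localCov s η) s' x X =
      transMat (s x) (s' x) * η' X := by
    rw [h X]
    ext A B
    rw [Matrix.mul_apply]
    have h2 : ∑ C, transMat (s x) (s' x) A C * covForm (localCov s η) s' x X C B =
        frameCovec (s x) A (localCov s η (fun y => frameVec (s' y) B) x X) := by
      rw [← sum_frameCovec_mul (s' x) (frameCovec (s x) A)]
      exact Finset.sum_congr rfl fun C _ => mul_comm _ _
    rw [h2, frameCovec_localCov, Matrix.add_apply, Matrix.mul_apply, add_comm]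
    congr 1
    exact Finset.sum_congr rfl fun C _ => mul_comm _ _
  rw [← transMat_mul_cancel (s' x) (s x) (covForm (localCov s η) s' x X), h1,
    transMat_mul_cancel]

end

/-! ### The correspondence between affine connections and principal connection forms -/

section

variable {n : ℕ} {M : Type*} [TopologicalSpace M] [ChartedSpace (Model n) M]
  [IsManifold (mdl n) ∞ M]
variable {s s' : ∀ x : M, Vec n ≃L[ℝ] TangentSpace (mdl n) x} {U U' : Set M}

/-- A local smooth vector field agrees near a point with a global one. -/
theorem exists_contMDiff_eventuallyEq [T2Space M] {Y : ∀ x : M, TangentSpace (mdl n) x}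
    (hU : IsOpen U)
    (hY : ContMDiffOn (mdl n) (mdl n).tangent ∞ (fun y => (⟨y, Y y⟩ : TangentBundle (mdl n) M)) U)
    {x : M} (hx : x ∈ U) : ∃ Z : ∀ x : M, TangentSpace (mdl n) x,
      ContMDiff (mdl n) (mdl n).tangent ∞ (fun y => (⟨y, Z y⟩ : TangentBundle (mdl n) M)) ∧
      ∀ᶠ y in 𝓝 x, Z y = Y y := by
  -- A bump function with support in `U`, equal to `1` near `x`, cuts the field off.
  obtain ⟨f, -, hf⟩ := (SmoothBumpFunction.nhds_basis_tsupport (I := mdl n) x).mem_iff.1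
    (hU.mem_nhds hx)
  refine ⟨(f : M → ℝ) • Y, ContMDiffOn.smul_section_of_tsupport f.contMDiff.contMDiffOn hU hf hY,
    ?_⟩
  filter_upwards [f.eventuallyEq_one] with y hy
  change f y • Y y = Y y
  rw [hy]
  exact one_smul ℝ _

/-- Smoothness of a covariant derivative speaks of fields smooth on all of `M`, whereas frame
vectors are smooth on `U` only. Near each point a frame vector is replaced by a global field, and
locality of the derivative shows that the values do not change. -/
theorem isSmoothFormOn_covForm [T2Space M] {cov : Connection n M}
    (hcov : cov.ContMDiffCovariantDerivative ∞) (hs : IsLocalFrame s U) :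
    IsSmoothFormOn (mdl n) (covForm cov s) U := by
  rw [isSmoothFormOn_gl_iff]
  intro A B q hq
  obtain ⟨Z, hZ, hZs⟩ := exists_contMDiff_eventuallyEq hs.1 (hs.contMDiffOn_frameVec B) hq
  have h1 := hcov.contMDiff.contMDiff (σ := Z) (by simpa using hZ.contMDiffOn)
  have hp : ContMDiff (mdl n).tangent (mdl n) ∞ (TotalSpace.proj : TangentBundle (mdl n) M → M) :=
    contMDiff_proj (TangentSpace (mdl n))
  have h2 : ContMDiffOn (mdl n).tangent (mdl n).tangent ∞ (fun q : TangentBundle (mdl n) M =>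
      (⟨q.proj, cov Z q.proj q.2⟩ : TangentBundle (mdl n) M)) Set.univ :=
    ContMDiffOn.clm_bundle_apply (E₁ := (TangentSpace (mdl n) : M → Type _))
      (E₂ := (TangentSpace (mdl n) : M → Type _)) (b := TotalSpace.proj)
      (ϕ := fun q : TangentBundle (mdl n) M => cov Z q.proj)
      (v := fun q : TangentBundle (mdl n) M => q.2) (h1.comp hp.contMDiffOn fun _ _ => trivial)
      contMDiff_id.contMDiffOn
  have h3 := hs.contMDiffOn_frameCovec (b := TotalSpace.proj) (O := TotalSpace.proj ⁻¹' U)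
    (fun _ h => h) (h2.mono (Set.subset_univ _)) A
  have hO : IsOpen (TotalSpace.proj ⁻¹' U : Set (TangentBundle (mdl n) M)) :=
    hs.1.preimage (FiberBundle.continuous_proj _ _)
  refine ContMDiffAt.contMDiffWithinAt
    ((h3.contMDiffAt (hO.mem_nhds hq)).congr_of_eventuallyEq ?_)
  have h4 := (FiberBundle.continuous_proj (Model n)
    (TangentSpace (mdl n) : M → Type _)).continuousAt.eventually
    ((hZs.eventually_nhds).and (hs.1.mem_nhds hq))
  filter_upwards [h4] with q' hq'
  rw [covForm_apply]
  refine congrArg (frameCovec (s q'.proj) A) (DFunLike.congr_fun ?_ q'.2)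
  exact cov.isCovariantDerivativeOnUniv.congr_of_eventuallyEq
    (hs.mdifferentiableAt_frameVec hq'.2 B) (hZ.mdifferentiableAt (by simp)) Filter.univ_mem
    (hq'.1.mono fun y hy => hy.symm)

theorem corresponds_iff {cov : Connection n M} {Θ : FrameForm n M} :
    Corresponds cov Θ ↔ ∀ (s : ∀ x : M, Vec n ≃L[ℝ] TangentSpace (mdl n) x) (U : Set M),
      IsLocalFrame s U → ∀ x ∈ U, framePullback Θ s x = covForm cov s x := by
  constructor
  · intro h s U hs x hx
    refine LinearMap.ext fun X => ?_
    ext A B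
    rw [covForm_apply, h U s hs x hx X B, map_sum]
    simp [frameCovec_frameVec, Matrix.one_apply]
  · intro h U s hs x hx X B
    rw [h s U hs x hx]
    exact (sum_frameCovec_smul (s x) _).symm

theorem localForm_congr {η η' : ∀ x : M, TangentSpace (mdl n) x →ₗ[ℝ] Gl n} {e : FrameBundle n M}
    (h : η (base e) = η' (base e)) : localForm s η e = localForm s η' e := by
  refine LinearMap.ext fun ξ => ?_
  rw [localForm_apply, localForm_apply, h]

/-- Existence is the gluing of the matrices `covForm cov s` over all local frames. For uniqueness, a
principal form is the `localForm` of its pullbacks, and these are prescribed by the correspondence.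
-/
theorem existsUnique_corresponds_of_connection [T2Space M] {cov : Connection n M}
    (hcov : cov.ContMDiffCovariantDerivative ∞) :
    ∃! Θ : FrameForm n M, IsPrincipalConnectionForm Θ ∧ Corresponds cov Θ := by
  obtain ⟨Θ, hΘ, hΘ'⟩ := exists_isPrincipalConnectionForm (P := IsLocalFrame (n := n) (M := M))
    (fun _ _ h => h) (fun x => exists_isLocalFrame (n := n) x) (fun s _ => covForm cov s)
    (fun s U hs => isSmoothFormOn_covForm hcov hs)
    (fun s U s' U' hs hs' x hx hx' => transformsAt_covForm cov.isCovariantDerivativeOnUniv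
      (Set.mem_univ x) hs hs' hx hx')
  refine ⟨Θ, ⟨hΘ, corresponds_iff.2 fun s U hs x hx => ?_⟩, ?_⟩
  · rw [← framePullback_localForm hs (covForm cov s) hx]
    exact congrArg (fun f => f ∘ₗ _) (hΘ' s U hs (frameSection s x) hx)
  · rintro Θ' ⟨h1, h2⟩
    funext e
    obtain ⟨s, U, hs, hx⟩ := exists_isLocalFrame (n := n) (base e)
    rw [h1.eq_localForm hs hx, hΘ' s U hs e hx]
    exact localForm_congr (corresponds_iff.1 h2 s U hs _ hx)

/-- The frame and its inverse are smooth, so conjugating by them turns smooth matrix entries into a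
smooth endomorphism field. -/
theorem IsLocalFrame.contMDiffOn_endomorphism (hs : IsLocalFrame s U) {L : M → Gl n}
    (hL : MatSmoothOn (mdl n) L U) :
    ContMDiffOn (mdl n) ((mdl n).prod 𝓘(ℝ, Model n →L[ℝ] Model n)) ∞
      (fun x => TotalSpace.mk' (Model n →L[ℝ] Model n)
        (E := fun x : M => TangentSpace (mdl n) x →L[ℝ] TangentSpace (mdl n) x) x
        (((s x : Vec n →L[ℝ] TangentSpace (mdl n) x).comp (matCLM (L x))).comp
          ((s x).symm : TangentSpace (mdl n) x →L[ℝ] Vec n))) U := by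
  intro x hx
  refine ContMDiffAt.contMDiffWithinAt ?_
  have h1 := ((contMDiffAt_hom_bundle _).1 (hs.contMDiffOn_hom.contMDiffAt (hs.1.mem_nhds hx))).2
  have h2 := ((contMDiffAt_hom_bundle _).1 (hs.contMDiffOn_symm.contMDiffAt (hs.1.mem_nhds hx))).2
  have h3 : ContMDiffAt (mdl n) 𝓘(ℝ, Vec n →L[ℝ] Vec n) ∞ (fun x => matCLM (L x)) x := by
    refine ContMDiffAt.comp x (g := fun g : Idx n → Idx n → ℝ => matCLM (Matrix.of g))
      (f := fun y A B => L y A B) contMDiff_matCLM.contMDiffAt ?_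
    refine contMDiffAt_pi_space.2 fun A => contMDiffAt_pi_space.2 fun B => ?_
    exact (hL A B).contMDiffAt (hs.1.mem_nhds hx)
  rw [contMDiffAt_hom_bundle]
  refine ⟨contMDiffAt_id, ((h1.clm_comp h3).clm_comp h2).congr_of_eventuallyEq ?_⟩
  refine Filter.Eventually.of_forall fun y => ?_
  ext1 v
  simp [ContinuousLinearMap.inCoordinates]
  rfl

theorem IsSmoothFormOn.contMDiffOn_apply {EN : Type*} [NormedAddCommGroup EN] [NormedSpace ℝ EN]
    {HN : Type*} [TopologicalSpace HN] {J : ModelWithCorners ℝ EN HN} {N : Type*}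
    [TopologicalSpace N] [ChartedSpace HN N] [IsManifold J ∞ N]
    {η : ∀ p : N, TangentSpace J p →ₗ[ℝ] Gl n} {O : Set N} (hη : IsSmoothFormOn J η O)
    {Y : ∀ x : N, TangentSpace J x}
    (hY : ContMDiffOn J J.tangent ∞ (fun y => (⟨y, Y y⟩ : TangentBundle J N)) O) (A B : Idx n) :
    ContMDiffOn J 𝓘(ℝ, ℝ) ∞ (fun x => η x (Y x) A B) O :=
  ContMDiffOn.comp (g := fun q : TangentBundle J N => η q.proj q.2 A B)
    (isSmoothFormOn_gl_iff.1 hη A B) hY fun _ h => h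

theorem contMDiffOn_mvfderiv_apply {EN : Type*} [NormedAddCommGroup EN] [NormedSpace ℝ EN]
    {HN : Type*} [TopologicalSpace HN] {J : ModelWithCorners ℝ EN HN} {N : Type*}
    [TopologicalSpace N] [ChartedSpace HN N] [IsManifold J ∞ N]
    {f : N → ℝ} {O : Set N} (hO : IsOpen O) (hf : ContMDiffOn J 𝓘(ℝ, ℝ) ∞ f O)
    {Y : ∀ x : N, TangentSpace J x}
    (hY : ContMDiffOn J J.tangent ∞ (fun y => (⟨y, Y y⟩ : TangentBundle J N)) O) :
    ContMDiffOn J 𝓘(ℝ, ℝ) ∞ (fun x => mvfderiv J f x (Y x)) O :=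
  ContMDiffOn.comp (g := fun q : TangentBundle J N => mvfderiv J f q.proj q.2)
    (contMDiffOn_mvfderiv hO hf) hY fun _ h => h

theorem matSmoothOn_localCov (hs : IsLocalFrame s U)
    {η : ∀ x : M, TangentSpace (mdl n) x →ₗ[ℝ] Gl n} (hη : IsSmoothFormOn (mdl n) η U)
    {Y : ∀ x : M, TangentSpace (mdl n) x}
    (hY : ContMDiffOn (mdl n) (mdl n).tangent ∞
      (fun y => (⟨y, Y y⟩ : TangentBundle (mdl n) M)) U) :
    MatSmoothOn (mdl n) (fun x => Matrix.of fun A C =>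
      frameCovec (s x) A (localCov s η Y x (frameVec (s x) C))) U := by
  have hY' : ∀ A, ContMDiffOn (mdl n) 𝓘(ℝ, ℝ) ∞ (fun y => frameCovec (s y) A (Y y)) U :=
    hs.contMDiffOn_frameCovec (b := id) (fun _ h => h) hY
  intro A C
  simp only [Matrix.of_apply, frameCovec_localCov]
  exact (contMDiffOn_mvfderiv_apply hs.1 (hY' A) (hs.contMDiffOn_frameVec C)).add
    (contMDiffOn_finsetSum fun B _ =>
      (hY' B).mul (IsSmoothFormOn.contMDiffOn_apply hη (hs.contMDiffOn_frameVec C) A B))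

theorem endomorphism_eq_comp_matCLM {x : M} (φ : Vec n ≃L[ℝ] TangentSpace (mdl n) x)
    (T : TangentSpace (mdl n) x →L[ℝ] TangentSpace (mdl n) x) :
    T = ((φ : Vec n →L[ℝ] TangentSpace (mdl n) x).comp
      (matCLM (Matrix.of fun A C => frameCovec φ A (T (frameVec φ C))))).comp
        (φ.symm : TangentSpace (mdl n) x →L[ℝ] Vec n) := by
  refine ContinuousLinearMap.ext fun X => frameCovec_ext φ fun A => ?_
  have h1 : ∀ L : Gl n, frameCovec φ A (((φ : Vec n →L[ℝ] TangentSpace (mdl n) x).comp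
      (matCLM L)).comp (φ.symm : TangentSpace (mdl n) x →L[ℝ] Vec n) X) =
      ∑ C, L A C * frameCovec φ C X := by
    intro L
    simp [frameCovec, matCLM, Matrix.mulVec, dotProduct]
  rw [h1]
  refine (sum_frameCovec_mul φ ((frameCovec φ A).comp T) X).symm.trans ?_
  exact Finset.sum_congr rfl fun C _ => mul_comm _ _

theorem contMDiffOn_localCov (hs : IsLocalFrame s U)
    {η : ∀ x : M, TangentSpace (mdl n) x →ₗ[ℝ] Gl n} (hη : IsSmoothFormOn (mdl n) η U)
    {Y : ∀ x : M, TangentSpace (mdl n) x}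
    (hY : ContMDiffOn (mdl n) (mdl n).tangent ∞
      (fun y => (⟨y, Y y⟩ : TangentBundle (mdl n) M)) U) :
    ContMDiffOn (mdl n) ((mdl n).prod 𝓘(ℝ, Model n →L[ℝ] Model n)) ∞
      (fun x => TotalSpace.mk' (Model n →L[ℝ] Model n)
        (E := fun x : M => TangentSpace (mdl n) x →L[ℝ] TangentSpace (mdl n) x) x
        (localCov s η Y x)) U :=
  (hs.contMDiffOn_endomorphism (matSmoothOn_localCov hs hη hY)).congr fun x _ =>
    congrArg (TotalSpace.mk x) (endomorphism_eq_comp_matCLM (s x) (localCov s η Y x))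

/-- The connection which at each point `x` is given by a local frame `σ x` near `x` and a local
connection form `η x`. -/
def pointwiseConnection (σ : ∀ _ y : M, Vec n ≃L[ℝ] TangentSpace (mdl n) y) (V : M → Set M)
    (hσ : ∀ x, IsLocalFrame (σ x) (V x)) (hV : ∀ x, x ∈ V x)
    (η : ∀ _ y : M, TangentSpace (mdl n) y →ₗ[ℝ] Gl n) : Connection n M where
  toFun Y x := localCov (σ x) (η x) Y x
  isCovariantDerivativeOnUniv :=
    { add := fun {_ _ x} hY hZ _ => (isCovariantDerivativeOn_localCov (hσ x) (η x)).add hY hZ (hV x)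
      leibniz := fun {_ _ x} hY hg _ =>
        (isCovariantDerivativeOn_localCov (hσ x) (η x)).leibniz hY hg (hV x) }

/-- At `x` the connection is built from the chosen frame `σ x`. The transformation law of the
pullbacks of `Θ` identifies its matrix in any other frame near `x` with the pullback along that
frame. -/
theorem corresponds_pointwiseConnection {Θ : FrameForm n M} (hΘ : IsPrincipalConnectionForm Θ)
    (σ : ∀ _ y : M, Vec n ≃L[ℝ] TangentSpace (mdl n) y) (V : M → Set M)
    (hσ : ∀ x, IsLocalFrame (σ x) (V x)) (hV : ∀ x, x ∈ V x) :
    Corresponds (pointwiseConnection σ V hσ hV fun x => framePullback Θ (σ x)) Θ := by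
  refine corresponds_iff.2 fun s U hs x hx => Eq.symm ?_
  refine Eq.trans ?_ (covForm_localCov_of_transformsAt (framePullback Θ (σ x))
    (hΘ.transformsAt (hσ x) hs (hV x) hx))
  refine LinearMap.ext fun X => ?_
  ext A B
  rw [covForm_apply, covForm_apply]
  rfl

/-- A connection assembled from frames that jump from point to point is not visibly smooth. The
correspondence repairs this: near each point the connection is `localCov` for one fixed frame and a
smooth form. -/
theorem Corresponds.contMDiffCovariantDerivative {cov : Connection n M} {Θ : FrameForm n M}
    (hΘ : IsPrincipalConnectionForm Θ) (h : Corresponds cov Θ) :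
    cov.ContMDiffCovariantDerivative ∞ := by
  refine ⟨⟨fun {Y} hY x _ => ?_⟩⟩
  have hY' : ContMDiff (mdl n) (mdl n).tangent ∞
      (fun y => (⟨y, Y y⟩ : TangentBundle (mdl n) M)) := by
    rw [← contMDiffOn_univ]
    simpa using hY
  obtain ⟨s, U, hs, hx⟩ := exists_isLocalFrame (n := n) x
  have h1 := contMDiffOn_localCov hs (hΘ.isSmoothFormOn_framePullback hs)
    (hY'.contMDiffOn (s := U))
  refine ContMDiffAt.contMDiffWithinAt (ContMDiffAt.congr_of_eventuallyEq
    (h1.contMDiffAt (hs.1.mem_nhds hx)) ?_)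
  filter_upwards [hs.1.mem_nhds hx] with y hy
  refine congrArg (TotalSpace.mk y) ?_
  refine (IsCovariantDerivativeOn.eq_localCov cov.isCovariantDerivativeOnUniv (Set.mem_univ y)
    hs hy (hY'.mdifferentiableAt (by simp))).trans ?_
  exact localCov_congr (corresponds_iff.1 h _ _ hs y hy).symm Y

theorem exists_connection_of_isPrincipalConnectionForm {Θ : FrameForm n M}
    (hΘ : IsPrincipalConnectionForm Θ) :
    ∃ cov : Connection n M, cov.ContMDiffCovariantDerivative ∞ ∧ Corresponds cov Θ := by
  choose σ V hσ hV using exists_isLocalFrame (n := n) (M := M)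
  have h := corresponds_pointwiseConnection hΘ σ V hσ hV
  exact ⟨_, h.contMDiffCovariantDerivative hΘ, h⟩

/-- The axioms constrain a covariant derivative only on fields differentiable at the point, so
agreement is claimed only for those; there both sides are given by the same component formula. -/
theorem Corresponds.eq_connection {Θ : FrameForm n M} {cov cov' : Connection n M}
    (h : Corresponds cov Θ) (h' : Corresponds cov' Θ) {Y : ∀ x : M, TangentSpace (mdl n) x}
    {x : M} (hY : FieldDiffAt Y x) : cov' Y x = cov Y x := by
  obtain ⟨s, U, hs, hx⟩ := exists_isLocalFrame (n := n) x
  rw [IsCovariantDerivativeOn.eq_localCov cov.isCovariantDerivativeOnUniv (Set.mem_univ x) hs hx hY,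
    IsCovariantDerivativeOn.eq_localCov cov'.isCovariantDerivativeOnUniv (Set.mem_univ x) hs hx hY]
  refine localCov_congr ?_ Y
  rw [← corresponds_iff.1 h s U hs x hx, ← corresponds_iff.1 h' s U hs x hx]

end

/-! ### Smooth orthonormalization of semidefinite matrices -/

section

section GramSchmidt

variable {n : ℕ} {EN : Type*} [NormedAddCommGroup EN] [NormedSpace ℝ EN]
    {HN : Type*} [TopologicalSpace HN] {J : ModelWithCorners ℝ EN HN} {N : Type*}
    [TopologicalSpace N] [ChartedSpace HN N]

theorem contMDiffOn_mulVec {H : N → Gl n} {O : Set N} (hH : MatSmoothOn J H O)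
    {v : N → Idx n → ℝ} (hv : ∀ A, ContMDiffOn J 𝓘(ℝ, ℝ) ∞ (fun x => v x A) O) (A : Idx n) :
    ContMDiffOn J 𝓘(ℝ, ℝ) ∞ (fun x => (H x).mulVec (v x) A) O := by
  simp only [Matrix.mulVec, dotProduct]
  exact contMDiffOn_finsetSum fun C _ => (hH A C).mul (hv C)

theorem contMDiffOn_dotProduct {O : Set N} {u v : N → Idx n → ℝ}
    (hu : ∀ A, ContMDiffOn J 𝓘(ℝ, ℝ) ∞ (fun x => u x A) O)
    (hv : ∀ A, ContMDiffOn J 𝓘(ℝ, ℝ) ∞ (fun x => v x A) O) :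
    ContMDiffOn J 𝓘(ℝ, ℝ) ∞ (fun x => u x ⬝ᵥ v x) O :=
  contMDiffOn_finsetSum fun C _ => (hu C).mul (hv C)

theorem dotProduct_mulVec_comm_of_posSemidef {H : Gl n} (hH : H.PosSemidef) (u v : Idx n → ℝ) :
    u ⬝ᵥ H.mulVec v = v ⬝ᵥ H.mulVec u := by
  have h : H.transpose = H := by simpa [Matrix.IsHermitian] using hH.1
  conv_rhs => rw [← h, Matrix.mulVec_transpose, dotProduct_comm, ← Matrix.dotProduct_mulVec]

/-- If every residual had length zero, semidefiniteness would put it into the kernel of `H`. Then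
`H` would map everything into the span of the `k` vectors `H β_a`, against `k < H.rank`. -/
theorem exists_pos_of_lt_rank {H : Gl n} (hH : H.PosSemidef) {k : ℕ} (hk : k < H.rank)
    (β : Fin k → Idx n → ℝ) : ∃ α : Idx n → ℝ,
      0 < (α - ∑ a, (α ⬝ᵥ H.mulVec (β a)) • β a) ⬝ᵥ
        H.mulVec (α - ∑ a, (α ⬝ᵥ H.mulVec (β a)) • β a) := by
  have hzero : ∀ w : Idx n → ℝ, w ⬝ᵥ H.mulVec w ≤ 0 → H.mulVec w = 0 := fun w hw =>
    (hH.dotProduct_mulVec_zero_iff w).1 (le_antisymm hw (hH.dotProduct_mulVec_nonneg w))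
  by_contra! hcon
  have h0 : ∀ α : Idx n → ℝ, H.mulVec α = ∑ a, (α ⬝ᵥ H.mulVec (β a)) • H.mulVec (β a) := by
    intro α
    have h2 := hzero _ (hcon α)
    rw [Matrix.mulVec_sub, sub_eq_zero] at h2
    rw [h2, Matrix.mulVec_sum]
    simp only [Matrix.mulVec_smul]
  have h3 : LinearMap.range H.mulVecLin ≤ Submodule.span ℝ (Set.range fun a => H.mulVec (β a)) := by
    rintro _ ⟨α, rfl⟩
    rw [Matrix.mulVecLin_apply, h0 α]
    exact Submodule.sum_mem _ fun a _ => Submodule.smul_mem _ _ (Submodule.subset_span ⟨a, rfl⟩)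
  have h4 := Submodule.finrank_mono h3
  have h5 := finrank_range_le_card (R := ℝ) fun a => H.mulVec (β a)
  rw [Fintype.card_fin] at h5
  have h6 : H.rank = Module.finrank ℝ (LinearMap.range H.mulVecLin) := rfl
  exact absurd (h4.trans h5) (by omega)

/-- Smooth Gram–Schmidt orthonormalization for a smooth family of positive semidefinite
matrices. -/
theorem exists_orthonormal_family {H : N → Gl n} {O : Set N} (hO : IsOpen O)
    (hH : MatSmoothOn J H O) (hpos : ∀ x ∈ O, (H x).PosSemidef) {x₀ : N} (hx₀ : x₀ ∈ O) (k : ℕ)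
    (hk : k ≤ (H x₀).rank) : ∃ (V : Set N) (β : Fin k → N → Idx n → ℝ), IsOpen V ∧ x₀ ∈ V ∧
      V ⊆ O ∧ (∀ a A, ContMDiffOn J 𝓘(ℝ, ℝ) ∞ (fun x => β a x A) V) ∧
      ∀ x ∈ V, ∀ a b, β a x ⬝ᵥ (H x).mulVec (β b x) = if a = b then 1 else 0 := by
  induction k with
  | zero => exact ⟨O, fun a => a.elim0, hO, hx₀, subset_rfl, fun a => a.elim0, fun _ _ a => a.elim0⟩
  | succ k ih =>
    obtain ⟨V, β, hV, hxV, hVO, hβ, hδ⟩ := ih (by omega)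
    -- The rank at `x₀` exceeds `k`, so some covector has a residual of positive length there. The
    -- same constant covector is used at nearby points.
    obtain ⟨α, hα⟩ := exists_pos_of_lt_rank (hpos x₀ hx₀) (k := k) (by omega) fun a => β a x₀
    let q : N → Idx n → ℝ := fun x => α - ∑ a, (α ⬝ᵥ (H x).mulVec (β a x)) • β a x
    let Q : N → ℝ := fun x => q x ⬝ᵥ (H x).mulVec (q x)
    have hHV : MatSmoothOn J H V := fun A B => (hH A B).mono hVO
    have hq : ∀ A, ContMDiffOn J 𝓘(ℝ, ℝ) ∞ (fun x => q x A) V := by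
      intro A
      simp only [q, Pi.sub_apply, Finset.sum_apply, Pi.smul_apply, smul_eq_mul]
      exact contMDiffOn_const.sub (contMDiffOn_finsetSum fun a _ =>
        (contMDiffOn_dotProduct (u := fun _ => α) (fun _ => contMDiffOn_const)
          (contMDiffOn_mulVec hHV (hβ a))).mul (hβ a A))
    have hQ : ContMDiffOn J 𝓘(ℝ, ℝ) ∞ Q V := contMDiffOn_dotProduct hq (contMDiffOn_mulVec hHV hq)
    have horth : ∀ x ∈ V, ∀ a, β a x ⬝ᵥ (H x).mulVec (q x) = 0 := by
      intro x hx a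
      simp only [q, Matrix.mulVec_sub, Matrix.mulVec_sum, Matrix.mulVec_smul, dotProduct_sub,
        dotProduct_sum, dotProduct_smul, hδ x hx, smul_eq_mul]
      simp [dotProduct_mulVec_comm_of_posSemidef (hpos x (hVO hx)) α]
    -- On the open set where the residual keeps positive length it can be normalized, and the square
    -- root is smooth there.
    refine ⟨V ∩ Q ⁻¹' Set.Ioi 0, Fin.cons (fun x => (√(Q x))⁻¹ • q x) β,
      hQ.continuousOn.isOpen_inter_preimage hV isOpen_Ioi, ⟨hxV, hα⟩,
      Set.inter_subset_left.trans hVO, ?_, ?_⟩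
    · refine Fin.cases (fun A => ?_) fun a A => ?_
      · simp only [Fin.cons_zero, Pi.smul_apply, smul_eq_mul]
        intro x hx
        have h1 : ContMDiffAt 𝓘(ℝ, ℝ) 𝓘(ℝ, ℝ) ∞ (fun t : ℝ => (√t)⁻¹) (Q x) :=
          ContDiffAt.contMDiffAt (((Real.contDiffAt_sqrt (ne_of_gt hx.2))).inv
            (Real.sqrt_ne_zero'.2 hx.2))
        have h2 := ContMDiffAt.comp x h1 (hQ.contMDiffAt (hV.mem_nhds hx.1))
        exact (h2.mul ((hq A).contMDiffAt (hV.mem_nhds hx.1))).contMDiffWithinAt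
      · simp only [Fin.cons_succ]
        exact (hβ a A).mono Set.inter_subset_left
    · intro x hx
      refine Fin.cases (Fin.cases ?_ fun b => ?_) fun a => Fin.cases ?_ fun b => ?_
      · have h1 : √(Q x) * √(Q x) = q x ⬝ᵥ (H x).mulVec (q x) := Real.mul_self_sqrt (le_of_lt hx.2)
        have h2 : √(Q x) ≠ 0 := Real.sqrt_ne_zero'.2 hx.2
        simp only [Fin.cons_zero, Matrix.mulVec_smul, dotProduct_smul, smul_dotProduct, smul_eq_mul,
          ← h1, if_true]
        field_simp
      · simp [horth x hx.1, (Fin.succ_ne_zero b).symm,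
          dotProduct_mulVec_comm_of_posSemidef (hpos x (hVO hx.1)) (q x)]
      · simp [Matrix.mulVec_smul, horth x hx.1, Fin.succ_ne_zero]
      · simpa using hδ x hx.1 a b

/-- Near `x₀`, a smooth family of positive semidefinite matrices `H` of rank `n` with `τ H = 0`,
`τ ≠ 0` can be brought to the normal form `spaceDiag`. -/
theorem exists_normal_form {H : N → Gl n} {τ : N → Idx n → ℝ} {O : Set N} (hO : IsOpen O)
    (hH : MatSmoothOn J H O) (hτ : ∀ A, ContMDiffOn J 𝓘(ℝ, ℝ) ∞ (fun x => τ x A) O)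
    (hpos : ∀ x ∈ O, (H x).PosSemidef) {x₀ : N} (hx₀ : x₀ ∈ O) (hrank : (H x₀).rank = n)
    (hτ₀ : τ x₀ ≠ 0) (hτH : ∀ x ∈ O, ∀ v, τ x ⬝ᵥ (H x).mulVec v = 0) :
    ∃ (V : Set N) (k l : N → Gl n), IsOpen V ∧ x₀ ∈ V ∧ V ⊆ O ∧ MatSmoothOn J k V ∧
      ∀ x ∈ V, l x * k x = 1 ∧ (∀ B, ∑ A, τ x A * k x A B = (1 : Gl n) idxT B) ∧
        H x = k x * spaceDiag n * (k x).transpose := by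
  obtain ⟨V, β, hV, hxV, hVO, hβ, hδ⟩ := exists_orthonormal_family hO hH hpos hx₀ n hrank.ge
  obtain ⟨A₀, hA₀⟩ : ∃ A, τ x₀ A ≠ 0 := by
    by_contra! h
    exact hτ₀ (funext h)
  -- A unit timelike vector: a multiple of a basis vector on which `τ` does not vanish at `x₀`,
  -- hence not nearby either.
  let v : N → Idx n → ℝ := fun x => (τ x A₀)⁻¹ • Pi.single A₀ 1
  -- The columns are the new frame: `v`, and the vectors `H β_b`, which are spacelike because `τ H =
  -- 0`.
  let k : N → Gl n := fun x => Matrix.of fun A B =>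
    Sum.elim (fun _ => v x A) (fun b => (H x).mulVec (β b x) A) B
  -- The rows are the dual coframe: `τ`, and `β_a` corrected by a multiple of `τ` so that it
  -- vanishes on `v`.
  let l : N → Gl n := fun x => Matrix.of fun A B =>
    Sum.elim (fun _ => τ x B) (fun a => β a x B - (β a x ⬝ᵥ v x) * τ x B) A
  have hτV := fun A => (hτ A).mono hVO
  have hHV : MatSmoothOn J H V := fun A B => (hH A B).mono hVO
  have hW : IsOpen (V ∩ (fun x => τ x A₀) ⁻¹' {0}ᶜ) :=
    (hτV A₀).continuousOn.isOpen_inter_preimage hV isOpen_compl_singleton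
  refine ⟨V ∩ (fun x => τ x A₀) ⁻¹' {0}ᶜ, k, l, hW, ⟨hxV, hA₀⟩, Set.inter_subset_left.trans hVO,
    ?_, ?_⟩
  · rintro A (⟨⟩ | b)
    · simp only [k, Matrix.of_apply, Sum.elim_inl, v, Pi.smul_apply, smul_eq_mul]
      exact (((hτV A₀).mono Set.inter_subset_left).inv₀ fun x hx => hx.2).mul contMDiffOn_const
    · simp only [k, Matrix.of_apply, Sum.elim_inr]
      exact (contMDiffOn_mulVec hHV (hβ b) A).mono Set.inter_subset_left
  · intro x hx
    have h1 : τ x ⬝ᵥ v x = 1 := by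
      simp only [v, dotProduct_smul, dotProduct_single, mul_one, smul_eq_mul]
      exact inv_mul_cancel₀ hx.2
    have hxO := hVO hx.1
    have hrow : ∀ (a : Fin n) (w : Idx n → ℝ), (∑ C, l x (idxS a) C * (H x).mulVec w C) =
        β a x ⬝ᵥ (H x).mulVec w := by
      intro a w
      have h2 : (∑ C, l x (idxS a) C * (H x).mulVec w C) =
          (β a x - (β a x ⬝ᵥ v x) • τ x) ⬝ᵥ (H x).mulVec w := rfl
      rw [h2, sub_dotProduct, smul_dotProduct, hτH x hxO, smul_zero, sub_zero]
    have hlk : l x * k x = 1 := by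
      ext (⟨⟩ | a) (⟨⟩ | b)
      · exact h1
      · exact hτH x hxO _
      · have h2 : (l x * k x) (idxS a) idxT = (β a x - (β a x ⬝ᵥ v x) • τ x) ⬝ᵥ v x := rfl
        rw [h2, sub_dotProduct, smul_dotProduct, h1]
        simp
      · refine (hrow a (β b x)).trans ((hδ x hx.1 a b).trans ?_)
        simp [Matrix.one_apply]
    refine ⟨hlk, ?_, ?_⟩
    · rintro (⟨⟩ | b)
      · exact h1
      · exact hτH x hxO _
    -- The time row and the corrections in the spatial rows vanish because `τ H = 0`. Multiplication
    -- by `k`, the inverse of `l`, then gives the normal form.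
    · have hlH : l x * H x = spaceDiag n * (k x).transpose := by
        ext A B
        have h3 : (H x).col B = (H x).mulVec (Pi.single B 1) := by simp
        have h4 : (l x * H x) A B = ∑ C, l x A C * (H x).mulVec (Pi.single B 1) C := by
          rw [Matrix.mul_apply, ← h3]
          rfl
        rw [h4]
        rcases A with (⟨⟩ | a)
        · refine (hτH x hxO _).trans ?_
          simp [Matrix.mul_apply, spaceDiag]
        · rw [hrow, dotProduct_mulVec_comm_of_posSemidef (hpos x hxO), single_one_dotProduct]
          simp [Matrix.mul_apply, spaceDiag, Matrix.one_apply, k]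
      rw [mul_assoc, ← hlH, ← mul_assoc, mul_eq_one_comm.1 hlk, one_mul]

end GramSchmidt

end

/-! ### Galilei frames in matrix terms -/

section

variable {n : ℕ} {M : Type*} [TopologicalSpace M] [ChartedSpace (Model n) M]
  [IsManifold (mdl n) ∞ M]
variable {s s' : ∀ x : M, Vec n ≃L[ℝ] TangentSpace (mdl n) x} {U U' : Set M}
variable {S : GalileiStructure n M}

variable (S) in
/-- The components of the space metric in a frame. -/
def metricMat {x : M} (φ : Vec n ≃L[ℝ] TangentSpace (mdl n) x) : Gl n :=
  Matrix.of fun A B => frameCovec φ A (S.metric x (frameCovec φ B))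

/-- Rephrased for frame components, the definition becomes stable under matrix calculus: a change of
frame acts by a product on `τ` and by congruence on `h`. -/
theorem isGalileiFrameAt_iff {x : M} {φ : Vec n ≃L[ℝ] TangentSpace (mdl n) x} :
    IsGalileiFrameAt S x φ ↔
      (∀ B, S.clock x (frameVec φ B) = (1 : Gl n) idxT B) ∧ metricMat S φ = spaceDiag n := by
  constructor
  · intro h
    refine ⟨?_, ?_⟩
    · rintro (⟨⟩ | b)
      · exact h.1
      · exact clock_frameVec h b
    · ext A B
      rw [metricMat, Matrix.of_apply, h.2, map_sum]
      simp only [map_smul, frameCovec_frameVec, smul_eq_mul]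
      rcases A with (⟨⟩ | a) <;> rcases B with (⟨⟩ | b) <;>
        simp [spaceDiag, Matrix.one_apply, eq_comm]
  · rintro ⟨h1, h2⟩
    refine ⟨h1 idxT, fun α => ?_⟩
    have h3 : ∀ A, frameCovec φ A (S.metric x α) = ∑ B, α (frameVec φ B) * spaceDiag n B A := by
      intro A
      rw [S.metric_symm, ← sum_frameCovec_mul φ α, ← h2]
      exact Finset.sum_congr rfl fun B _ => mul_comm _ _
    rw [← sum_frameCovec_smul φ (S.metric x α)]
    simp only [h3, Fintype.sum_sum_type]
    simp [spaceDiag, Matrix.one_apply]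

theorem clock_frameVec_eq_sum_transMat {x : M} (φ ψ : Vec n ≃L[ℝ] TangentSpace (mdl n) x)
    (B : Idx n) :
    S.clock x (frameVec ψ B) = ∑ A, S.clock x (frameVec φ A) * transMat φ ψ A B := by
  rw [← sum_frameCovec_mul φ (S.clock x)]
  exact Finset.sum_congr rfl fun A _ => mul_comm _ _

theorem metricMat_eq_mul {x : M} (φ ψ : Vec n ≃L[ℝ] TangentSpace (mdl n) x) :
    metricMat S φ = transMat φ ψ * metricMat S ψ * (transMat φ ψ).transpose := by
  have h : ∀ A (Y : TangentSpace (mdl n) x),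
      frameCovec φ A Y = ∑ C, transMat φ ψ A C * frameCovec ψ C Y := by
    intro A Y
    rw [← sum_frameCovec_mul ψ (frameCovec φ A)]
    exact Finset.sum_congr rfl fun B _ => mul_comm _ _
  have h1 : metricMat S φ = transMat φ ψ * Matrix.of fun C B =>
      frameCovec ψ C (S.metric x (frameCovec φ B)) := by
    ext A B
    exact h A _
  rw [h1, mul_assoc]
  congr 1
  ext C B
  rw [Matrix.of_apply, S.metric_symm, h B, Matrix.mul_apply]
  refine Finset.sum_congr rfl fun D _ => ?_
  rw [Matrix.transpose_apply, metricMat, Matrix.of_apply, S.metric_symm, mul_comm]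

/-- Conditions on a matrix to be in the Galilei group. -/
theorem transMat_galilei {x : M} {φ ψ : Vec n ≃L[ℝ] TangentSpace (mdl n) x}
    (hφ : IsGalileiFrameAt S x φ) (hψ : IsGalileiFrameAt S x ψ) :
    (∀ B, transMat φ ψ idxT B = (1 : Gl n) idxT B) ∧
      transMat φ ψ * spaceDiag n * (transMat φ ψ).transpose = spaceDiag n := by
  rw [isGalileiFrameAt_iff] at hφ hψ
  refine ⟨fun B => ?_, ?_⟩
  · rw [← hψ.1 B, clock_frameVec_eq_sum_transMat φ ψ]
    simp [hφ.1, Matrix.one_apply]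
  · conv_rhs => rw [← hφ.2, metricMat_eq_mul φ ψ, hψ.2]

theorem transGL_mem_galGroup {x : M} {φ ψ : Vec n ≃L[ℝ] TangentSpace (mdl n) x}
    (hφ : IsGalileiFrameAt S x φ) (hψ : IsGalileiFrameAt S x ψ) : transGL φ ψ ∈ galGroup n :=
  (exists_galGroupMatrix_iff _).2 (by rw [coe_transGL]; exact transMat_galilei hφ hψ)

section

variable {EN : Type*} [NormedAddCommGroup EN] [NormedSpace ℝ EN]
    {HN : Type*} [TopologicalSpace HN] {J : ModelWithCorners ℝ EN HN} {N : Type*}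
    [TopologicalSpace N] [ChartedSpace HN N]

theorem matDeriv_mul_const_mul_transpose {f : N → Gl n} {p : N} (hf : MatDiffAt J f p) (D : Gl n)
    (ξ : TangentSpace J p) :
    matDeriv J (fun q => f q * D * (f q).transpose) p ξ =
      matDeriv J f p ξ * D * (f p).transpose + f p * D * (matDeriv J f p ξ).transpose := by
  have h1 : MatDiffAt J (fun q => (f q).transpose) p := fun A B => hf B A
  have h2 : MatDiffAt J (fun q => f q * D) p := fun A B => by
    simp only [Matrix.mul_apply]
    exact (mvfderiv_sum fun C _ => (hf A C).mul mdifferentiableAt_const).1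
  rw [matDeriv_mul h2 h1, matDeriv_mul hf (matDiffAt_const D p), matDeriv_const]
  have h3 : matDeriv J (fun q => (f q).transpose) p ξ = (matDeriv J f p ξ).transpose := rfl
  rw [h3]
  simp

/-- The logarithmic derivative of a map to the Galilei group has values in the Galilei algebra. -/
theorem inv_mul_matDeriv_mem_galAlg {f : N → Gl n} {p : N} (hf : MatDiffAt J f p)
    (h : ∀ᶠ q in 𝓝 p, (∀ B, f q idxT B = (1 : Gl n) idxT B) ∧
      f q * spaceDiag n * (f q).transpose = spaceDiag n) {b : Gl n} (hb : b * f p = 1)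
    (ξ : TangentSpace J p) : b * matDeriv J f p ξ ∈ galAlg n := by
  refine (exists_galAlgMatrix_iff _).2 ⟨?_, ?_⟩
  · have h0 := h.self_of_nhds
    -- The first row of `f` is constant, and the inverse `b` has the same first row, so the product
    -- has vanishing first row.
    have h1 : ∀ B, matDeriv J f p ξ idxT B = 0 := by
      intro B
      rw [matDeriv_apply, mvfderiv]
      have h2 : (fun q => f q idxT B) =ᶠ[𝓝 p] fun _ => (1 : Gl n) idxT B :=
        h.mono fun q hq => hq.1 B
      rw [h2.mfderiv_eq, mfderiv_const]
      rfl
    have h3 : ∀ B, b idxT B = (1 : Gl n) idxT B := by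
      intro B
      rw [← mul_eq_one_comm.1 hb, Matrix.mul_apply]
      simp [h0.1, Matrix.one_apply]
    intro B
    simp [Matrix.mul_apply, h3, h1, Matrix.one_apply]
  -- Differentiating the invariance of `spaceDiag n` and multiplying by `b` and its transpose gives
  -- the antisymmetry relation of the Galilei algebra.
  · have h1 : matDeriv J (fun q => f q * spaceDiag n * (f q).transpose) p ξ = 0 := by
      rw [matDeriv_congr (h.mono fun q hq => hq.2), matDeriv_const]
      rfl
    rw [matDeriv_mul_const_mul_transpose hf] at h1
    have hb' : (f p).transpose * b.transpose = 1 := by rw [← Matrix.transpose_mul, hb]; simp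
    set D := matDeriv J f p ξ
    calc b * D * spaceDiag n + spaceDiag n * (b * D).transpose
        = b * D * spaceDiag n * ((f p).transpose * b.transpose) +
          (b * f p) * spaceDiag n * (b * D).transpose := by rw [hb', hb, mul_one, one_mul]
      _ = b * (D * spaceDiag n * (f p).transpose + f p * spaceDiag n * D.transpose) *
          b.transpose := by
        rw [Matrix.transpose_mul]
        simp only [mul_add, add_mul, mul_assoc]
      _ = 0 := by rw [h1]; simp

end

/-! ### Existence of local Galilei frames -/

theorem IsLocalFrame.exists_mul (hs : IsLocalFrame s U) {k l : M → Gl n} {V : Set M}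
    (hV : IsOpen V) (hVU : V ⊆ U) (hk : MatSmoothOn (mdl n) k V) (hlk : ∀ x ∈ V, l x * k x = 1) :
    ∃ s' : ∀ x : M, Vec n ≃L[ℝ] TangentSpace (mdl n) x, IsLocalFrame s' V ∧
      ∀ x ∈ V, transMat (s x) (s' x) = k x := by
  classical
  -- Extended by `1` where `k` is not invertible, which does not happen on `V`.
  let g : M → GL (Idx n) ℝ := fun x => if h : IsUnit (k x) then h.unit else 1
  have hg : ∀ x ∈ V, (g x : Gl n) = k x := by
    intro x hx
    have h : IsUnit (k x) := IsUnit.of_mul_eq_one_right _ (hlk x hx)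
    simp [g, h]
  let s' : ∀ x : M, Vec n ≃L[ℝ] TangentSpace (mdl n) x := fun x =>
    frameIso (rightMul (g x) (frameSection s x))
  refine ⟨s', isLocalFrame_iff.2 ⟨hV, fun x hx => ?_⟩, fun x hx => ?_⟩
  · refine ContMDiffAt.contMDiffWithinAt ?_
    have h1 := ((contMDiffAt_hom_bundle _).1
      (hs.contMDiffOn_hom.contMDiffAt (hs.1.mem_nhds (hVU hx)))).2
    have h3 : ContMDiffAt (mdl n) 𝓘(ℝ, Vec n →L[ℝ] Vec n) ∞ (fun x => matCLM (k x)) x := by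
      refine ContMDiffAt.comp x (g := fun g : Idx n → Idx n → ℝ => matCLM (Matrix.of g))
        (f := fun y A B => k y A B) contMDiff_matCLM.contMDiffAt ?_
      refine contMDiffAt_pi_space.2 fun A => contMDiffAt_pi_space.2 fun B => ?_
      exact (hk A B).contMDiffAt (hV.mem_nhds hx)
    rw [contMDiffAt_hom_bundle]
    refine ⟨contMDiffAt_id, (h1.clm_comp h3).congr_of_eventuallyEq ?_⟩
    filter_upwards [hV.mem_nhds hx] with y hy
    rw [← hg y hy]
    exact inCoordinates_comp _ _ _ _
  · refine (transMat_rightMul (frameSection s x) (s x) (g x)).trans ?_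
    rw [frameIso_frameSection]
    exact (congrArg₂ (· * ·) (transMat_self (s x)) (hg x hx)).trans (one_mul (k x))

theorem IsLocalFrame.contMDiffOn_frameCovec_section (hs : IsLocalFrame s U) (A : Idx n) :
    ContMDiffOn (mdl n) ((mdl n).prod 𝓘(ℝ, Model n →L[ℝ] ℝ)) ∞
      (fun x => TotalSpace.mk' (Model n →L[ℝ] ℝ)
        (E := fun x : M => TangentSpace (mdl n) x →L[ℝ] ℝ) x (frameCovec (s x) A)) U := by
  intro x hx
  refine ContMDiffAt.contMDiffWithinAt ?_
  have h2 := ((contMDiffAt_hom_bundle _).1 (hs.contMDiffOn_symm.contMDiffAt (hs.1.mem_nhds hx))).2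
  have h4 := (contMDiffAt_const (I := mdl n) (x := x) (n := ∞)
    (c := (ContinuousLinearMap.proj A : Vec n →L[ℝ] ℝ))).clm_comp h2
  refine (contMDiffAt_hom_bundle (E₂ := Bundle.Trivial M ℝ) _).2
    ⟨contMDiffAt_id, h4.congr_of_eventuallyEq ?_⟩
  refine Filter.Eventually.of_forall fun y => ?_
  ext1 v
  simp [ContinuousLinearMap.inCoordinates]
  rfl

theorem IsLocalFrame.contMDiffOn_clock (hs : IsLocalFrame s U) (A : Idx n) :
    ContMDiffOn (mdl n) 𝓘(ℝ, ℝ) ∞ (fun x => S.clock x (frameVec (s x) A)) U := by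
  have h := ContMDiffOn.clm_bundle_apply (E₁ := (TangentSpace (mdl n) : M → Type _))
    (E₂ := Bundle.Trivial M ℝ) (b := fun x : M => x)
    (ϕ := fun x => S.clock x) (v := fun x => frameVec (s x) A)
    (S.contMDiff_clock.contMDiffOn (s := U)) (hs.contMDiffOn_frameVec A)
  intro x hx
  have h1 := (contMDiffAt_section _).1 (h.contMDiffAt (hs.1.mem_nhds hx))
  exact ContMDiffAt.contMDiffWithinAt h1

theorem IsLocalFrame.matSmoothOn_metricMat (hs : IsLocalFrame s U) :
    MatSmoothOn (mdl n) (fun x => metricMat S (s x)) U := fun A B => by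
  have h := ContMDiffOn.clm_bundle_apply
    (E₁ := fun x : M => TangentSpace (mdl n) x →L[ℝ] Bundle.Trivial M ℝ x)
    (E₂ := (TangentSpace (mdl n) : M → Type _)) (b := fun x : M => x)
    (ϕ := fun x => S.metric x) (v := fun x => frameCovec (s x) B)
    (S.contMDiff_metric.contMDiffOn (s := U)) (hs.contMDiffOn_frameCovec_section B)
  exact hs.contMDiffOn_frameCovec (b := id) (fun _ h => h) h A

end

section

variable {n : ℕ} {M : Type*} [TopologicalSpace M] [ChartedSpace (Model n) M]
  [IsManifold (mdl n) ∞ M]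
variable {s s' : ∀ x : M, Vec n ≃L[ℝ] TangentSpace (mdl n) x} {U U' : Set M}
variable {S : GalileiStructure n M}

theorem metricMat_mulVec {x : M} (φ : Vec n ≃L[ℝ] TangentSpace (mdl n) x) (v : Idx n → ℝ) :
    (metricMat S φ).mulVec v = φ.symm (S.metric x (∑ A, v A • frameCovec φ A)) := by
  ext A
  change _ = frameCovec φ A (S.metric x (∑ A, v A • frameCovec φ A))
  simp only [map_sum, map_smul, smul_eq_mul, Matrix.mulVec, dotProduct]
  exact Finset.sum_congr rfl fun B _ => mul_comm _ _

theorem posSemidef_metricMat {x : M} (φ : Vec n ≃L[ℝ] TangentSpace (mdl n) x) :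
    (metricMat S φ).PosSemidef := by
  refine Matrix.PosSemidef.of_dotProduct_mulVec_nonneg ?_ fun v => ?_
  · ext A B
    exact S.metric_symm x (frameCovec φ B) (frameCovec φ A)
  · have h : v ⬝ᵥ (metricMat S φ).mulVec v =
        (∑ A, v A • frameCovec φ A) (S.metric x (∑ A, v A • frameCovec φ A)) := by
      rw [metricMat_mulVec, sum_apply]
      rfl
    rw [star_trivial, h]
    exact S.metric_nonneg x _

theorem sum_smul_frameCovec {x : M} (φ : Vec n ≃L[ℝ] TangentSpace (mdl n) x)
    (α : TangentSpace (mdl n) x →L[ℝ] ℝ) : ∑ A, α (frameVec φ A) • frameCovec φ A = α := by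
  refine ContinuousLinearMap.ext fun Y => ?_
  rw [sum_apply, ← sum_frameCovec_mul φ α Y]
  exact Finset.sum_congr rfl fun A _ => mul_comm _ _

/-- The frame isomorphism carries the range of `S.metric x` onto the range of the matrix, so the two
dimensions agree. -/
theorem rank_metricMat {x : M} (φ : Vec n ≃L[ℝ] TangentSpace (mdl n) x) :
    (metricMat S φ).rank = n := by
  have h : LinearMap.range (metricMat S φ).mulVecLin =
      (S.metric x).range.map (φ.symm.toLinearEquiv : TangentSpace (mdl n) x →ₗ[ℝ] Vec n) := by
    ext w
    constructor
    · rintro ⟨v, rfl⟩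
      exact ⟨_, ⟨_, rfl⟩, (metricMat_mulVec φ v).symm⟩
    · rintro ⟨_, ⟨α, rfl⟩, rfl⟩
      refine ⟨fun A => α (frameVec φ A), ?_⟩
      rw [Matrix.mulVecLin_apply, metricMat_mulVec, sum_smul_frameCovec]
      rfl
  have h1 : (metricMat S φ).rank =
      Module.finrank ℝ (LinearMap.range (metricMat S φ).mulVecLin) := rfl
  rw [h1, h, LinearEquiv.finrank_map_eq]
  exact S.metric_rank x

variable (S) in
-- In an arbitrary local frame the components of `h` form a smooth family of semidefinite matrices
-- of rank `n`, annihilated by the components of `τ`. The matrix `k` of `exists_normal_form` is the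
-- change to a Galilei frame.
theorem exists_isGalileiFrame (x₀ : M) :
    ∃ (s : ∀ x : M, Vec n ≃L[ℝ] TangentSpace (mdl n) x) (U : Set M),
      IsGalileiFrame S s U ∧ x₀ ∈ U := by
  obtain ⟨s, U, hs, hx₀⟩ := exists_isLocalFrame (n := n) x₀
  obtain ⟨V, k, l, hV, hxV, hVU, hk, h⟩ := exists_normal_form (J := mdl n)
    (H := fun x => metricMat S (s x)) (τ := fun x A => S.clock x (frameVec (s x) A)) hs.1
    hs.matSmoothOn_metricMat (fun A => hs.contMDiffOn_clock A)
    (fun x _ => posSemidef_metricMat (s x)) hx₀ (rank_metricMat (s x₀))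
    (fun h0 => S.clock_ne_zero x₀ (ContinuousLinearMap.ext fun Y => by
      rw [← sum_frameCovec_mul (s x₀) (S.clock x₀)]
      simp [fun A => congrFun h0 A]))
    (fun x _ v => by
      rw [metricMat_mulVec]
      refine Eq.trans ?_ (S.clock_metric x (∑ A, v A • frameCovec (s x) A))
      rw [← sum_frameCovec_mul (s x) (S.clock x)]
      exact Finset.sum_congr rfl fun A _ => mul_comm _ _)
  obtain ⟨s', hs', hs'k⟩ := hs.exists_mul hV hVU hk fun x hx => (h x hx).1
  refine ⟨s', V, ⟨hs', fun x hx => ?_⟩, hxV⟩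
  obtain ⟨h1, h2, h3⟩ := h x hx
  rw [isGalileiFrameAt_iff]
  refine ⟨fun B => ?_, ?_⟩
  · rw [clock_frameVec_eq_sum_transMat (s x), hs'k x hx]
    exact h2 B
  · have h4 : transMat (s' x) (s x) * k x = 1 := by
      rw [← hs'k x hx, transMat_mul, transMat_self]
    have h5 : (k x).transpose * (transMat (s' x) (s x)).transpose = 1 := by
      rw [← Matrix.transpose_mul, h4, Matrix.transpose_one]
    rw [metricMat_eq_mul (s' x) (s x), h3]
    calc transMat (s' x) (s x) * (k x * spaceDiag n * (k x).transpose) *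
          (transMat (s' x) (s x)).transpose
        = (transMat (s' x) (s x) * k x) * spaceDiag n *
          ((k x).transpose * (transMat (s' x) (s x)).transpose) := by simp only [mul_assoc]
      _ = spaceDiag n := by rw [h4, h5, one_mul, mul_one]

/-! ### Tangent vectors and connection forms on the Galilei frame bundle -/

theorem IsGalileiFrame.frameCoord_galilei (hs : IsGalileiFrame S s U) {e : FrameBundle n M}
    (he : e ∈ galileiBundle S) (hx : base e ∈ U) :
    (∀ B, frameCoord s e idxT B = (1 : Gl n) idxT B) ∧
      frameCoord s e * spaceDiag n * (frameCoord s e).transpose = spaceDiag n :=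
  transMat_galilei (hs.2 _ hx) he

/-- The coordinate of a curve in `G(M)` runs in the Galilei group, so its logarithmic derivative is
in the Galilei algebra. Velocities of such curves span the tangent space, and the condition is
linear. -/
theorem IsGalileiFrame.inv_mul_matDeriv_frameCoord_mem (hs : IsGalileiFrame S s U)
    {e : FrameBundle n M} (hx : base e ∈ U) {b : Gl n}
    (hb : b * frameCoord s e = 1) {ξ : TangentSpace (frameMdl n) e}
    (hξ : ξ ∈ subTangent (frameMdl n) (galileiBundle S) e) :
    b * matDeriv (frameMdl n) (frameCoord s) e ξ ∈ galAlg n := by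
  suffices h : subTangent (frameMdl n) (galileiBundle S) e ≤ (galAlg n).comap
      ((LinearMap.mulLeft ℝ b).comp (matDeriv (frameMdl n) (frameCoord s) e)) from h hξ
  refine Submodule.span_le.2 ?_
  rintro ξ ⟨γ, hγ, hγP, hγξ⟩
  have h0 : γ 0 = e := congrArg TotalSpace.proj hγξ
  have h1 : mfderiv 𝓘(ℝ, ℝ) (frameMdl n) γ 0 (1 : ℝ) = ξ := by
    subst h0
    exact eq_of_heq (TotalSpace.mk.inj hγξ).2
  change b * matDeriv (frameMdl n) (frameCoord s) e ξ ∈ galAlg n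
  have h2 := matDeriv_comp (J' := 𝓘(ℝ, ℝ)) h0 (hs.1.matDiffAt_frameCoord hx)
    (hγ.mdifferentiableAt (by simp)) (1 : ℝ)
  rw [h1] at h2
  rw [← h2]
  have hU : ∀ᶠ t in 𝓝 (0 : ℝ), base (γ t) ∈ U := by
    refine hγ.continuousAt.eventually_mem ((isOpen_base_preimage hs.1.1).mem_nhds ?_)
    rw [Set.mem_preimage, h0]
    exact hx
  refine inv_mul_matDeriv_mem_galAlg (matDiffAt_comp h0 (hs.1.matDiffAt_frameCoord hx)
    (hγ.mdifferentiableAt (by simp))) ?_ (by rw [h0]; exact hb) _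
  filter_upwards [hγP, hU] with t h3 h4
  exact hs.frameCoord_galilei h3 h4

end

section

variable {n : ℕ} {M : Type*} [TopologicalSpace M] [ChartedSpace (Model n) M]
  [IsManifold (mdl n) ∞ M]
variable {s s' : ∀ x : M, Vec n ≃L[ℝ] TangentSpace (mdl n) x} {U U' : Set M}
variable {S : GalileiStructure n M} {θ : GalForm S (Gl n)}

theorem galileiPullback_apply (hs : IsGalileiFrame S s U) {x : M} (hx : x ∈ U)
    (X : TangentSpace (mdl n) x) : galileiPullback θ hs x X =
      θ ⟨frameSection s x, frameSection_mem hs hx⟩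
        ⟨mfderiv (mdl n) (frameMdl n) (frameSection s) x X, mfderiv_frameSection_mem hs hx X⟩ := by
  rw [galileiPullback, dif_pos hx]
  rfl

theorem galileiPullback_restrictToGalilei (Θ : FrameForm n M) (hs : IsGalileiFrame S s U) {x : M}
    (hx : x ∈ U) : galileiPullback (restrictToGalilei S Θ) hs x = framePullback Θ s x := by
  refine LinearMap.ext fun X => ?_
  rw [galileiPullback_apply hs hx]
  rfl

/-- Two Galilei frames at a point differ by a Galilei matrix, so each fibre of `G(M)` is one orbit
of the Galilei group. -/
theorem IsGalileiFrame.exists_eq_galRightMul (hs : IsGalileiFrame S s U) (e : galileiBundle S)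
    (hx : base e.1 ∈ U) : ∃ (x : M) (hx : x ∈ U) (g : galGroup n),
      e = galRightMul S g ⟨frameSection s x, frameSection_mem hs hx⟩ :=
  ⟨base e.1, hx, ⟨_, transGL_mem_galGroup (hs.2 _ hx) e.2⟩,
    Subtype.ext (Galilei.exists_eq_rightMul s e.1)⟩

theorem galRep_inv_apply (g : galGroup n) (Z : Gl n) :
    galRep n g⁻¹ Z = ((g.1⁻¹ : GL (Idx n) ℝ) : Gl n) * Z * (g.1 : Gl n) := by
  change ((g.1⁻¹ : GL (Idx n) ℝ) : Gl n) * Z * ((g.1⁻¹⁻¹ : GL (Idx n) ℝ) : Gl n) = _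
  rw [inv_inv]

/-- Every tangent vector of `G(M)` is the sum of a translate of a vector tangent to a given local
section and of a vertical vector. -/
theorem galilei_tangent_decomposition (hs : IsGalileiFrame S s U) {x : M} (hx : x ∈ U)
    (g : galGroup n)
    (ξ : subTangent (frameMdl n) (galileiBundle S)
      (galRightMul S g ⟨frameSection s x, frameSection_mem hs hx⟩).1)
    (X : TangentSpace (mdl n) x)
    (hX : mfderiv (frameMdl n) (mdl n) (base : FrameBundle n M → M)
      (rightMul g.1 (frameSection s x)) ξ.1 = X) :
    ∃ Y : galAlg n, Y.1 = ((g.1⁻¹ : GL (Idx n) ℝ) : Gl n) *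
        matDeriv (frameMdl n) (frameCoord s) (rightMul g.1 (frameSection s x)) ξ.1 ∧
      ξ = galRightMulDeriv S g ⟨frameSection s x, frameSection_mem hs hx⟩
        ⟨mfderiv (mdl n) (frameMdl n) (frameSection s) x X, mfderiv_frameSection_mem hs hx X⟩ +
        galFundamentalVec S Y (galRightMul S g ⟨frameSection s x, frameSection_mem hs hx⟩) := by
  have hG : frameCoord s (rightMul g.1 (frameSection s x)) = g.1 := by
    rw [frameCoord_rightMul, frameCoord_frameSection, transMat_self, one_mul]
  have hY : ((g.1⁻¹ : GL (Idx n) ℝ) : Gl n) *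
      matDeriv (frameMdl n) (frameCoord s) (rightMul g.1 (frameSection s x)) ξ.1 ∈ galAlg n :=
    hs.inv_mul_matDeriv_frameCoord_mem (e := rightMul g.1 (frameSection s x)) hx
      (by rw [hG]; simp) ξ.2
  exact ⟨⟨_, hY⟩, rfl, Subtype.ext (tangent_decomposition hs.1 hx g.1 ξ.1 X hX)⟩

theorem IsGalileiConnectionForm.apply_galRightMulDeriv (hθ : IsGalileiConnectionForm θ)
    (g : galGroup n) (e : galileiBundle S)
    (ξ : subTangent (frameMdl n) (galileiBundle S) e.1) :
    θ (galRightMul S g e) (galRightMulDeriv S g e ξ) =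
      ((g.1⁻¹ : GL (Idx n) ℝ) : Gl n) * θ e ξ * (g.1 : Gl n) :=
  (hθ.equivariant g e ξ).trans (galRep_inv_apply g _)

theorem IsGalileiConnectionForm.apply_of_eq_add (hθ : IsGalileiConnectionForm θ)
    {g : galGroup n} {e : galileiBundle S} {Y : galAlg n}
    {ξ₀ : subTangent (frameMdl n) (galileiBundle S) e.1}
    {ξ : subTangent (frameMdl n) (galileiBundle S) (galRightMul S g e).1}
    (h : ξ = galRightMulDeriv S g e ξ₀ + galFundamentalVec S Y (galRightMul S g e)) :
    θ (galRightMul S g e) ξ =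
      ((g.1⁻¹ : GL (Idx n) ℝ) : Gl n) * θ e ξ₀ * (g.1 : Gl n) + Y.1 :=
  (congrArg (θ (galRightMul S g e)) h).trans ((LinearMap.map_add _ _ _).trans
    (congrArg₂ (· + ·) (hθ.apply_galRightMulDeriv g e ξ₀) (hθ.fundamental Y _)))

theorem IsGalileiConnectionForm.apply_rightMul (hθ : IsGalileiConnectionForm θ)
    (hs : IsGalileiFrame S s U) {x : M} (hx : x ∈ U) (g : galGroup n)
    (ξ : subTangent (frameMdl n) (galileiBundle S)
      (galRightMul S g ⟨frameSection s x, frameSection_mem hs hx⟩).1)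
    (X : TangentSpace (mdl n) x)
    (hX : mfderiv (frameMdl n) (mdl n) (base : FrameBundle n M → M)
      (rightMul g.1 (frameSection s x)) ξ.1 = X) :
    θ (galRightMul S g ⟨frameSection s x, frameSection_mem hs hx⟩) ξ =
      ((g.1⁻¹ : GL (Idx n) ℝ) : Gl n) * galileiPullback θ hs x X * (g.1 : Gl n) +
      ((g.1⁻¹ : GL (Idx n) ℝ) : Gl n) *
        matDeriv (frameMdl n) (frameCoord s) (rightMul g.1 (frameSection s x)) ξ.1 := by
  obtain ⟨Y, hY, hdec⟩ := galilei_tangent_decomposition hs hx g ξ X hX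
  have h0 : ∀ a b P P' c c' : Gl n, P' = P → c' = c → a * P * b + c' = a * P' * b + c := by
    rintro a b P P' c c' rfl rfl
    rfl
  exact (hθ.apply_of_eq_add hdec).trans
    (h0 _ _ _ _ _ _ (galileiPullback_apply (θ := θ) hs hx X) hY)

/-- Decomposing a tangent vector of `G(M)` involves only translations by the Galilei group and
fundamental vectors of the Galilei algebra. The conditions on `θ` thus force the same formula as on
`F(M)`, although its values may lie anywhere in `𝔤𝔩(n+1)`. -/
theorem IsGalileiConnectionForm.eq_localForm (hθ : IsGalileiConnectionForm θ)
    (hs : IsGalileiFrame S s U) (e : galileiBundle S) (he : base e.1 ∈ U)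
    (ξ : subTangent (frameMdl n) (galileiBundle S) e.1) :
    θ e ξ = localForm s (galileiPullback θ hs) e.1 ξ.1 := by
  obtain ⟨x, hx, g, rfl⟩ := hs.exists_eq_galRightMul e he
  have hG : frameCoord s (rightMul g.1 (frameSection s x)) = g.1 := by
    rw [frameCoord_rightMul, frameCoord_frameSection, transMat_self, one_mul]
  refine (hθ.apply_rightMul hs hx g ξ _ rfl).trans
    (Eq.trans ?_ (localForm_apply (galileiPullback θ hs) _ ξ.1).symm)
  have h1 : ∀ a b c d f : Gl n, a = d → b = f → ∀ X, d * X * f + d * c = a * (X * b + c) := by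
    rintro a b c d f rfl rfl X
    rw [mul_add, mul_assoc]
  exact h1 _ _ _ _ _ (transMat_frameIso_eq_inv _ g.1 hG) hG _

theorem IsGalileiConnectionForm.transformsAt (hθ : IsGalileiConnectionForm θ)
    (hs : IsGalileiFrame S s U) (hs' : IsGalileiFrame S s' U') {x : M} (hx : x ∈ U)
    (hx' : x ∈ U') :
    TransformsAt s s' x (galileiPullback θ hs x) (galileiPullback θ hs' x) := by
  intro X
  have h1 : galileiPullback θ hs' x X = localForm s (galileiPullback θ hs) (frameSection s' x)
      (mfderiv (mdl n) (frameMdl n) (frameSection s') x X) := by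
    rw [galileiPullback_apply hs' hx']
    exact hθ.eq_localForm hs ⟨frameSection s' x, frameSection_mem hs' hx'⟩ hx _
  rw [h1, localForm_apply, frameCoord_frameSection,
    matDeriv_frameCoord_frameSection hs.1 hs'.1 hx hx', mfderiv_base_frameSection hs'.1 hx',
    frameIso_frameSection]
  exact transMat_mul_cancel _ _ _

/-- Near a point of the section a scalar component of `θ` is the restriction of a smooth form on an
open part of `F(M)`, and pulling back that form gives the same result. -/
theorem isSmoothFormOn_galileiPullback (hθ : IsSmoothSubForm (frameMdl n) θ)
    (hs : IsGalileiFrame S s U) : IsSmoothFormOn (mdl n) (galileiPullback θ hs) U := by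
  intro l q hq
  obtain ⟨O, η, hO, hpO, hη, hηθ⟩ := hθ l ⟨frameSection s q.proj, frameSection_mem hs hq⟩
  have hV : IsOpen (U ∩ frameSection s ⁻¹' O) :=
    hs.1.2.continuousOn.isOpen_inter_preimage hs.1.1 hO
  have h1 : ContMDiffOn (mdl n).tangent 𝓘(ℝ, ℝ) ∞
      (fun q : TangentBundle (mdl n) M => η (frameSection s q.proj)
        (mfderiv (mdl n) (frameMdl n) (frameSection s) q.proj q.2))
      (TotalSpace.proj ⁻¹' (U ∩ frameSection s ⁻¹' O)) :=
    ContMDiffOn.comp (hη LinearMap.id)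
      (contMDiffOn_tangentMap hV (hs.1.2.mono Set.inter_subset_left)) fun q hq => hq.2
  have hW : IsOpen (TotalSpace.proj ⁻¹' (U ∩ frameSection s ⁻¹' O) :
      Set (TangentBundle (mdl n) M)) := hV.preimage (FiberBundle.continuous_proj _ _)
  refine ContMDiffAt.contMDiffWithinAt
    ((h1.contMDiffAt (hW.mem_nhds ⟨hq, hpO⟩)).congr_of_eventuallyEq ?_)
  filter_upwards [hW.mem_nhds ⟨hq, hpO⟩] with q' hq'
  rw [galileiPullback_apply hs hq'.1]
  exact hηθ ⟨_, frameSection_mem hs hq'.1⟩ hq'.2 _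

theorem IsPrincipalConnectionForm.restrictToGalilei {Θ : FrameForm n M}
    (hΘ : IsPrincipalConnectionForm Θ) :
    IsGalileiConnectionForm (restrictToGalilei S Θ) where
  smooth l _ := ⟨Set.univ, fun q => l.comp (Θ q), isOpen_univ, trivial,
    fun l' => hΘ.smooth (l'.comp l), fun _ _ _ => rfl⟩
  equivariant g e ξ := hΘ.equivariant g.1 e.1 ξ.1
  fundamental X e := hΘ.fundamental X.1 e.1

/-- The pullback along a Galilei frame determines a principal form on whole fibres of `F(M)`, and
such frames exist near every point; hence injectivity. Conversely, the pullbacks of a form on `G(M)`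
obey the transformation law and glue to a form on `F(M)`, and on `G(M)` both are the same
`localForm`. -/
theorem bijOn_restrictToGalilei :
    Set.BijOn (restrictToGalilei S) {Θ | IsPrincipalConnectionForm Θ}
      {θ | IsGalileiConnectionForm θ} := by
  refine ⟨fun Θ hΘ => IsPrincipalConnectionForm.restrictToGalilei hΘ, ?_, ?_⟩
  · intro Θ hΘ Θ' hΘ' h
    funext e
    obtain ⟨s, U, hs, hx⟩ := exists_isGalileiFrame S (base e)
    rw [IsPrincipalConnectionForm.eq_localForm hΘ hs.1 hx,
      IsPrincipalConnectionForm.eq_localForm hΘ' hs.1 hx]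
    refine localForm_congr ?_
    rw [← galileiPullback_restrictToGalilei Θ hs hx, h, galileiPullback_restrictToGalilei Θ' hs hx]
  · intro θ hθ
    classical
    have hθ : IsGalileiConnectionForm θ := hθ
    obtain ⟨Θ, hΘ, hΘ'⟩ := exists_isPrincipalConnectionForm (P := IsGalileiFrame S)
      (fun _ _ h => h.1) (exists_isGalileiFrame S)
      (fun s U => if hs : IsGalileiFrame S s U then galileiPullback θ hs else 0)
      (fun s U hs => by
        rw [dif_pos hs]
        exact isSmoothFormOn_galileiPullback hθ.smooth hs)
      (fun s U s' U' hs hs' x hx hx' => by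
        rw [dif_pos hs, dif_pos hs']
        exact hθ.transformsAt hs hs' hx hx')
    refine ⟨Θ, hΘ, ?_⟩
    funext e
    refine LinearMap.ext fun ξ => ?_
    obtain ⟨s, U, hs, hx⟩ := exists_isGalileiFrame S (base e.1)
    rw [hθ.eq_localForm hs e hx]
    have h1 := hΘ' s U hs e.1 hx
    rw [dif_pos hs] at h1
    exact LinearMap.congr_fun h1 ξ.1

/-! ### The projection to the quotient by the Galilei algebra -/

theorem galQuotRep_mkQ (g : galGroup n) (Y : Gl n) :
    galQuotRep n g ((galAlg n).mkQ Y) = (galAlg n).mkQ (galRep n g Y) := rfl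

/-- For a vertical vector the pullback term drops out. What remains is the logarithmic derivative of
the coordinate, an element of the Galilei algebra. -/
theorem IsGalileiConnectionForm.mem_galAlg_of_vertical (hθ : IsGalileiConnectionForm θ)
    (e : galileiBundle S) (ξ : subTangent (frameMdl n) (galileiBundle S) e.1)
    (h : mfderiv (frameMdl n) (mdl n) (base : FrameBundle n M → M) e.1 ξ.1 = 0) :
    θ e ξ ∈ galAlg n := by
  obtain ⟨s, U, hs, he⟩ := exists_isGalileiFrame S (base e.1)
  obtain ⟨x, hx, g, rfl⟩ := hs.exists_eq_galRightMul e he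
  obtain ⟨Y, hY, -⟩ := galilei_tangent_decomposition hs hx g ξ 0 h
  have h0 : ∀ (a b c P : Gl n), P = 0 → a * P * b + c = c := by
    rintro a b c P rfl
    simp
  have h1 := (hθ.apply_rightMul hs hx g ξ 0 h).trans
    ((h0 _ _ _ _ (LinearMap.map_zero (galileiPullback θ hs x))).trans hY.symm)
  rw [h1]
  exact Y.2

theorem IsGalileiConnectionForm.isGalEquivariant_mkQ (hθ : IsGalileiConnectionForm θ) :
    IsGalEquivariant (galQuotRep n) (fun e => (galAlg n).mkQ.comp (θ e)) := by
  intro g e ξ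
  exact (congrArg (galAlg n).mkQ (hθ.equivariant g e ξ)).trans (galQuotRep_mkQ _ _).symm

theorem IsGalileiConnectionForm.isTensorial (hθ : IsGalileiConnectionForm θ) :
    IsTensorial (galQuotRep n) (fun e => (galAlg n).mkQ.comp (θ e)) where
  smooth l p := hθ.smooth (l.comp (galAlg n).mkQ) p
  equivariant := hθ.isGalEquivariant_mkQ
  horizontal e ξ h := (Submodule.Quotient.mk_eq_zero _).2 (hθ.mem_galAlg_of_vertical e ξ h)

end

/-! ### Covariant derivatives of one-forms and of the space metric in components -/

section

variable {n : ℕ} {M : Type*} [TopologicalSpace M] [ChartedSpace (Model n) M]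
  [IsManifold (mdl n) ∞ M]
variable {s s' : ∀ x : M, Vec n ≃L[ℝ] TangentSpace (mdl n) x} {U U' : Set M}
variable {S : GalileiStructure n M} {cov : Connection n M}

/-- Differentiability at `x` of a one-form. -/
abbrev CovecDiffAt (α : ∀ x : M, TangentSpace (mdl n) x →L[ℝ] ℝ) (x : M) : Prop :=
  MDifferentiableAt (mdl n) ((mdl n).prod 𝓘(ℝ, Model n →L[ℝ] ℝ))
    (fun y => TotalSpace.mk' (Model n →L[ℝ] ℝ)
      (E := fun x : M => TangentSpace (mdl n) x →L[ℝ] ℝ) y (α y)) x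

theorem covecDiffAt_extendCovec {x : M} (α : TangentSpace (mdl n) x →L[ℝ] ℝ) :
    CovecDiffAt (extendCovec α) x :=
  FiberBundle.mdifferentiableAt_extend (mdl n) (Model n →L[ℝ] ℝ)
    (V := fun x : M => TangentSpace (mdl n) x →L[ℝ] Bundle.Trivial M ℝ x) α

theorem extendCovec_self {x : M} (α : TangentSpace (mdl n) x →L[ℝ] ℝ) :
    extendCovec α x = α :=
  FiberBundle.extend_apply_self (Model n →L[ℝ] ℝ)
    (E := fun x : M => TangentSpace (mdl n) x →L[ℝ] Bundle.Trivial M ℝ x) α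

theorem fieldDiffAt_extend {x : M} (Y : TangentSpace (mdl n) x) :
    FieldDiffAt (FiberBundle.extend (Model n) Y) x :=
  FiberBundle.mdifferentiableAt_extend (mdl n) (Model n)
    (V := (TangentSpace (mdl n) : M → Type _)) Y

theorem IsLocalFrame.covecDiffAt_frameCovec (hs : IsLocalFrame s U) {x : M} (hx : x ∈ U)
    (A : Idx n) : CovecDiffAt (fun y => frameCovec (s y) A) x :=
  ((hs.contMDiffOn_frameCovec_section A).contMDiffAt (hs.1.mem_nhds hx)).mdifferentiableAt (by simp)

theorem CovecDiffAt.apply {α : ∀ x : M, TangentSpace (mdl n) x →L[ℝ] ℝ} {x : M}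
    (hα : CovecDiffAt α x) {Y : ∀ x : M, TangentSpace (mdl n) x} (hY : FieldDiffAt Y x) :
    MDifferentiableAt (mdl n) 𝓘(ℝ, ℝ) (fun y => α y (Y y)) x := by
  have h := MDifferentiableAt.clm_bundle_apply (E₁ := (TangentSpace (mdl n) : M → Type _))
    (E₂ := Bundle.Trivial M ℝ) (b := fun x : M => x) (ϕ := α) (v := Y) hα hY
  exact ((mdifferentiableAt_totalSpace (mdl n) _).1 h).2

theorem CovecDiffAt.metric {α : ∀ x : M, TangentSpace (mdl n) x →L[ℝ] ℝ} {x : M}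
    (hα : CovecDiffAt α x) : FieldDiffAt (fun y => S.metric y (α y)) x :=
  MDifferentiableAt.clm_bundle_apply
    (E₁ := fun x : M => TangentSpace (mdl n) x →L[ℝ] Bundle.Trivial M ℝ x)
    (E₂ := (TangentSpace (mdl n) : M → Type _)) (b := fun x : M => x)
    (ϕ := fun x => S.metric x) (v := α) (S.contMDiff_metric.mdifferentiableAt (by simp)) hα

variable (S) in
theorem covecDiffAt_clock (x : M) : CovecDiffAt S.clock x :=
  S.contMDiff_clock.mdifferentiableAt (by simp)

theorem frameCovec_cov (hs : IsLocalFrame s U) {x : M} (hx : x ∈ U)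
    {Y : ∀ x : M, TangentSpace (mdl n) x} (hY : FieldDiffAt Y x) (X : TangentSpace (mdl n) x)
    (A : Idx n) : frameCovec (s x) A (cov Y x X) =
      mvfderiv (mdl n) (fun y => frameCovec (s y) A (Y y)) x X +
        ∑ B, frameCovec (s x) B (Y x) * covForm cov s x X A B := by
  have h := IsCovariantDerivativeOn.eq_localCov cov.isCovariantDerivativeOnUniv (Set.mem_univ x)
    hs hx hY
  refine (congrArg (fun L : TangentSpace (mdl n) x →L[ℝ] TangentSpace (mdl n) x =>
    frameCovec (s x) A (L X)) h).trans ?_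
  exact frameCovec_localCov _ _ _ _ _

/-- The covariant derivative of a one-form in terms of components. -/
theorem mvfderiv_sub_apply_cov (hs : IsLocalFrame s U) {x : M} (hx : x ∈ U)
    {α : ∀ x : M, TangentSpace (mdl n) x →L[ℝ] ℝ} (hα : CovecDiffAt α x)
    {Y : ∀ x : M, TangentSpace (mdl n) x} (hY : FieldDiffAt Y x) (X : TangentSpace (mdl n) x) :
    mvfderiv (mdl n) (fun y => α y (Y y)) x X - α x (cov Y x X) =
      ∑ B, frameCovec (s x) B (Y x) * (mvfderiv (mdl n) (fun y => α y (frameVec (s y) B)) x X -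
        ∑ A, covForm cov s x X A B * α x (frameVec (s x) A)) := by
  have h1 : (fun y => α y (Y y)) =
      fun y => ∑ B, frameCovec (s y) B (Y y) * α y (frameVec (s y) B) :=
    funext fun y => (sum_frameCovec_mul (s y) (α y) (Y y)).symm
  have hYd := hs.mdifferentiableAt_frameCovec hx hY
  have hαd : ∀ B, MDifferentiableAt (mdl n) 𝓘(ℝ, ℝ) (fun y => α y (frameVec (s y) B)) x :=
    fun B => hα.apply (hs.mdifferentiableAt_frameVec hx B)
  have h2 : mvfderiv (mdl n) (fun y => α y (Y y)) x X =
      ∑ B, (frameCovec (s x) B (Y x) * mvfderiv (mdl n) (fun y => α y (frameVec (s y) B)) x X +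
        α x (frameVec (s x) B) * mvfderiv (mdl n) (fun y => frameCovec (s y) B (Y y)) x X) := by
    rw [h1, (mvfderiv_sum (f := fun B y => frameCovec (s y) B (Y y) * α y (frameVec (s y) B))
      fun B _ => (hYd B).mul (hαd B)).2, sum_apply]
    refine Finset.sum_congr rfl fun B _ => ?_
    rw [mvfderiv_fun_mul (hYd B) (hαd B)]
    simp only [add_apply, smul_apply, smul_eq_mul]
  rw [h2, ← sum_frameCovec_mul (s x) (α x) (cov Y x X)]
  simp only [frameCovec_cov hs hx hY, add_mul, mul_sub, Finset.sum_add_distrib,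
    Finset.sum_sub_distrib, Finset.sum_mul, Finset.mul_sum]
  rw [Finset.sum_comm (f := fun A B => frameCovec (s x) B (Y x) * covForm cov s x X A B *
    α x (frameVec (s x) A))]
  simp only [mul_assoc, mul_comm (α x _)]
  ring

theorem covDerivForm_eq (hs : IsLocalFrame s U) {x : M} (hx : x ∈ U)
    {α : ∀ x : M, TangentSpace (mdl n) x →L[ℝ] ℝ} (hα : CovecDiffAt α x)
    (X Y : TangentSpace (mdl n) x) : covDerivForm cov α x X Y =
      ∑ B, frameCovec (s x) B Y * (mvfderiv (mdl n) (fun y => α y (frameVec (s y) B)) x X -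
        ∑ A, covForm cov s x X A B * α x (frameVec (s x) A)) := by
  refine (mvfderiv_sub_apply_cov hs hx hα (fieldDiffAt_extend Y) X).trans ?_
  rw [FiberBundle.extend_apply_self]

theorem covDerivForm_frameVec (hs : IsLocalFrame s U) {x : M} (hx : x ∈ U)
    {α : ∀ x : M, TangentSpace (mdl n) x →L[ℝ] ℝ} (hα : CovecDiffAt α x)
    (X : TangentSpace (mdl n) x) (B : Idx n) : covDerivForm cov α x X (frameVec (s x) B) =
      mvfderiv (mdl n) (fun y => α y (frameVec (s y) B)) x X -
        ∑ A, covForm cov s x X A B * α x (frameVec (s x) A) := by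
  rw [covDerivForm_eq hs hx hα]
  simp [frameCovec_frameVec, Matrix.one_apply]

/-- The value of `∇α` does not depend on the extension of the vector. -/
theorem mvfderiv_sub_apply_cov_eq_covDerivForm {x : M}
    {α : ∀ x : M, TangentSpace (mdl n) x →L[ℝ] ℝ} (hα : CovecDiffAt α x)
    {Y : ∀ x : M, TangentSpace (mdl n) x} (hY : FieldDiffAt Y x) (X : TangentSpace (mdl n) x) :
    mvfderiv (mdl n) (fun y => α y (Y y)) x X - α x (cov Y x X) = covDerivForm cov α x X (Y x) := by
  obtain ⟨s, U, hs, hx⟩ := exists_isLocalFrame (n := n) x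
  rw [mvfderiv_sub_apply_cov hs hx hα hY, covDerivForm_eq hs hx hα]

/-- The definition uses arbitrary extensions of the two covectors. The rule `X(α(Y)) - α(∇_X Y) =
(∇_X α)(Y)` is applied to the extension of `e^A` with `Y` the metric image of the extension of
`e^B`, and to the extension of `e^B` with `Y` the metric image of `e^A` itself. By symmetry of `h`
the derivatives that contain an extension cancel, and only frame components remain. -/
theorem nonMetricityMetric_frameCovec (hs : IsLocalFrame s U) {x : M} (hx : x ∈ U)
    (X : TangentSpace (mdl n) x) (A B : Idx n) :
    nonMetricityMetric S cov x X (frameCovec (s x) A) (frameCovec (s x) B) =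
      mvfderiv (mdl n) (fun y => frameCovec (s y) A (S.metric y (frameCovec (s y) B))) x X +
        ∑ C, covForm cov s x X A C * frameCovec (s x) C (S.metric x (frameCovec (s x) B)) +
        ∑ C, covForm cov s x X B C * frameCovec (s x) A (S.metric x (frameCovec (s x) C)) := by
  set α := frameCovec (s x) A with hα
  set β := frameCovec (s x) B with hβ
  have h1 := mvfderiv_sub_apply_cov_eq_covDerivForm (cov := cov) (covecDiffAt_extendCovec α)
    (CovecDiffAt.metric (S := S) (covecDiffAt_extendCovec β)) X
  have h2 := mvfderiv_sub_apply_cov_eq_covDerivForm (cov := cov) (covecDiffAt_extendCovec β)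
    (CovecDiffAt.metric (S := S) (hs.covecDiffAt_frameCovec hx A)) X
  have h3 := frameCovec_cov (cov := cov) hs hx
    (CovecDiffAt.metric (S := S) (covecDiffAt_extendCovec β)) X A
  have h4 := frameCovec_cov (cov := cov) hs hx
    (CovecDiffAt.metric (S := S) (hs.covecDiffAt_frameCovec hx A)) X B
  simp only [extendCovec_self] at h1 h2 h3 h4
  have h5 : (fun y => extendCovec β y (S.metric y (frameCovec (s y) A))) =
      fun y => frameCovec (s y) A (S.metric y (extendCovec β y)) :=
    funext fun y => S.metric_symm y _ _
  have h6 : (fun y => frameCovec (s y) B (S.metric y (frameCovec (s y) A))) =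
      fun y => frameCovec (s y) A (S.metric y (frameCovec (s y) B)) :=
    funext fun y => S.metric_symm y _ _
  rw [h5] at h2
  rw [h6] at h4
  have h7 : ∑ C, covForm cov s x X A C * frameCovec (s x) C (S.metric x β) =
      ∑ C, frameCovec (s x) C (S.metric x β) * covForm cov s x X A C :=
    Finset.sum_congr rfl fun C _ => mul_comm _ _
  have h8 : ∑ C, covForm cov s x X B C * α (S.metric x (frameCovec (s x) C)) =
      ∑ C, frameCovec (s x) C (S.metric x α) * covForm cov s x X B C :=
    Finset.sum_congr rfl fun C _ => by rw [S.metric_symm x α, mul_comm]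
  rw [nonMetricityMetric, h7, h8]
  linarith

end

/-! ### Non-metricities and Newton–Coriolis form in a Galilei frame -/

section

variable {n : ℕ} {M : Type*} [TopologicalSpace M] [ChartedSpace (Model n) M]
  [IsManifold (mdl n) ∞ M]
variable {s s' : ∀ x : M, Vec n ≃L[ℝ] TangentSpace (mdl n) x} {U U' : Set M}
variable {S : GalileiStructure n M} {cov : Connection n M}

theorem IsGalileiFrame.clock_frameVec (hs : IsGalileiFrame S s U) {x : M} (hx : x ∈ U)
    (B : Idx n) : S.clock x (frameVec (s x) B) = (1 : Gl n) idxT B :=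
  (isGalileiFrameAt_iff.1 (hs.2 x hx)).1 B

theorem IsGalileiFrame.frameCovec_metric (hs : IsGalileiFrame S s U) {x : M} (hx : x ∈ U)
    (A B : Idx n) : frameCovec (s x) A (S.metric x (frameCovec (s x) B)) = spaceDiag n A B :=
  congrFun (congrFun (isGalileiFrameAt_iff.1 (hs.2 x hx)).2 A) B

theorem mvfderiv_eq_zero_of_eventuallyEq_const {f : M → ℝ} {x : M} {c : ℝ}
    (h : f =ᶠ[𝓝 x] fun _ => c) (X : TangentSpace (mdl n) x) : mvfderiv (mdl n) f x X = 0 := by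
  rw [mvfderiv, h.mfderiv_eq, mfderiv_const]
  rfl

theorem nonMetricityClock_frameVec (hs : IsLocalFrame s U) {x : M} (hx : x ∈ U)
    (X : TangentSpace (mdl n) x) (A : Idx n) :
    nonMetricityClock S cov x X (frameVec (s x) A) =
      mvfderiv (mdl n) (fun y => S.clock y (frameVec (s y) A)) x X -
        ∑ B, covForm cov s x X B A * S.clock x (frameVec (s x) B) :=
  covDerivForm_frameVec hs hx (covecDiffAt_clock S x) X A

/-- The components of `τ` are constant, so only the connection term survives. -/
theorem IsGalileiFrame.nonMetricityClock_frameVec (hs : IsGalileiFrame S s U) {x : M} (hx : x ∈ U)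
    (X : TangentSpace (mdl n) x) (A : Idx n) :
    nonMetricityClock S cov x X (frameVec (s x) A) = -covForm cov s x X idxT A := by
  rw [Galilei.nonMetricityClock_frameVec hs.1 hx, mvfderiv_eq_zero_of_eventuallyEq_const
    (c := (1 : Gl n) idxT A)
    (Filter.eventually_of_mem (hs.1.1.mem_nhds hx) fun y hy => hs.clock_frameVec hy A)]
  simp only [hs.clock_frameVec hx]
  simp [Matrix.one_apply]

/-- The components of `h` are constant too, and symmetry of `spaceDiag n` makes the two connection
terms a matrix and its transpose. -/
theorem IsGalileiFrame.nonMetricityMetric_frameCovec (hs : IsGalileiFrame S s U) {x : M}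
    (hx : x ∈ U) (X : TangentSpace (mdl n) x) (A B : Idx n) :
    nonMetricityMetric S cov x X (frameCovec (s x) A) (frameCovec (s x) B) =
      (covForm cov s x X * spaceDiag n) A B + (covForm cov s x X * spaceDiag n) B A := by
  rw [Galilei.nonMetricityMetric_frameCovec hs.1 hx, mvfderiv_eq_zero_of_eventuallyEq_const
    (c := spaceDiag n A B)
    (Filter.eventually_of_mem (hs.1.1.mem_nhds hx) fun y hy => hs.frameCovec_metric hy A B)]
  simp only [hs.frameCovec_metric hx, Matrix.mul_apply, zero_add]
  congr 1
  refine Finset.sum_congr rfl fun C _ => ?_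
  rcases A with (⟨⟩ | a) <;> rcases C with (⟨⟩ | c) <;> simp [spaceDiag, Matrix.one_apply, eq_comm]

theorem mul_spaceDiag_apply (Y : Gl n) (A B : Idx n) :
    (Y * spaceDiag n) A B = ∑ c : Fin n, Y A (idxS c) * if B = idxS c then 1 else 0 := by
  rw [Matrix.mul_apply, Fintype.sum_sum_type]
  rcases B with (⟨⟩ | b) <;> simp [spaceDiag, Matrix.one_apply]

theorem mul_spaceDiag_idxT (Y : Gl n) (A : Idx n) : (Y * spaceDiag n) A idxT = 0 := by
  simp [mul_spaceDiag_apply]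

theorem mul_spaceDiag_idxS (Y : Gl n) (A : Idx n) (b : Fin n) :
    (Y * spaceDiag n) A (idxS b) = Y A (idxS b) := by
  simp [mul_spaceDiag_apply]

/-- Only the characterization is available: the form annihilates the timelike frame vector and pairs
`Y` with `e_a = h e^a` to `e^a(Y)`. Expanding the second argument in the frame fixes all values. -/
theorem covariantSpaceMetric_frame {x : M} {φ : Vec n ≃L[ℝ] TangentSpace (mdl n) x}
    (h : IsGalileiFrameAt S x φ) (Y Z : TangentSpace (mdl n) x) :
    covariantSpaceMetric S x (frameVec φ idxT) Y Z =
      ∑ a : Fin n, frameCovec φ (idxS a) Y * frameCovec φ (idxS a) Z := by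
  obtain ⟨-, h2, h3⟩ := covariantSpaceMetric_spec S x (frameVec φ idxT) h.1
  have h4 : ∀ a : Fin n, S.metric x (frameCovec φ (idxS a)) = frameVec φ (idxS a) := by
    intro a
    rw [h.2]
    simp [frameCovec_frameVec, Matrix.one_apply]
  have h5 : ∀ a : Fin n, covariantSpaceMetric S x (frameVec φ idxT) Y (frameVec φ (idxS a)) =
      frameCovec φ (idxS a) Y := by
    intro a
    rw [← h4, h3, map_sub, map_smul, frameCovec_frameVec]
    simp
  conv_lhs => rw [← sum_frameCovec_smul φ Z]
  rw [map_sum, Fintype.sum_sum_type]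
  simp only [map_smul, smul_eq_mul, h5]
  simp [h2, mul_comm]

theorem IsGalileiFrame.newtonCoriolis_eq (hs : IsGalileiFrame S s U) {x : M} (hx : x ∈ U)
    (X Y : TangentSpace (mdl n) x) :
    newtonCoriolis S cov (fun y => frameVec (s y) idxT) x X Y =
      ∑ a : Fin n, (covForm cov s x X (idxS a) idxT * frameCovec (s x) (idxS a) Y
        - covForm cov s x Y (idxS a) idxT * frameCovec (s x) (idxS a) X) := by
  rw [newtonCoriolis, covariantSpaceMetric_frame (hs.2 x hx),
    covariantSpaceMetric_frame (hs.2 x hx), ← Finset.sum_sub_distrib]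
  rfl

/-! ### The encoding of the non-metricities -/

/-- The map that encodes the non-metricities. -/
def nonMetricityMap (n : ℕ) : Gl n →ₗ[ℝ] Vec n × Gl n where
  toFun Y := (fun A => -Y idxT A, Y * spaceDiag n + (Y * spaceDiag n).transpose)
  map_add' Y Z := by
    refine Prod.ext (funext fun A => ?_) ?_
    · simp [add_comm]
    · simp only [add_mul, Matrix.transpose_add, Prod.mk_add_mk]
      abel
  map_smul' c Y := by
    refine Prod.ext (funext fun A => ?_) ?_
    · simp
    · simp [Matrix.transpose_smul]

theorem transpose_spaceDiag : (spaceDiag n).transpose = spaceDiag n := by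
  simp [spaceDiag, Matrix.fromBlocks_transpose]

/-- Both components vanish exactly when the first row is zero and the spatial block is
antisymmetric. One inclusion lets the map descend to the quotient, the other makes it injective
there. -/
theorem ker_nonMetricityMap : LinearMap.ker (nonMetricityMap n) = galAlg n := by
  ext Y
  rw [LinearMap.mem_ker]
  refine Iff.trans ?_ (exists_galAlgMatrix_iff Y).symm
  have h : nonMetricityMap n Y =
    (fun A => -Y idxT A, Y * spaceDiag n + (Y * spaceDiag n).transpose) := rfl
  rw [h, Prod.mk_eq_zero, Matrix.transpose_mul, transpose_spaceDiag]
  refine and_congr_left fun _ => ⟨fun h B => ?_, fun h => funext fun B => ?_⟩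
  · exact neg_eq_zero.1 (congrFun h B)
  · exact neg_eq_zero.2 (h B)

/-- The induced injective map on `𝔤𝔩(n+1) / 𝔤𝔞𝔩`. -/
def nonMetricityQuot (n : ℕ) : (Gl n ⧸ galAlg n) →ₗ[ℝ] Vec n × Gl n :=
  (galAlg n).liftQ (nonMetricityMap n) ker_nonMetricityMap.ge

theorem injective_nonMetricityQuot : Function.Injective (nonMetricityQuot n) := by
  rw [← LinearMap.ker_eq_bot]
  exact Submodule.ker_liftQ_eq_bot' _ _ ker_nonMetricityMap.symm

/-- Translate a given Galilei frame by the constant matrix that carries it to `e`. Claims about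
points of `G(M)` thereby become claims about values of local frames. -/
theorem exists_isGalileiFrame_through (e : galileiBundle S) :
    ∃ (s : ∀ x : M, Vec n ≃L[ℝ] TangentSpace (mdl n) x) (U : Set M) (hs : IsGalileiFrame S s U)
      (x : M) (hx : x ∈ U), e = ⟨frameSection s x, frameSection_mem hs hx⟩ := by
  obtain ⟨s, U, hs, he⟩ := exists_isGalileiFrame S (base e.1)
  obtain ⟨x, hx, g, rfl⟩ := hs.exists_eq_galRightMul e he
  let s' : ∀ x : M, Vec n ≃L[ℝ] TangentSpace (mdl n) x := fun x =>
    frameIso (rightMul g.1 (frameSection s x))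
  have h : ∀ y, frameSection s' y = rightMul g.1 (frameSection s y) := fun y => rfl
  have hs' : IsGalileiFrame S s' U :=
    ⟨⟨hs.1.1, (contMDiff_rightMul g.1).comp_contMDiffOn hs.1.2⟩, fun y hy =>
      rightMul_mem g.2 (frameSection_mem hs hy)⟩
  exact ⟨s', U, hs', x, hx, rfl⟩

/-- The difference of the two vectors is vertical. -/
theorem IsGalileiConnectionForm.mkQ_eq_of_mfderiv_base_eq {θ : GalForm S (Gl n)}
    (hθ : IsGalileiConnectionForm θ) {e : galileiBundle S}
    {ξ : TangentSpace (frameMdl n) e.1} {hξ : ξ ∈ subTangent (frameMdl n) (galileiBundle S) e.1}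
    {ζ : TangentSpace (frameMdl n) e.1} {hζ : ζ ∈ subTangent (frameMdl n) (galileiBundle S) e.1}
    (h : mfderiv (frameMdl n) (mdl n) (base : FrameBundle n M → M) e.1 ξ =
      mfderiv (frameMdl n) (mdl n) (base : FrameBundle n M → M) e.1 ζ) :
    (galAlg n).mkQ (θ e ⟨ξ, hξ⟩) = (galAlg n).mkQ (θ e ⟨ζ, hζ⟩) := by
  refine (Submodule.Quotient.eq _).2 ?_
  have h1 := hθ.mem_galAlg_of_vertical e (⟨ξ, hξ⟩ - ⟨ζ, hζ⟩)
    ((ContinuousLinearMap.map_sub _ _ _).trans (sub_eq_zero.2 h))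
  rw [LinearMap.map_sub] at h1
  exact h1

theorem IsGalileiConnectionForm.mkQ_eq_galileiPullback {θ : GalForm S (Gl n)}
    (hθ : IsGalileiConnectionForm θ) (hs : IsGalileiFrame S s U) {x : M} (hx : x ∈ U)
    (ξ : subTangent (frameMdl n) (galileiBundle S) (frameSection s x))
    (X : TangentSpace (mdl n) x)
    (hX : mfderiv (frameMdl n) (mdl n) (base : FrameBundle n M → M) (frameSection s x) ξ.1 = X) :
    (galAlg n).mkQ (θ ⟨frameSection s x, frameSection_mem hs hx⟩ ξ) =
      (galAlg n).mkQ (galileiPullback θ hs x X) := by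
  refine (hθ.mkQ_eq_of_mfderiv_base_eq (e := ⟨frameSection s x, frameSection_mem hs hx⟩)
    (hζ := mfderiv_frameSection_mem hs hx X)
    (hX.trans (mfderiv_base_frameSection hs.1 hx X).symm)).trans ?_
  exact congrArg (galAlg n).mkQ (galileiPullback_apply (θ := θ) hs hx X).symm

theorem IsGalileiFrame.nonMetricityQuot_covForm (hs : IsGalileiFrame S s U) {x : M} (hx : x ∈ U)
    (X : TangentSpace (mdl n) x) {φ : Vec n ≃L[ℝ] TangentSpace (mdl n) x} (hφ : φ = s x) :
    nonMetricityQuot n ((galAlg n).mkQ (covForm cov s x X)) =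
      (fun A => nonMetricityClock S cov x X (frameVec φ A),
        Matrix.of fun A B => nonMetricityMetric S cov x X (frameCovec φ A) (frameCovec φ B)) := by
  subst hφ
  refine Prod.ext (funext fun A => ?_) ?_
  · exact (hs.nonMetricityClock_frameVec hx X A).symm
  · ext A B
    exact (hs.nonMetricityMetric_frameCovec hx X A B).symm

/-- Take a Galilei frame through `e`. Modulo the Galilei algebra, `ξ` may be replaced by the vector
tangent to this section with the same projection, on which the form is `covForm`; there the local
formulas for the non-metricities apply. -/
theorem nonMetricityQuot_restrictToGalilei {Θ : FrameForm n M} (hΘ : IsPrincipalConnectionForm Θ)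
    (h : Corresponds cov Θ) (e : galileiBundle S)
    (ξ : subTangent (frameMdl n) (galileiBundle S) e.1) :
    nonMetricityQuot n ((galAlg n).mkQ (restrictToGalilei S Θ e ξ)) =
      (fun A => nonMetricityClock S cov (base e.1)
          (mfderiv (frameMdl n) (mdl n) (base : FrameBundle n M → M) e.1 ξ.1)
          (frameVec (frameIso e.1) A),
        Matrix.of fun A B => nonMetricityMetric S cov (base e.1)
          (mfderiv (frameMdl n) (mdl n) (base : FrameBundle n M → M) e.1 ξ.1)
          (frameCovec (frameIso e.1) A) (frameCovec (frameIso e.1) B)) := by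
  obtain ⟨s, U, hs, x, hx, rfl⟩ := exists_isGalileiFrame_through e
  have h1 : galileiPullback (restrictToGalilei S Θ) hs x = covForm cov s x :=
    (galileiPullback_restrictToGalilei Θ hs hx).trans (corresponds_iff.1 h s U hs.1 x hx)
  refine (congrArg (nonMetricityQuot n) (((IsPrincipalConnectionForm.restrictToGalilei
    hΘ).mkQ_eq_galileiPullback hs hx ξ _ rfl).trans (congrArg (galAlg n).mkQ
      (LinearMap.congr_fun h1 _)))).trans ?_
  exact hs.nonMetricityQuot_covForm hx _ (frameIso_frameSection x)

end

end Galilei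

end

/-! ### Assembly of the theorem -/

theorem mainTheorem2 (n : ℕ) (hn : 1 ≤ n) {M : Type*} [TopologicalSpace M] [T2Space M]
    [SecondCountableTopology M] [ChartedSpace (Galilei.Model n) M]
    [IsManifold (Galilei.mdl n) ∞ M] (S : Galilei.GalileiStructure n M) :
    -- affine connections correspond to principal connection forms on `F(M)`
    (∀ cov : Galilei.Connection n M, cov.ContMDiffCovariantDerivative ∞ →
      ∃! Θ : Galilei.FrameForm n M,
        Galilei.IsPrincipalConnectionForm Θ ∧ Galilei.Corresponds cov Θ) ∧
    (∀ Θ : Galilei.FrameForm n M, Galilei.IsPrincipalConnectionForm Θ →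
      ∃ cov : Galilei.Connection n M, cov.ContMDiffCovariantDerivative ∞ ∧
        Galilei.Corresponds cov Θ ∧
        ∀ cov' : Galilei.Connection n M, cov'.ContMDiffCovariantDerivative ∞ →
          Galilei.Corresponds cov' Θ →
          ∀ (Y : ∀ x : M, TangentSpace (Galilei.mdl n) x) (x : M),
            MDifferentiableAt (Galilei.mdl n) (Galilei.mdl n).tangent
              (fun y => (⟨y, Y y⟩ : TangentBundle (Galilei.mdl n) M)) x →
            cov' Y x = cov Y x) ∧
    -- restriction to `G(M)`: principal connection forms on `F(M)` correspond to the forms on `G(M)`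
    -- that are equivariant and reproduce the Galilei algebra on fundamental vector fields
    Set.BijOn (Galilei.restrictToGalilei S) {Θ | Galilei.IsPrincipalConnectionForm Θ}
      {θ | Galilei.IsGalileiConnectionForm θ} ∧
    -- the projection to `𝔤𝔩(n+1) / 𝔤𝔞𝔩` is tensorial
    (∀ θ : Galilei.GalForm S (Galilei.Gl n), Galilei.IsGalileiConnectionForm θ →
      Galilei.IsTensorial (Galilei.galQuotRep n)
        (fun e => (Galilei.galAlg n).mkQ.comp (θ e))) ∧
    -- the projection encodes the non-metricities `∇τ` and `∇h`
    (∃ Ψ : (Galilei.Gl n ⧸ Galilei.galAlg n) →ₗ[ℝ] Galilei.Vec n × Galilei.Gl n,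
      Function.Injective Ψ ∧
      ∀ (cov : Galilei.Connection n M) (Θ : Galilei.FrameForm n M),
        cov.ContMDiffCovariantDerivative ∞ → Galilei.IsPrincipalConnectionForm Θ →
        Galilei.Corresponds cov Θ →
        ∀ (e : Galilei.galileiBundle S)
          (ξ : Galilei.subTangent (Galilei.frameMdl n) (Galilei.galileiBundle S) e.1),
          let X : TangentSpace (Galilei.mdl n) (Galilei.base e.1) :=
            mfderiv (Galilei.frameMdl n) (Galilei.mdl n)
              (Galilei.base : Galilei.FrameBundle n M → M) e.1 ξ.1
          let φ := Galilei.frameIso e.1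
          Ψ ((Galilei.galAlg n).mkQ (Galilei.restrictToGalilei S Θ e ξ)) =
            (fun A => Galilei.nonMetricityClock S cov (Galilei.base e.1) X (Galilei.frameVec φ A),
             Matrix.of fun A B => Galilei.nonMetricityMetric S cov (Galilei.base e.1) X
               (Galilei.frameCovec φ A) (Galilei.frameCovec φ B))) ∧
    -- local expressions with respect to a local Galilei frame
    (∀ (cov : Galilei.Connection n M) (Θ : Galilei.FrameForm n M),
      cov.ContMDiffCovariantDerivative ∞ → Galilei.IsPrincipalConnectionForm Θ →
      Galilei.Corresponds cov Θ →
      ∀ (U : Set M) (s : ∀ x : M, Galilei.Vec n ≃L[ℝ] TangentSpace (Galilei.mdl n) x)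
        (hs : Galilei.IsGalileiFrame S s U),
        let ω' := Galilei.galileiPullback (Galilei.restrictToGalilei S Θ) hs
        Galilei.IsSmoothFormOn (Galilei.mdl n) ω' U ∧
        ∀ x ∈ U,
          (∀ (X : TangentSpace (Galilei.mdl n) x) (B : Galilei.Idx n),
            cov (fun y => Galilei.frameVec (s y) B) x X =
              ∑ A, ω' x X A B • Galilei.frameVec (s x) A) ∧
          -- `Q̂_A = dτ_A - ω^B_A τ_B = - ω^t_A`
          (∀ (X : TangentSpace (Galilei.mdl n) x) (A : Galilei.Idx n),
            Galilei.nonMetricityClock S cov x X (Galilei.frameVec (s x) A) =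
                mvfderiv (Galilei.mdl n) (fun y => S.clock y (Galilei.frameVec (s y) A)) x X
                  - ∑ B, ω' x X B A * S.clock x (Galilei.frameVec (s x) B) ∧
            Galilei.nonMetricityClock S cov x X (Galilei.frameVec (s x) A) =
              - ω' x X Galilei.idxT A) ∧
          -- `Q^{AB} = dh^{AB} + ω^A_C h^{CB} + ω^B_C h^{AC} = ω^A_c δ^{cb} δ^B_b + ω^B_c δ^{ac} δ^A_a`
          (∀ (X : TangentSpace (Galilei.mdl n) x),
            let Q : Galilei.Idx n → Galilei.Idx n → ℝ := fun A B =>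
              Galilei.nonMetricityMetric S cov x X
                (Galilei.frameCovec (s x) A) (Galilei.frameCovec (s x) B)
            let hh : M → Galilei.Idx n → Galilei.Idx n → ℝ := fun y A B =>
              Galilei.frameCovec (s y) A (S.metric y (Galilei.frameCovec (s y) B))
            (∀ A B, Q A B = mvfderiv (Galilei.mdl n) (fun y => hh y A B) x X
                + ∑ C, ω' x X A C * hh x C B + ∑ C, ω' x X B C * hh x A C) ∧
            (∀ A B, Q A B =
                (∑ c : Fin n, ω' x X A (Galilei.idxS c) * if B = Galilei.idxS c then 1 else 0)
                + ∑ c : Fin n, ω' x X B (Galilei.idxS c) * if A = Galilei.idxS c then 1 else 0) ∧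
            Q Galilei.idxT Galilei.idxT = 0 ∧
            (∀ a : Fin n,
              Q Galilei.idxT (Galilei.idxS a) = ω' x X Galilei.idxT (Galilei.idxS a) ∧
              Q (Galilei.idxS a) Galilei.idxT = ω' x X Galilei.idxT (Galilei.idxS a)) ∧
            (∀ a b : Fin n, Q (Galilei.idxS a) (Galilei.idxS b) =
              ω' x X (Galilei.idxS a) (Galilei.idxS b)
                + ω' x X (Galilei.idxS b) (Galilei.idxS a))) ∧
          -- `Ω = δ_{ab} ϖ^a ∧ e^b` with `ϖ^a = ω^a_t`
          (∀ X Y : TangentSpace (Galilei.mdl n) x,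
            Galilei.newtonCoriolis S cov (fun y => Galilei.frameVec (s y) Galilei.idxT) x X Y =
              ∑ a : Fin n,
                (ω' x X (Galilei.idxS a) Galilei.idxT * Galilei.frameCovec (s x) (Galilei.idxS a) Y
                - ω' x Y (Galilei.idxS a) Galilei.idxT
                  * Galilei.frameCovec (s x) (Galilei.idxS a) X))) := by
  refine ⟨fun cov hcov => Galilei.existsUnique_corresponds_of_connection hcov, fun Θ hΘ => ?_,
    Galilei.bijOn_restrictToGalilei, fun θ hθ => hθ.isTensorial,
    ⟨Galilei.nonMetricityQuot n, Galilei.injective_nonMetricityQuot, fun cov Θ _ hΘ h e ξ =>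
      Galilei.nonMetricityQuot_restrictToGalilei hΘ h e ξ⟩, ?_⟩
  · obtain ⟨cov, hcov, h⟩ := Galilei.exists_connection_of_isPrincipalConnectionForm hΘ
    exact ⟨cov, hcov, h, fun cov' _ h' Y x hY => h.eq_connection h' hY⟩
  · intro cov Θ _ hΘ h U s hs ω'
    refine ⟨Galilei.isSmoothFormOn_galileiPullback hΘ.restrictToGalilei.smooth hs, fun x hx => ?_⟩
    -- The pullback is the matrix of the covariant derivative, so every local expression becomes a
    -- statement about `covForm`.
    have hω : ω' x = Galilei.covForm cov s x := by
      refine (Galilei.galileiPullback_restrictToGalilei Θ hs hx).trans ?_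
      exact Galilei.corresponds_iff.1 h s U hs.1 x hx
    rw [hω]
    refine ⟨fun X B => (Galilei.sum_frameCovec_smul (s x) _).symm, fun X A =>
      ⟨Galilei.nonMetricityClock_frameVec hs.1 hx X A, hs.nonMetricityClock_frameVec hx X A⟩,
      fun X => ?_, fun X Y => hs.newtonCoriolis_eq hx X Y⟩
    -- The explicit entries follow from this because right multiplication by `spaceDiag n`
    -- annihilates the column `t` and keeps the spatial columns.
    have hQ := hs.nonMetricityMetric_frameCovec (cov := cov) hx X
    refine ⟨Galilei.nonMetricityMetric_frameCovec hs.1 hx X, fun A B => ?_, ?_, fun a => ⟨?_, ?_⟩,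
      fun a b => ?_⟩
    · rw [← Galilei.mul_spaceDiag_apply, ← Galilei.mul_spaceDiag_apply]
      exact hQ A B
    · refine (hQ _ _).trans ?_
      rw [Galilei.mul_spaceDiag_idxT, add_zero]
    · refine (hQ _ _).trans ?_
      rw [Galilei.mul_spaceDiag_idxT, Galilei.mul_spaceDiag_idxS, add_zero]
    · refine (hQ _ _).trans ?_
      rw [Galilei.mul_spaceDiag_idxT, Galilei.mul_spaceDiag_idxS, zero_add]
    · refine (hQ _ _).trans ?_
      rw [Galilei.mul_spaceDiag_idxS, Galilei.mul_spaceDiag_idxS]
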